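/- Let $N_g$ ($g\ge 1$) be the closed connected non-orientable surface of genus $g$ (the connected sum of $g$ real projective planes), and let $\iota$ be an involution on $N_g$, i.e. a homeomorphism with $\iota\circ\iota=\mathrm{id}$. A \emph{reflection curve} of $\iota$ is a simple closed curve (regarded as a subset of the surface) fixed pointwise by $\iota$; it is \emph{one-sided} (resp. \emph{two-sided}) if it is the core of a Möbius band (resp. an annulus) that is a neighbourhood of it. Let $n_1(\iota)$ and $n_2(\iota)$ be the numbers of one-sided and of two-sided reflection curves of $\iota$. Let $x_0$ be a fixed point of $\iota$. Choose a coordinate disk about $x_0$ on which $\iota$ acts as a rotation or as a reflection: an open embedding $e$ of $\{z\in\mathbb{C} : |z|<R\}$, for some $R>1$, into $N_g$ with $e(0)=x_0$ such that either $\iota(e(z))=e(-z)$ for all $z$, or $\iota(e(z))=e(\overline z)$ for all $z$. The \emph{blowup} of $N_g$ at $x_0$ is the surface $N'$ obtained from $N_g\setminus e(\{|z|<1\})$ by identifying $e(z)$ with $e(-z)$ for all $|z|=1$ (a model of $N_{g+1}$), and $\tilde\iota([x])=[\iota(x)]$ is the induced involution on $N'$. Then: 1. If $x_0$ is an isolated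 fixed point of $\iota$, then $n_1(\tilde\iota)=n_1(\iota)+1$ and $n_2(\tilde\iota)=n_2(\iota)$. 2. If $x_0$ lies on a one-sided reflection curve of $\iota$, then $n_1(\tilde\iota)+1=n_1(\iota)$ and $n_2(\tilde\iota)=n_2(\iota)+1$. If $x_0$ lies on a two-sided reflection curve of $\iota$, then $n_2(\tilde\iota)+1=n_2(\iota)$ and $n_1(\tilde\iota)=n_1(\iota)+1$. -/

import Mathlib

namespace SurfaceBlowup

open Topology

/-! ### Closed non-orientable surfaces -/

/-- The sphere `ℂ ∪ {∞}` with the `g` disjoint open disks of radius `1/3` about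
`0, 1, …, g - 1` removed. -/
def PuncturedSphere (g : ℕ) : Type :=
  {x : OnePoint ℂ // ∀ k : ℕ, k < g → x ∉ ((↑) : ℂ → OnePoint ℂ) '' Metric.ball (k : ℂ) (1 / 3)}

instance (g : ℕ) : TopologicalSpace (PuncturedSphere g) :=
  inferInstanceAs (TopologicalSpace
    {x : OnePoint ℂ // ∀ k : ℕ, k < g →
      x ∉ ((↑) : ℂ → OnePoint ℂ) '' Metric.ball (k : ℂ) (1 / 3)})

theorem center_unique {k l : ℕ} {u v : ℂ} (hu : ‖u‖ = 1 / 3) (hv : ‖v‖ = 1 / 3)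
    (h : (k : ℂ) - u = l + v) : k = l := by
  have h1 : ((k : ℤ) - (l : ℤ) : ℂ) = u + v := by push_cast; linear_combination h
  have h2 : ‖((k : ℤ) - (l : ℤ) : ℂ)‖ < 1 := by
    rw [h1]
    calc ‖u + v‖ ≤ ‖u‖ + ‖v‖ := norm_add_le _ _
      _ < 1 := by rw [hu, hv]; norm_num
  have h3 : |(k : ℤ) - (l : ℤ)| < 1 := by
    have : ((k : ℤ) - (l : ℤ) : ℂ) = (((k : ℤ) - (l : ℤ) : ℤ) : ℂ) := by push_cast; rfl
    rw [this, Complex.norm_intCast] at h2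
    exact_mod_cast h2
  have := Int.abs_lt_one_iff.mp h3
  omega

/-- Antipodal points of each of the `g` boundary circles are identified. -/
def crosscapSetoid (g : ℕ) : Setoid (PuncturedSphere g) where
  r x y := x = y ∨ ∃ k : ℕ, k < g ∧ ∃ u : ℂ, ‖u‖ = 1 / 3 ∧
    x.1 = ((k + u : ℂ) : OnePoint ℂ) ∧ y.1 = ((k - u : ℂ) : OnePoint ℂ)
  iseqv :=
    { refl := fun _ => Or.inl rfl
      symm := by
        rintro x y (rfl | ⟨k, hk, u, hu, hx, hy⟩)
        · exact Or.inl rfl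
        · exact Or.inr ⟨k, hk, -u, by rwa [norm_neg], by rw [hy, sub_eq_add_neg],
            by rw [hx, sub_neg_eq_add]⟩
      trans := by
        rintro x y z (rfl | ⟨k, hk, u, hu, hx, hy⟩) h
        · exact h
        · rcases h with rfl | ⟨l, hl, v, hv, hy', hz⟩
          · exact Or.inr ⟨k, hk, u, hu, hx, hy⟩
          · have h1 : (k : ℂ) - u = l + v := OnePoint.coe_injective (hy.symm.trans hy')
            obtain rfl := center_unique hu hv h1
            left
            apply Subtype.ext
            rw [hx, hz]
            congr 1
            linear_combination -h1 }

/-- `N_g`: the sphere with `g` crosscaps, that is, the connected sum of `g` real projective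
planes. -/
def NonorientableSurface (g : ℕ) : Type := Quotient (crosscapSetoid g)

instance (g : ℕ) : TopologicalSpace (NonorientableSurface g) :=
  inferInstanceAs (TopologicalSpace (Quotient (crosscapSetoid g)))

/-! ### One-sided and two-sided simple closed curves -/

/-- `(x, t) ∼ (x + n, εⁿ t)` on the plane, for integers `n`, where `ε = ± 1`. -/
def bandSetoid (ε : ℤˣ) : Setoid (ℝ × ℝ) where
  r p q := ∃ n : ℤ, q = (p.1 + n, (((ε ^ n : ℤˣ) : ℤ) : ℝ) * p.2)
  iseqv :=
    { refl := fun p => ⟨0, by simp⟩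
      symm := by
        rintro p q ⟨n, rfl⟩
        refine ⟨-n, ?_⟩
        have h : ((((ε ^ (-n) : ℤˣ) : ℤ) : ℝ)) * (((ε ^ n : ℤˣ) : ℤ) : ℝ) = 1 := by
          rw [← Int.cast_mul, ← Units.val_mul, ← zpow_add]; simp
        ext
        · simp
        · simp only [← mul_assoc, h, one_mul]
      trans := by
        rintro p q r ⟨n, rfl⟩ ⟨m, rfl⟩
        refine ⟨n + m, ?_⟩
        ext
        · simp [add_assoc]
        · simp only [← mul_assoc, ← Int.cast_mul, ← Units.val_mul, ← zpow_add, add_comm m n] }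

/-- The open annulus (`ε = 1`) and the open Möbius band (`ε = -1`). -/
def Band (ε : ℤˣ) : Type := Quotient (bandSetoid ε)

instance (ε : ℤˣ) : TopologicalSpace (Band ε) :=
  inferInstanceAs (TopologicalSpace (Quotient (bandSetoid ε)))

/-- The core circle `t = 0` of the band. -/
def Band.core (ε : ℤˣ) : Set (Band ε) :=
  Set.range fun x : ℝ => (Quotient.mk (bandSetoid ε) (x, 0) : Band ε)

section Curves

variable {S : Type*} [TopologicalSpace S]

/-- The subset `γ` is a simple closed curve (curves are identified with their images). -/
def IsSimpleClosedCurve (γ : Set S) : Prop := Nonempty (Circle ≃ₜ γ)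

/-- `γ` is the core of an open annulus (`ε = 1`) or open Möbius band (`ε = -1`) in `S`. -/
def IsBandCore (ε : ℤˣ) (γ : Set S) : Prop :=
  ∃ f : Band ε → S, IsOpenEmbedding f ∧ f '' Band.core ε = γ

/-- `γ` has a neighbourhood that is a Möbius band with core `γ`. -/
def IsOneSided (γ : Set S) : Prop := IsBandCore (-1) γ

/-- `γ` has a neighbourhood that is an annulus with core `γ`. -/
def IsTwoSided (γ : Set S) : Prop := IsBandCore 1 γ

/-- A reflection curve of `ι`: a simple closed curve fixed pointwise by `ι`. -/
def IsReflectionCurve (ι : S → S) (γ : Set S) : Prop :=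
  IsSimpleClosedCurve γ ∧ ∀ x ∈ γ, ι x = x

/-- The number of one-sided reflection curves of `ι`. -/
noncomputable def numOneSided (ι : S → S) : ℕ∞ :=
  {γ : Set S | IsReflectionCurve ι γ ∧ IsOneSided γ}.encard

/-- The number of two-sided reflection curves of `ι`. -/
noncomputable def numTwoSided (ι : S → S) : ℕ∞ :=
  {γ : Set S | IsReflectionCurve ι γ ∧ IsTwoSided γ}.encard

/-- `x` is isolated in the fixed point set of `ι`. -/
def IsIsolatedFixedPoint (ι : S → S) (x : S) : Prop :=
  ι x = x ∧ ∃ U ∈ 𝓝 x, ∀ y ∈ U, ι y = y → y = x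

/-! ### Blowups -/

/-- An `ι`-invariant coordinate disk with centre `x₀`. The disk itself is `D = e(𝔻)` for the closed
unit disk `𝔻`; as usual for embedded disks in a surface, the coordinate `e` is defined on a
neighbourhood of `𝔻`, so that `∂D` has an (`ι`-invariant) regular neighbourhood.
Values of `e` outside the open disk of radius `R > 1` play no role. -/
structure InvariantDisk (ι : S → S) (x₀ : S) where
  /-- the coordinate -/
  e : ℂ → S
  /-- the radius of the disk on which the coordinate is used -/
  R : ℝ
  one_lt_R : 1 < R
  isOpenEmbedding : IsOpenEmbedding ((Metric.ball (0 : ℂ) R).domRestrict e)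
  map_zero : e 0 = x₀
  /-- `ι` acts as the rotation `z ↦ -z` or as the reflection `z ↦ conj z` -/
  equivariant : (∀ z ∈ Metric.ball (0 : ℂ) R, ι (e z) = e (-z)) ∨
    (∀ z ∈ Metric.ball (0 : ℂ) R, ι (e z) = e (starRingEnd ℂ z))

namespace InvariantDisk

variable {ι : S → S} {x₀ : S} (D : InvariantDisk ι x₀)

theorem mem_ball {z : ℂ} (hz : ‖z‖ ≤ 1) : z ∈ Metric.ball (0 : ℂ) D.R := by
  simpa using hz.trans_lt D.one_lt_R

theorem e_inj {z w : ℂ} (hz : ‖z‖ ≤ 1) (hw : ‖w‖ ≤ 1) (h : D.e z = D.e w) : z = w :=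
  congrArg Subtype.val
    (@D.isOpenEmbedding.injective ⟨z, D.mem_ball hz⟩ ⟨w, D.mem_ball hw⟩ h)

/-- `S - int D`. -/
def Exterior : Type _ := {x : S // x ∉ D.e '' Metric.ball (0 : ℂ) 1}

instance : TopologicalSpace D.Exterior :=
  inferInstanceAs (TopologicalSpace {x : S // x ∉ D.e '' Metric.ball (0 : ℂ) 1})

/-- `e(z)` and `e(-z)` are identified for `z ∈ ∂𝔻`. -/
def antipodal : Setoid D.Exterior where
  r x y := x = y ∨ ∃ z : ℂ, ‖z‖ = 1 ∧ x.1 = D.e z ∧ y.1 = D.e (-z)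
  iseqv :=
    { refl := fun _ => Or.inl rfl
      symm := by
        rintro x y (rfl | ⟨z, hz, hx, hy⟩)
        · exact Or.inl rfl
        · exact Or.inr ⟨-z, by rwa [norm_neg], hy, by rwa [neg_neg]⟩
      trans := by
        rintro x y w (rfl | ⟨z, hz, hx, hy⟩) h
        · exact h
        · rcases h with rfl | ⟨z', hz', hy', hw⟩
          · exact Or.inr ⟨z, hz, hx, hy⟩
          · have : -z = z' := D.e_inj (by rw [norm_neg, hz]) hz'.le (hy.symm.trans hy')
            left
            apply Subtype.ext
            rw [hx, hw, ← this, neg_neg] }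

/-- The surface obtained from `S` by the blowup on `D`. -/
def Blowup : Type _ := Quotient D.antipodal

instance : TopologicalSpace D.Blowup :=
  inferInstanceAs (TopologicalSpace (Quotient D.antipodal))

theorem map_exterior (hι : Function.Involutive ι) (x : D.Exterior) :
    ι x.1 ∉ D.e '' Metric.ball (0 : ℂ) 1 := by
  rintro ⟨z, hz, h⟩
  have hz' : ‖z‖ < 1 := by simpa using hz
  apply x.2
  have hx : x.1 = ι (D.e z) := by rw [h, hι]
  rcases D.equivariant with he | he
  · exact ⟨-z, by simpa using hz', by rw [hx, he z (D.mem_ball hz'.le)]⟩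
  · exact ⟨starRingEnd ℂ z, by simpa using hz', by rw [hx, he z (D.mem_ball hz'.le)]⟩

/-- The map `[x] ↦ [ι x]` induced by `ι` on the blowup. -/
def blowupMap (hι : Function.Involutive ι) : D.Blowup → D.Blowup :=
  Quotient.map (fun x : D.Exterior => (⟨ι x.1, D.map_exterior hι x⟩ : D.Exterior)) (by
    rintro x y (rfl | ⟨z, hz, hx, hy⟩)
    · exact Or.inl rfl
    · have hb := D.mem_ball hz.le
      have hb' : -z ∈ Metric.ball (0 : ℂ) D.R := D.mem_ball (by rw [norm_neg, hz])
      rcases D.equivariant with he | he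
      · exact Or.inr ⟨-z, by rwa [norm_neg], by simp only [hx, he z hb], by simp only [hy, he _ hb']⟩
      · exact Or.inr ⟨starRingEnd ℂ z, by simpa using hz, by simp only [hx, he z hb],
          by simp only [hy, he _ hb', map_neg]⟩)

end InvariantDisk

/-- `ι'` on `S'` is obtained from the involution `ι` on `S` by the blowup of `S` at the fixed point
`x₀`: for some invariant disk `D` about `x₀`, the surface `S'` is identified with the blowup of `S`
on `D` through a homeomorphism `F`, and `ι'` is the map induced by `ι`. -/
def IsObtainedByBlowup {S' : Type*} [TopologicalSpace S'] (ι : S → S)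
    (hι : Function.Involutive ι) (x₀ : S) (ι' : S' → S') : Prop :=
  ∃ (D : InvariantDisk ι x₀) (F : D.Blowup ≃ₜ S'), ∀ p, ι' (F p) = F (D.blowupMap hι p)

end Curves

end SurfaceBlowup

/-! Outside the closed unit disk the blowup changes nothing. The part `outer` is open in both
surfaces with the same involution, and being the core of an annulus or a Möbius band is a local
property, so the curves avoiding the disk downstairs and those avoiding the exceptional circle
upstairs are equally many (`encard_outer`). It remains to find the reflection curves that meet the
disk, respectively the exceptional circle. All counts are compared by adding one in `ℕ∞`, so
finiteness plays no role.

If `ι` is a rotation on the disk, the centre is its only fixed point there, and no curve passes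
through an isolated fixed point. Upstairs the rotation acts on the unit circle as the antipodal map,
which the identification turns into the identity. Thus the exceptional circle is a new reflection
curve. It is one-sided, because an annulus whose inner boundary is glued antipodally is a Möbius
band (`isBandLift_polarLift`).

If `ι` is a reflection on the disk, its fixed points there form the real diameter. Let a curve of
type `ε` pass through the centre. Near the centre `ι` swaps the two sides of the curve; by
connectedness it does so all along it, hence the curve is relatively open in the fixed point set and
is the only reflection curve meeting the disk. Upstairs the segment `[-1, 1]` is removed and its
ends are identified. A strip about the curve is cut at the disk and reglued by `z ↦ -z`, which
reverses the height, so the strict transform has type `-ε` (`IsAdapted.chartMap_one`). The only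
other fixed point on the exceptional circle is the class of `i` and `-i`, which is isolated. One
curve of type `ε` is lost and one of type `-ε` is gained.

The regluing is visible only when the band about the curve agrees with the coordinate of the disk
near the diameter. For an arbitrary topological band this is arranged in
`IsBandLift.exists_adapted`, by a compactly supported homeomorphism built as a commutator. Other
ingredients are that annulus cores are not Möbius cores (`IsBandCore.not_isBandCore_neg_one`), and
that a relatively clopen fixed core equals every fixed core meeting it (`fixedCores_eq_of_mem`). -/

namespace SurfaceBlowup

open Topology Set

/-! ### Coordinates on bands -/

section BandLift

variable {Y : Type*} [TopologicalSpace Y] {ε : ℤˣ} {δ : ℝ} {F : ℝ × ℝ → Y}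

/-- The open strip `|t| < δ` in the plane. -/
def strip (δ : ℝ) : Set (ℝ × ℝ) := {p | |p.2| < δ}

theorem isOpen_strip (δ : ℝ) : IsOpen (strip δ) :=
  isOpen_lt (by fun_prop) continuous_const

theorem strip_mono {δ δ' : ℝ} (h : δ ≤ δ') : strip δ ⊆ strip δ' := fun p (hp : |p.2| < δ) =>
  show |p.2| < δ' from hp.trans_le h

theorem core_mem_strip (hδ : 0 < δ) (x : ℝ) : (x, (0 : ℝ)) ∈ strip δ := by
  simpa [strip] using hδ

/-- The sign `εⁿ` as a real number. -/
def signPow (ε : ℤˣ) (n : ℤ) : ℝ := ((ε ^ n : ℤˣ) : ℤ)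

theorem signPow_eq_or (ε : ℤˣ) (n : ℤ) : signPow ε n = 1 ∨ signPow ε n = -1 := by
  rcases Int.units_eq_one_or (ε ^ n) with h | h <;> simp [signPow, h]

theorem signPow_zero (ε : ℤˣ) : signPow ε 0 = 1 := by simp [signPow]

theorem signPow_one (n : ℤ) : signPow 1 n = 1 := by simp [signPow]

theorem signPow_one_right (ε : ℤˣ) : signPow ε 1 = ((ε : ℤ) : ℝ) := by simp [signPow]

theorem signPow_add (ε : ℤˣ) (m n : ℤ) : signPow ε (m + n) = signPow ε m * signPow ε n := by
  simp [signPow, zpow_add]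

theorem signPow_neg (ε : ℤˣ) (n : ℤ) : signPow ε (-n) = signPow ε n := by
  rcases Int.units_eq_one_or (ε ^ n) with h | h <;> simp [signPow, zpow_neg, h]

theorem signPow_mul_self (ε : ℤˣ) (n : ℤ) : signPow ε n * signPow ε n = 1 := by
  rcases signPow_eq_or ε n with h | h <;> simp [h]

theorem abs_signPow (ε : ℤˣ) (n : ℤ) : |signPow ε n| = 1 := by
  rcases signPow_eq_or ε n with h | h <;> simp [h]

/-- The deck transformation `(x, t) ↦ (x + n, εⁿ t)`. -/
def deck (ε : ℤˣ) (n : ℤ) (p : ℝ × ℝ) : ℝ × ℝ := (p.1 + n, signPow ε n * p.2)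

theorem band_rel_iff {p q : ℝ × ℝ} : (bandSetoid ε).r p q ↔ ∃ n : ℤ, q = deck ε n p := Iff.rfl

theorem continuous_deck (ε : ℤˣ) (n : ℤ) : Continuous (deck ε n) := by
  unfold deck; fun_prop

theorem deck_deck (ε : ℤˣ) (m n : ℤ) (p : ℝ × ℝ) : deck ε m (deck ε n p) = deck ε (n + m) p := by
  simp only [deck, signPow_add]; ext
  · push_cast; ring
  · simp only; ring

theorem deck_zero (ε : ℤˣ) (p : ℝ × ℝ) : deck ε 0 p = p := by simp [deck, signPow_zero]

theorem deck_mem_strip {n : ℤ} {p : ℝ × ℝ} : deck ε n p ∈ strip δ ↔ p ∈ strip δ := by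
  simp [deck, strip, abs_mul, abs_signPow]

theorem eq_deck_neg {n : ℤ} {p q : ℝ × ℝ} (h : q = deck ε n p) : p = deck ε (-n) q := by
  rw [h, deck_deck, add_neg_cancel, deck_zero]

/-- The projection of the plane onto the band. -/
def Band.mk (ε : ℤˣ) (p : ℝ × ℝ) : Band ε := Quotient.mk (bandSetoid ε) p

theorem Band.continuous_mk (ε : ℤˣ) : Continuous (Band.mk ε) := continuous_quot_mk

theorem Band.mk_eq_iff {p q : ℝ × ℝ} : Band.mk ε p = Band.mk ε q ↔ (bandSetoid ε).r p q :=
  Quotient.eq (r := bandSetoid ε)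

theorem Band.isOpen_iff {U : Set (Band ε)} : IsOpen U ↔ IsOpen (Band.mk ε ⁻¹' U) :=
  isQuotientMap_quot_mk.isOpen_preimage.symm

/-- The union of the translates of a set under the deck transformations. -/
def saturation (ε : ℤˣ) (O : Set (ℝ × ℝ)) : Set (ℝ × ℝ) := ⋃ n : ℤ, deck ε n ⁻¹' O

theorem isOpen_saturation {O : Set (ℝ × ℝ)} (hO : IsOpen O) : IsOpen (saturation ε O) :=
  isOpen_iUnion fun n => hO.preimage (continuous_deck ε n)

theorem mem_saturation {O : Set (ℝ × ℝ)} {q : ℝ × ℝ} :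
    q ∈ saturation ε O ↔ ∃ p ∈ O, (bandSetoid ε).r p q := by
  simp only [saturation, mem_iUnion, mem_preimage, band_rel_iff]
  constructor
  · rintro ⟨n, hn⟩
    exact ⟨_, hn, -n, eq_deck_neg rfl⟩
  · rintro ⟨p, hp, n, rfl⟩
    exact ⟨-n, by rwa [deck_deck, add_neg_cancel, deck_zero]⟩

theorem Band.preimage_image_mk (O : Set (ℝ × ℝ)) :
    Band.mk ε ⁻¹' (Band.mk ε '' O) = saturation ε O := by
  ext q
  simp only [mem_preimage, mem_image, mem_saturation, Band.mk_eq_iff]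

theorem Band.isOpenMap_mk (ε : ℤˣ) : IsOpenMap (Band.mk ε) := fun O hO =>
  Band.isOpen_iff.2 (by rw [Band.preimage_image_mk]; exact isOpen_saturation hO)

theorem Band.core_eq (ε : ℤˣ) : Band.core ε = range fun x : ℝ => Band.mk ε (x, 0) := rfl

/-- `F` describes an open band of width `δ` in `Y` in terms of its universal cover. -/
structure IsBandLift (ε : ℤˣ) (δ : ℝ) (F : ℝ × ℝ → Y) : Prop where
  pos : 0 < δ
  continuousOn : ContinuousOn F (strip δ)
  isOpen_image : ∀ O ⊆ strip δ, IsOpen O → IsOpen (F '' O)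
  eq_iff : ∀ p ∈ strip δ, ∀ q ∈ strip δ, F p = F q ↔ (bandSetoid ε).r p q

theorem IsBandLift.mono (hF : IsBandLift ε δ F) {δ' : ℝ} (h0 : 0 < δ') (h : δ' ≤ δ) :
    IsBandLift ε δ' F where
  pos := h0
  continuousOn := hF.continuousOn.mono (strip_mono h)
  isOpen_image := fun O hO => hF.isOpen_image O (hO.trans (strip_mono h))
  eq_iff := fun p hp q hq => hF.eq_iff p (strip_mono h hp) q (strip_mono h hq)

theorem IsBandLift.deck_eq (hF : IsBandLift ε δ F) {p : ℝ × ℝ} (hp : p ∈ strip δ) (n : ℤ) :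
    F (deck ε n p) = F p :=
  ((hF.eq_iff p hp _ (deck_mem_strip.2 hp)).2 ⟨n, rfl⟩).symm

theorem IsBandLift.eq_of_dist_lt (hF : IsBandLift ε δ F) {p q : ℝ × ℝ} (hp : p ∈ strip δ)
    (hq : q ∈ strip δ) (h : F p = F q) (hpq : |q.1 - p.1| < 1) : p = q := by
  obtain ⟨n, rfl⟩ := band_rel_iff.1 ((hF.eq_iff p hp q hq).1 h)
  have : |(n : ℝ)| < 1 := by simpa [deck] using hpq
  have hn : n = 0 := Int.abs_lt_one_iff.1 (by exact_mod_cast this)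
  rw [hn, deck_zero]

theorem IsBandLift.mem_core_iff (hF : IsBandLift ε δ F) {p : ℝ × ℝ} (hp : p ∈ strip δ) :
    F p ∈ (range fun x : ℝ => F (x, 0)) ↔ p.2 = 0 := by
  constructor
  · rintro ⟨x, hx⟩
    obtain ⟨n, hn⟩ := band_rel_iff.1 ((hF.eq_iff _ (core_mem_strip hF.pos x) p hp).1 hx)
    rw [hn]; simp [deck]
  · intro h
    exact ⟨p.1, by rw [← h]⟩

theorem IsOpenEmbedding.isBandLift {f : Band ε → Y} (hf : IsOpenEmbedding f) (hδ : 0 < δ) :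
    IsBandLift ε δ (f ∘ Band.mk ε) where
  pos := hδ
  continuousOn := (hf.continuous.comp (Band.continuous_mk ε)).continuousOn
  isOpen_image := fun O _ hO => by
    rw [image_comp]; exact hf.isOpenMap _ (Band.isOpenMap_mk ε _ hO)
  eq_iff := fun p _ q _ => by
    simp only [Function.comp, hf.injective.eq_iff, Band.mk_eq_iff]

/-- The map `t ↦ δt / (1 + |t|)` takes the line homeomorphically onto `(-δ, δ)`. It is odd, so it
commutes with the deck transformations and turns a full band into one of width `δ`. -/
theorem squeeze_mem {δ : ℝ} (hδ : 0 < δ) (t : ℝ) : |δ * t / (1 + |t|)| < δ := by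
  have h : 0 < 1 + |t| := by positivity
  rw [abs_div, abs_mul, abs_of_pos hδ, abs_of_pos h, div_lt_iff₀ h]
  nlinarith [abs_nonneg t]

theorem squeeze_inv {δ : ℝ} (hδ : 0 < δ) (t : ℝ) :
    (δ * t / (1 + |t|)) / (δ - |δ * t / (1 + |t|)|) = t := by
  have h : 0 < 1 + |t| := by positivity
  rw [abs_div, abs_mul, abs_of_pos hδ, abs_of_pos h]
  have : δ - δ * |t| / (1 + |t|) = δ / (1 + |t|) := by field_simp; ring
  rw [this]; field_simp

theorem inv_squeeze {δ : ℝ} {s : ℝ} (hs : |s| < δ) :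
    δ * (s / (δ - |s|)) / (1 + |s / (δ - |s|)|) = s := by
  have h : 0 < δ - |s| := by linarith
  rw [abs_div, abs_of_pos h]
  have h1 : 1 + |s| / (δ - |s|) = δ / (δ - |s|) := by field_simp; ring
  have h2 : δ ≠ 0 := (lt_of_le_of_lt (abs_nonneg s) hs).ne'
  rw [h1]; field_simp

theorem IsBandLift.exists_isOpenEmbedding (hF : IsBandLift ε δ F) :
    ∃ f : Band ε → Y, IsOpenEmbedding f ∧ (∀ x, f (Band.mk ε (x, 0)) = F (x, 0)) := by
  have hδ := hF.pos
  let q : ℝ × ℝ → ℝ × ℝ := fun p => (p.1, δ * p.2 / (1 + |p.2|))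
  have hqs : ∀ p, q p ∈ strip δ := fun p => squeeze_mem hδ p.2
  have hqc : Continuous q := by
    refine Continuous.prodMk continuous_fst (Continuous.div (by fun_prop) (by fun_prop) ?_)
    intro p; positivity
  have hqd : ∀ n p, q (deck ε n p) = deck ε n (q p) := by
    intro n p
    simp only [q, deck, abs_mul, abs_signPow, one_mul]
    ext
    · rfl
    · simp only; ring
  have hqi : ∀ p p', q p = q p' → p = p' := by
    intro p p' h
    have h1 := congrArg Prod.fst h
    have h2 := congrArg Prod.snd h
    simp only [q] at h1 h2
    ext
    · exact h1
    · rw [← squeeze_inv hδ p.2, h2, squeeze_inv hδ]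
  have hrel : ∀ p p', F (q p) = F (q p') ↔ (bandSetoid ε).r p p' := by
    intro p p'
    rw [hF.eq_iff _ (hqs p) _ (hqs p'), band_rel_iff, band_rel_iff]
    refine exists_congr fun n => ?_
    rw [← hqd]
    exact ⟨fun h => hqi _ _ h, fun h => by rw [h]⟩
  have hqo : ∀ V, IsOpen V → IsOpen (q '' V) := by
    intro V hV
    have hc : ContinuousOn (fun p : ℝ × ℝ => (p.1, p.2 / (δ - |p.2|))) (strip δ) := by
      refine ContinuousOn.prodMk continuousOn_fst (ContinuousOn.div (by fun_prop) (by fun_prop) ?_)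
      intro p hp
      have : |p.2| < δ := hp
      linarith
    convert hc.isOpen_inter_preimage (isOpen_strip δ) hV using 1
    ext p
    constructor
    · rintro ⟨p, hp, rfl⟩
      refine ⟨hqs p, ?_⟩
      simp only [q, mem_preimage, squeeze_inv hδ]
      exact hp
    · rintro ⟨hp, hp'⟩
      exact ⟨_, hp', by simp only [q]; rw [inv_squeeze hp]⟩
  let f : Band ε → Y := Quotient.lift (fun p => F (q p)) fun p p' h => (hrel p p').2 h
  have hf : ∀ p, f (Band.mk ε p) = F (q p) := fun p => rfl
  refine ⟨f, IsOpenEmbedding.of_continuous_injective_isOpenMap ?_ ?_ ?_, ?_⟩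
  · refine Continuous.quotient_lift ?_ _
    exact hF.continuousOn.comp_continuous hqc hqs
  · intro a b
    induction a using Quotient.inductionOn with | _ p => ?_
    induction b using Quotient.inductionOn with | _ p' => ?_
    intro h
    exact Band.mk_eq_iff.2 ((hrel p p').1 h)
  · intro U hU
    have : f '' U = F '' (q '' (Band.mk ε ⁻¹' U)) := by
      ext y
      simp only [mem_image, exists_exists_and_eq_and, mem_preimage]
      constructor
      · rintro ⟨a, ha, rfl⟩
        induction a using Quotient.inductionOn with | _ p => ?_
        exact ⟨p, ha, rfl⟩
      · rintro ⟨p, hp, rfl⟩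
        exact ⟨_, hp, hf p⟩
    rw [this]
    refine hF.isOpen_image _ ?_ (hqo _ (hU.preimage (Band.continuous_mk ε)))
    rintro _ ⟨p, _, rfl⟩
    exact hqs p
  · intro x
    rw [hf]; simp [q]

/-- Bands are handled through lifts on a strip from here on, since a lift can be thinned or
reparametrized at will. -/
theorem isBandCore_iff {γ : Set Y} : IsBandCore ε γ ↔
    ∃ (δ : ℝ) (F : ℝ × ℝ → Y), IsBandLift ε δ F ∧ (range fun x : ℝ => F (x, 0)) = γ := by
  constructor
  · rintro ⟨f, hf, rfl⟩
    refine ⟨1, f ∘ Band.mk ε, IsOpenEmbedding.isBandLift hf one_pos, ?_⟩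
    rw [Band.core_eq, ← range_comp]; rfl
  · rintro ⟨δ, F, hF, rfl⟩
    obtain ⟨f, hf, h⟩ := hF.exists_isOpenEmbedding
    refine ⟨f, hf, ?_⟩
    rw [Band.core_eq, ← range_comp]
    congr 1
    ext x
    exact h x

theorem IsBandLift.exists_isEmbedding_addCircle (hF : IsBandLift ε δ F) :
    ∃ c : AddCircle (1 : ℝ) → Y, IsEmbedding c ∧ ∀ x : ℝ, c x = F (x, 0) := by
  obtain ⟨f, hf, h⟩ := hF.exists_isOpenEmbedding
  have hper : Function.Periodic (fun x : ℝ => Band.mk ε (x, 0)) 1 := by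
    intro x
    exact Band.mk_eq_iff.2 (band_rel_iff.2 ⟨-1, by simp [deck]⟩)
  have hc : Continuous (hper.lift : AddCircle (1 : ℝ) → Band ε) :=
    continuous_coinduced_dom.2 ((Band.continuous_mk ε).comp (by fun_prop))
  -- Projecting the band to its first coordinate is a continuous left inverse of the core circle,
  -- which is therefore embedded.
  let r : Band ε → AddCircle (1 : ℝ) := Quotient.lift (fun p : ℝ × ℝ => (p.1 : AddCircle (1 : ℝ)))
    (by rintro p _ ⟨n, rfl⟩
        simp only [AddCircle.coe_add]
        have : ((n : ℝ) : AddCircle (1 : ℝ)) = 0 := by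
          rw [AddCircle.coe_eq_zero_iff]; exact ⟨n, by simp⟩
        rw [this, add_zero])
  have hr : Continuous r :=
    Continuous.quotient_lift ((AddCircle.continuous_mk' 1).comp continuous_fst) _
  have hrl : Function.LeftInverse r hper.lift := by
    intro a
    induction a using QuotientAddGroup.induction_on with | _ x => rfl
  refine ⟨f ∘ hper.lift, hf.isEmbedding.comp (hrl.isEmbedding hr hc), fun x => ?_⟩
  simp only [Function.comp, Function.Periodic.lift_coe, h]

theorem IsBandCore.exists_isEmbedding_addCircle {γ : Set Y} (h : IsBandCore ε γ) :
    ∃ c : AddCircle (1 : ℝ) → Y, IsEmbedding c ∧ range c = γ := by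
  obtain ⟨δ, F, hF, rfl⟩ := isBandCore_iff.1 h
  obtain ⟨c, hc, hcF⟩ := hF.exists_isEmbedding_addCircle
  refine ⟨c, hc, ?_⟩
  ext y
  constructor
  · rintro ⟨a, rfl⟩
    induction a using QuotientAddGroup.induction_on with | _ x => exact ⟨x, (hcF x).symm⟩
  · rintro ⟨x, rfl⟩
    exact ⟨x, hcF x⟩

theorem IsBandCore.isSimpleClosedCurve {γ : Set Y} (h : IsBandCore ε γ) :
    IsSimpleClosedCurve γ := by
  obtain ⟨c, hc, rfl⟩ := h.exists_isEmbedding_addCircle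
  exact ⟨(AddCircle.homeomorphCircle one_ne_zero).symm.trans hc.toHomeomorph⟩

theorem IsBandCore.isConnected {γ : Set Y} (h : IsBandCore ε γ) : IsConnected γ := by
  obtain ⟨c, hc, rfl⟩ := h.exists_isEmbedding_addCircle
  exact isConnected_range hc.continuous

theorem IsBandCore.isCompact {γ : Set Y} (h : IsBandCore ε γ) : IsCompact γ := by
  obtain ⟨c, hc, rfl⟩ := h.exists_isEmbedding_addCircle
  exact isCompact_range hc.continuous

end BandLift

/-! ### Separating annuli from Möbius bands, and curves in open subsurfaces -/

section Cores

variable {Y : Type*} [TopologicalSpace Y] {ε : ℤˣ} {δ : ℝ} {F : ℝ × ℝ → Y}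

/-- The tube lemma over the compact interval `[0, 1]` gives a uniform height, and deck
transformations carry it along the whole strip. -/
theorem IsBandLift.exists_thin (hF : IsBandLift ε δ F) {V : Set Y} (hV : IsOpen V)
    (h : (range fun x : ℝ => F (x, 0)) ⊆ V) :
    ∃ δ', 0 < δ' ∧ δ' ≤ δ ∧ ∀ p ∈ strip δ', F p ∈ V := by
  have hO : IsOpen (strip δ ∩ F ⁻¹' V) := hF.continuousOn.isOpen_inter_preimage (isOpen_strip δ) hV
  have hsub : Icc (0 : ℝ) 1 ×ˢ ({0} : Set ℝ) ⊆ strip δ ∩ F ⁻¹' V := by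
    rintro ⟨x, t⟩ ⟨_, ht⟩
    obtain rfl : t = 0 := ht
    exact ⟨core_mem_strip hF.pos x, h ⟨x, rfl⟩⟩
  obtain ⟨u, v, -, hv, hu, h0, huv⟩ :=
    generalized_tube_lemma isCompact_Icc isCompact_singleton hO hsub
  obtain ⟨r, hr, hrv⟩ := Metric.isOpen_iff.1 hv 0 (h0 rfl)
  refine ⟨min r δ, lt_min hr hF.pos, min_le_right _ _, fun p hp => ?_⟩
  have hps : p ∈ strip δ := strip_mono (min_le_right _ _) hp
  rw [← hF.deck_eq hps (-⌊p.1⌋)]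
  refine (huv (mk_mem_prod (hu ?_) (hrv ?_)) : deck ε (-⌊p.1⌋) p ∈ _).2
  · simp only [Int.cast_neg, ← sub_eq_add_neg]
    exact ⟨by linarith [Int.floor_le p.1], by linarith [Int.lt_floor_add_one p.1]⟩
  · have : |p.2| < min r δ := hp
    simp only [Metric.mem_ball, dist_zero_right, Real.norm_eq_abs, abs_mul, abs_signPow, one_mul]
    exact this.trans_le (min_le_left _ _)

/-- A band core has no isolated points, so it cannot contain an isolated fixed point. -/
theorem IsBandCore.exists_ne_mem {γ : Set Y} (hγ : IsBandCore ε γ) {y : Y} (hy : y ∈ γ)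
    {W : Set Y} (hW : W ∈ 𝓝 y) : ∃ z ∈ γ, z ∈ W ∧ z ≠ y := by
  obtain ⟨δ, F, hF, rfl⟩ := isBandCore_iff.1 hγ
  obtain ⟨x, rfl⟩ := hy
  have hc : ContinuousAt (fun s : ℝ => F (s, 0)) x :=
    (hF.continuousOn.comp_continuous (by fun_prop)
      (fun s => core_mem_strip hF.pos s)).continuousAt
  obtain ⟨r, hr, hrW⟩ := Metric.mem_nhds_iff.1 (hc hW)
  have hm : 0 < min (r / 2) (1 / 2) := by positivity
  refine ⟨_, ⟨x + min (r / 2) (1 / 2), rfl⟩, hrW ?_, fun h => ?_⟩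
  · rw [Metric.mem_ball, Real.dist_eq, add_sub_cancel_left, abs_of_pos hm]
    linarith [min_le_left (r / 2) (1 / 2)]
  · have := hF.eq_of_dist_lt (core_mem_strip hF.pos _) (core_mem_strip hF.pos _) h.symm (by
      rw [add_sub_cancel_left, abs_of_pos hm]
      linarith [min_le_right (r / 2) (1 / 2)])
    have := congrArg Prod.fst this
    simp only at this
    linarith

/-- A Möbius band minus its core is connected. Inside an annulus with the same core it would lie in
the union of the two disjoint open sides, yet it contains points of both. -/
theorem IsBandCore.not_isBandCore_neg_one {γ : Set Y} (h1 : IsBandCore 1 γ) :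
    ¬ IsBandCore (-1) γ := by
  intro h2
  obtain ⟨δ, F, hF, rfl⟩ := isBandCore_iff.1 h1
  obtain ⟨d, G, hG, hGγ⟩ := isBandCore_iff.1 h2
  have hFU : IsOpen (F '' strip δ) := hF.isOpen_image _ Subset.rfl (isOpen_strip δ)
  obtain ⟨η, hη, hηd, hGF⟩ := hG.exists_thin hFU (by
    rw [hGγ]; rintro _ ⟨x, rfl⟩; exact ⟨_, core_mem_strip hF.pos x, rfl⟩)
  have hG := hG.mono hη hηd
  let P : Set (ℝ × ℝ) := univ ×ˢ Ioo 0 η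
  have hPs : P ⊆ strip η := fun p hp => abs_lt.2 ⟨by linarith [hp.2.1], hp.2.2⟩
  have hPc : IsPreconnected (G '' P) :=
    (isPreconnected_univ.prod isPreconnected_Ioo).image _ (hG.continuousOn.mono hPs)
  let A : Set (ℝ × ℝ) := strip δ ∩ {p | 0 < p.2}
  let B : Set (ℝ × ℝ) := strip δ ∩ {p | p.2 < 0}
  have hAo : IsOpen (F '' A) := hF.isOpen_image _ inter_subset_left
    ((isOpen_strip δ).inter (isOpen_lt continuous_const continuous_snd))
  have hBo : IsOpen (F '' B) := hF.isOpen_image _ inter_subset_left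
    ((isOpen_strip δ).inter (isOpen_lt continuous_snd continuous_const))
  have hside : ∀ p ∈ strip δ, ∀ q ∈ strip δ, F p = F q → p.2 = q.2 := by
    intro p hp q hq h
    obtain ⟨n, rfl⟩ := band_rel_iff.1 ((hF.eq_iff p hp q hq).1 h)
    simp [deck, signPow_one]
  -- the Möbius band minus its core lies on one side of the annulus
  have hcov : ∀ p ∈ strip η, p.2 ≠ 0 → G p ∈ F '' A ∪ F '' B := by
    intro p hp h0
    obtain ⟨q, hq, hqp⟩ := hGF p hp
    rcases lt_trichotomy q.2 0 with h | h | h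
    · exact Or.inr ⟨q, ⟨hq, h⟩, hqp⟩
    · exfalso
      apply h0
      rw [← hG.mem_core_iff hp, hGγ, ← hqp, hF.mem_core_iff hq]
      exact h
    · exact Or.inl ⟨q, ⟨hq, h⟩, hqp⟩
  -- A turn around the Möbius band changes the sign of the height, so the upper half strip already
  -- covers everything off the core.
  have hneg : ∀ p ∈ strip η, p.2 ≠ 0 → G p ∈ G '' P := by
    intro p hp h0
    rcases lt_or_gt_of_ne h0 with h | h
    · rw [← hG.deck_eq hp 1]
      refine ⟨_, ⟨mem_univ _, ?_, ?_⟩, rfl⟩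
      · simp [deck, signPow]; exact h
      · have : |p.2| < η := hp
        simp [deck, signPow]
        linarith [neg_abs_le p.2]
    · exact ⟨p, ⟨mem_univ _, h, (abs_lt.1 hp).2⟩, rfl⟩
  obtain ⟨x, hx⟩ : ∃ x : ℝ, G (x, 0) = F (0, 0) := by
    have : F (0, 0) ∈ range fun x : ℝ => G (x, 0) := by rw [hGγ]; exact ⟨0, rfl⟩
    exact this
  -- A vertical path leaving the annulus core enters the Möbius band off its core. It is used
  -- upwards, with `τ = id`, and downwards, with `τ = Neg.neg`.
  have key : ∀ τ : ℝ → ℝ, ContinuousAt τ 0 → τ 0 = 0 → (∀ s, 0 < s → τ s ≠ 0) →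
      ∃ s, 0 < s ∧ s < δ ∧ |τ s| < δ ∧ F (0, τ s) ∈ G '' P := by
    intro τ hτ h0 hne
    have hGo : IsOpen (G '' strip η) := hG.isOpen_image _ Subset.rfl (isOpen_strip η)
    have hc : ContinuousAt (fun s : ℝ => F (0, τ s)) 0 := by
      have : ContinuousAt F (0, τ 0) := by
        rw [h0]
        exact hF.continuousOn.continuousAt ((isOpen_strip δ).mem_nhds (core_mem_strip hF.pos 0))
      exact ContinuousAt.comp (f := fun s => ((0 : ℝ), τ s)) this (by fun_prop)
    have e1 : ∀ᶠ s in 𝓝[>] (0 : ℝ), F (0, τ s) ∈ G '' strip η := by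
      refine nhdsWithin_le_nhds (hc (hGo.mem_nhds ?_))
      simp only [h0, ← hx]
      exact ⟨_, core_mem_strip hη x, rfl⟩
    have e2 : ∀ᶠ s in 𝓝[>] (0 : ℝ), |τ s| < δ := by
      refine nhdsWithin_le_nhds (hτ.abs.eventually_lt continuousAt_const ?_)
      simpa [h0] using hF.pos
    have e3 : ∀ᶠ s in 𝓝[>] (0 : ℝ), s ∈ Ioo 0 δ := Ioo_mem_nhdsGT hF.pos
    obtain ⟨s, ⟨p, hp, hps⟩, h2, h3⟩ := (e1.and (e2.and e3)).exists
    refine ⟨s, h3.1, h3.2, h2, ?_⟩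
    rw [← hps]
    refine hneg p hp fun hp0 => ?_
    have h1 : F (0, τ s) ∈ range fun x : ℝ => F (x, 0) := by
      rw [← hps, ← hGγ]
      exact (hG.mem_core_iff hp).2 hp0
    exact hne s h3.1 ((hF.mem_core_iff (p := (0, τ s)) h2).1 h1)
  obtain ⟨s, hs, -, hsδ, hsG⟩ := key id continuousAt_id rfl fun s hs => hs.ne'
  obtain ⟨s', hs', -, hsδ', hsG'⟩ := key Neg.neg continuousAt_neg neg_zero
    fun s hs => (neg_lt_zero.2 hs).ne
  obtain ⟨y, -, ⟨p, hp, hpy⟩, ⟨q, hq, hqy⟩⟩ := hPc (F '' A) (F '' B) hAo hBo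
    (by rintro _ ⟨p, hp, rfl⟩; exact hcov p (hPs hp) hp.2.1.ne')
    ⟨_, hsG, _, ⟨hsδ, hs⟩, rfl⟩ ⟨_, hsG', _, ⟨hsδ', neg_lt_zero.2 hs'⟩, rfl⟩
  have h := hside p hp.1 q hq.1 (hpy.trans hqy.symm)
  have h1 : 0 < p.2 := hp.2
  have h2 : q.2 < 0 := hq.2
  linarith

theorem IsBandCore.not_isBandCore_neg {γ : Set Y} (h : IsBandCore ε γ) : ¬ IsBandCore (-ε) γ := by
  rcases Int.units_eq_one_or ε with rfl | rfl
  · exact h.not_isBandCore_neg_one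
  · intro h'
    rw [neg_neg] at h'
    exact h'.not_isBandCore_neg_one h

/-- One-dimensional Borsuk–Ulam: `f (x + 1/2) - f x` changes sign over half a turn, so some pair of
antipodal points has equal values. -/
theorem not_injective_of_addCircle_real {f : AddCircle (1 : ℝ) → ℝ} (hf : Continuous f) :
    ¬ Function.Injective f := by
  intro hi
  let g : ℝ → ℝ := fun x => f ((x + 1 / 2 : ℝ) : AddCircle (1 : ℝ)) - f (x : AddCircle (1 : ℝ))
  have hg : Continuous g :=
    (hf.comp ((AddCircle.continuous_mk' 1).comp (by fun_prop))).sub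
      (hf.comp (AddCircle.continuous_mk' 1))
  have h1 : g (1 / 2) = - g 0 := by
    simp only [g]
    have : ((1 / 2 + 1 / 2 : ℝ) : AddCircle (1 : ℝ)) = ((0 : ℝ) : AddCircle (1 : ℝ)) := by
      norm_num
    rw [this, zero_add]; ring
  have h0 : (0 : ℝ) ∈ g '' (uIcc 0 (1 / 2)) := by
    apply intermediate_value_uIcc hg.continuousOn
    rw [h1, mem_uIcc]
    rcases le_total (g 0) 0 with h | h
    · left; constructor <;> linarith
    · right; constructor <;> linarith
  obtain ⟨x, -, hx⟩ := h0
  have := hi (sub_eq_zero.1 hx)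
  rw [AddCircle.coe_add, add_eq_left, AddCircle.coe_eq_zero_iff] at this
  obtain ⟨n, hn⟩ := this
  have hn' : (n : ℝ) * 2 = 1 := by
    rw [zsmul_eq_mul] at hn; linarith
  have : n * 2 = 1 := by exact_mod_cast hn'
  omega

/-- If a value is missed, rotate it to `-1`. The argument is then continuous on the image and gives
an injective map from the circle to the line. -/
theorem surjective_of_injective_addCircle_circle {f : AddCircle (1 : ℝ) → Circle}
    (hf : Continuous f) (hi : Function.Injective f) : Function.Surjective f := by
  by_contra hs
  simp only [Function.Surjective, not_forall, not_exists] at hs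
  obtain ⟨y, hy⟩ := hs
  have hne : ∀ a, ((-y⁻¹ * f a : Circle) : ℂ) ∈ Complex.slitPlane := by
    intro a
    rw [Complex.mem_slitPlane_iff_arg]
    refine ⟨fun h => hy a ?_, Circle.coe_ne_zero _⟩
    have h1 : -y⁻¹ * f a = Circle.exp Real.pi := by
      rw [← h, Circle.exp_arg]
    have h2 : -y⁻¹ * f a = -1 := by
      rw [h1]; ext; simp
    calc f a = -y * (-y⁻¹ * f a) := by simp
      _ = y := by rw [h2]; simp
  refine not_injective_of_addCircle_real (f := fun a => Complex.arg (-y⁻¹ * f a : Circle)) ?_ ?_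
  · refine continuous_iff_continuousAt.2 fun a => ?_
    refine ContinuousAt.comp (f := fun a => ((-y⁻¹ * f a : Circle) : ℂ))
      (Complex.continuousAt_arg (hne a)) ?_
    exact (Continuous.comp continuous_subtype_val (continuous_const.mul hf)).continuousAt
  · intro a b h
    have := Circle.injective_arg h
    exact hi (mul_left_cancel this)

/-- A simple closed curve contains no smaller one, because an injective loop in a circle is onto. -/
theorem IsBandCore.eq_of_subset {ε' : ℤˣ} {γ γ' : Set Y} (h : IsBandCore ε γ)
    (h' : IsBandCore ε' γ') (hs : γ ⊆ γ') : γ = γ' := by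
  obtain ⟨c, hc, rfl⟩ := h.exists_isEmbedding_addCircle
  obtain ⟨⟨u⟩⟩ : Nonempty (Nonempty (Circle ≃ₜ γ')) := ⟨h'.isSimpleClosedCurve⟩
  let f : AddCircle (1 : ℝ) → Circle := fun a => u.symm ⟨c a, hs ⟨a, rfl⟩⟩
  have hf : Continuous f := u.symm.continuous.comp (hc.continuous.subtype_mk _)
  have hi : Function.Injective f := by
    intro a b hab
    exact hc.injective (congrArg Subtype.val (u.symm.injective hab))
  refine hs.antisymm fun y hy => ?_
  obtain ⟨a, ha⟩ := surjective_of_injective_addCircle_circle hf hi (u.symm ⟨y, hy⟩)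
  exact ⟨a, congrArg Subtype.val (u.symm.injective ha)⟩

/-- The cores of annuli (`ε = 1`) or Möbius bands (`ε = -1`) fixed pointwise by `ι`. -/
def fixedCores (ε : ℤˣ) (ι : Y → Y) : Set (Set Y) := {γ | IsBandCore ε γ ∧ ∀ x ∈ γ, ι x = x}

theorem numOneSided_eq (ι : Y → Y) : numOneSided ι = (fixedCores (-1) ι).encard := by
  unfold numOneSided
  congr 1
  ext γ
  exact ⟨fun h => ⟨h.2, h.1.2⟩, fun h => ⟨⟨h.1.isSimpleClosedCurve, h.2⟩, h.1⟩⟩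

theorem numTwoSided_eq (ι : Y → Y) : numTwoSided ι = (fixedCores 1 ι).encard := by
  unfold numTwoSided
  congr 1
  ext γ
  exact ⟨fun h => ⟨h.2, h.1.2⟩, fun h => ⟨⟨h.1.isSimpleClosedCurve, h.2⟩, h.1⟩⟩

theorem IsBandCore.image {X : Type*} [TopologicalSpace X] {j : X → Y} (hj : IsOpenEmbedding j)
    {γ : Set X} (h : IsBandCore ε γ) : IsBandCore ε (j '' γ) := by
  obtain ⟨f, hf, rfl⟩ := h
  exact ⟨j ∘ f, hj.comp hf, by rw [image_comp]⟩

theorem IsBandCore.preimage {X : Type*} [TopologicalSpace X] {j : X → Y} (hj : IsOpenEmbedding j)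
    {γ : Set Y} (h : IsBandCore ε γ) (hγ : γ ⊆ range j) : IsBandCore ε (j ⁻¹' γ) := by
  obtain ⟨δ, F, hF, rfl⟩ := isBandCore_iff.1 h
  obtain ⟨δ', h0, hle, hr⟩ := hF.exists_thin hj.isOpen_range hγ
  replace hF := hF.mono h0 hle
  have : Nonempty X := ⟨(hγ ⟨0, rfl⟩).choose⟩
  choose! G hG using hr
  refine isBandCore_iff.2 ⟨δ', G, ⟨h0, ?_, ?_, ?_⟩, ?_⟩
  · refine hj.isInducing.continuousOn_iff.2 (hF.continuousOn.congr fun p hp => hG p hp)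
  · intro O hO hOo
    rw [hj.isOpen_iff_image_isOpen, ← image_comp]
    rw [show (j ∘ G) '' O = F '' O from image_congr fun p hp => hG p (hO hp)]
    exact hF.isOpen_image O hO hOo
  · intro p hp q hq
    rw [← hF.eq_iff p hp q hq, ← hG p hp, ← hG q hq, hj.injective.eq_iff]
  · ext y
    simp only [mem_range, mem_preimage]
    refine exists_congr fun x => ?_
    rw [← hG _ (core_mem_strip h0 x), hj.injective.eq_iff]

/-- A band about a curve in an open subset can be thinned into that subset. Hence such curves can be
counted without reference to the ambient surface. -/
theorem encard_fixedCores_subset_range {X : Type*} [TopologicalSpace X] {j : X → Y}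
    (hj : IsOpenEmbedding j) {κ : X → X} {ι : Y → Y} (hκ : ∀ x, ι (j x) = j (κ x)) :
    {γ ∈ fixedCores ε ι | γ ⊆ range j}.encard = (fixedCores ε κ).encard := by
  rw [← (image_injective.2 hj.injective).encard_image (fixedCores ε κ)]
  congr 1
  ext γ
  constructor
  · rintro ⟨⟨h1, h2⟩, h3⟩
    refine ⟨j ⁻¹' γ, ⟨h1.preimage hj h3, fun x hx => ?_⟩, image_preimage_eq_of_subset h3⟩
    exact hj.injective (by rw [← hκ]; exact h2 _ hx)
  · rintro ⟨γ, ⟨h1, h2⟩, rfl⟩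
    refine ⟨⟨h1.image hj, ?_⟩, image_subset_range _ _⟩
    rintro _ ⟨x, hx, rfl⟩
    rw [hκ, h2 x hx]

theorem encard_fixedCores_homeomorph {X : Type*} [TopologicalSpace X] (j : X ≃ₜ Y)
    {κ : X → X} {ι : Y → Y} (hκ : ∀ x, ι (j x) = j (κ x)) :
    (fixedCores ε ι).encard = (fixedCores ε κ).encard := by
  rw [← encard_fixedCores_subset_range j.isOpenEmbedding hκ]
  simp

/-- A fixed core which is relatively clopen among the fixed points contains every fixed core
that meets it. -/
theorem fixedCores_eq_of_mem {ε' : ℤˣ} {ι : Y → Y} {γ γ' : Set Y} (h : IsBandCore ε γ)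
    (hcl : IsClosed γ) {W : Set Y} (hW : IsOpen W) (hγW : γ ⊆ W)
    (hfix : ∀ y ∈ W, ι y = y → y ∈ γ) (h' : γ' ∈ fixedCores ε' ι) {y : Y} (hy : y ∈ γ)
    (hy' : y ∈ γ') : γ' = γ := by
  refine h'.1.eq_of_subset h ?_
  by_contra hs
  obtain ⟨z, hz, hzγ⟩ := not_subset.1 hs
  obtain ⟨w, hw, hwW, hwγ⟩ := h'.1.isConnected.isPreconnected W γᶜ hW hcl.isOpen_compl
    (fun x _ => (em (x ∈ γ)).imp (fun h => hγW h) id) ⟨y, hy', hγW hy⟩ ⟨z, hz, hzγ⟩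
  exact hwγ (hfix w hwW (h'.2 w hw))

end Cores

/-! ### The surface is Hausdorff -/

/-- Distinct fibres are disjoint closed sets of a normal space. Open sets separating them are shrunk
to saturated ones by taking complements of images of complements, which are open because the map is
closed. -/
theorem t2Space_of_isClosedMap {X Y : Type*} [TopologicalSpace X] [TopologicalSpace Y]
    [CompactSpace X] [T2Space X] {π : X → Y} (hc : Continuous π) (hs : Function.Surjective π)
    (hcl : IsClosedMap π) : T2Space Y := by
  have hpt : ∀ y : Y, IsClosed ({y} : Set Y) := fun y => by
    obtain ⟨x, rfl⟩ := hs y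
    simpa using hcl _ (isClosed_singleton (x := x))
  refine ⟨fun y y' hne => ?_⟩
  obtain ⟨U, V, hU, hV, hyU, hyV, hUV⟩ := normal_separation ((hpt y).preimage hc)
    ((hpt y').preimage hc) (Disjoint.preimage π (disjoint_singleton.2 hne))
  refine ⟨(π '' Uᶜ)ᶜ, (π '' Vᶜ)ᶜ, (hcl _ hU.isClosed_compl).isOpen_compl,
    (hcl _ hV.isClosed_compl).isOpen_compl, ?_, ?_, ?_⟩
  · rintro ⟨x, hx, h⟩; exact hx (hyU h)
  · rintro ⟨x, hx, h⟩; exact hx (hyV h)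
  · refine disjoint_left.2 fun z hz hz' => ?_
    obtain ⟨x, rfl⟩ := hs z
    have h1 : x ∈ U := by by_contra h; exact hz ⟨x, h, rfl⟩
    have h2 : x ∈ V := by by_contra h; exact hz' ⟨x, h, rfl⟩
    exact disjoint_left.1 hUV h1 h2

theorem isClosed_puncturedSphere (g : ℕ) : IsClosed {x : OnePoint ℂ | ∀ k : ℕ, k < g →
    x ∉ ((↑) : ℂ → OnePoint ℂ) '' Metric.ball (k : ℂ) (1 / 3)} := by
  simp only [ofPred_forall]
  refine isClosed_iInter fun k => isClosed_iInter fun _ => ?_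
  exact (OnePoint.isOpen_image_coe.2 Metric.isOpen_ball).isClosed_compl

instance (g : ℕ) : CompactSpace (PuncturedSphere g) :=
  isCompact_iff_compactSpace.1 (isClosed_puncturedSphere g).isCompact

instance (g : ℕ) : T2Space (PuncturedSphere g) :=
  inferInstanceAs (T2Space {x : OnePoint ℂ // ∀ k : ℕ, k < g →
      x ∉ ((↑) : ℂ → OnePoint ℂ) '' Metric.ball (k : ℂ) (1 / 3)})

instance (g : ℕ) : T2Space (NonorientableSurface g) := by
  refine t2Space_of_isClosedMap (π := fun x : PuncturedSphere g =>
    (Quotient.mk (crosscapSetoid g) x : NonorientableSurface g)) continuous_quot_mk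
    Quotient.mk_surjective fun C hC => ?_
  have hval : IsClosedEmbedding (Subtype.val : PuncturedSphere g → OnePoint ℂ) :=
    (isClosed_puncturedSphere g).isClosedEmbedding_subtypeVal
  refine isQuotientMap_quot_mk.isClosed_preimage.1 ?_
  -- `T k` consists of the antipodes of the points of `C` on the `k`-th boundary circle. The
  -- saturation of `C` adds only these `g` compact sets.
  let T : ℕ → Set (OnePoint ℂ) := fun k => (fun u : ℂ => ((k - u : ℂ) : OnePoint ℂ)) ''
    (Metric.sphere 0 (1 / 3) ∩ (fun u : ℂ => ((k + u : ℂ) : OnePoint ℂ)) ⁻¹' (Subtype.val '' C))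
  have hT : ∀ k, IsClosed (T k) := fun k => by
    refine IsCompact.isClosed (IsCompact.image_of_continuousOn ?_ ?_)
    · refine (isCompact_sphere _ _).inter_right ((hval.isClosedMap _ hC).preimage ?_)
      exact OnePoint.continuous_coe.comp (by fun_prop)
    · exact (OnePoint.continuous_coe.comp (by fun_prop)).continuousOn
  have : Quot.mk _ ⁻¹' ((fun x : PuncturedSphere g =>
      (Quotient.mk (crosscapSetoid g) x : NonorientableSurface g)) '' C) =
      C ∪ ⋃ k ∈ Finset.range g, Subtype.val ⁻¹' T k := by
    ext y
    simp only [mem_preimage, mem_union, mem_iUnion, Finset.mem_range, exists_prop]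
    constructor
    · rintro ⟨x, hx, h⟩
      rcases Quotient.exact (s := crosscapSetoid g) h with rfl | ⟨k, hk, u, hu, h1, h2⟩
      · exact Or.inl hx
      · exact Or.inr ⟨k, hk, u, ⟨by simpa using hu, x, hx, h1⟩, h2.symm⟩
    · rintro (hy | ⟨k, hk, u, ⟨hu, x, hx, h1⟩, h2⟩)
      · exact ⟨y, hy, rfl⟩
      · exact ⟨x, hx, Quotient.sound (s := crosscapSetoid g)
          (Or.inr ⟨k, hk, u, by simpa using hu, h1, h2.symm⟩)⟩
  exact (congrArg IsClosed this).mpr <| hC.union ((Finset.range g).finite_toSet.isClosed_biUnion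
    fun k _ => (hT k).preimage hval.continuous)

/-! ### Extending compactly supported homeomorphisms -/

section Extend

variable {X Y : Type*} [TopologicalSpace X] [TopologicalSpace Y]

open Classical in
/-- The map `f ∘ G ∘ f⁻¹`, extended by the identity. -/
noncomputable def conjExtend (f : OpenPartialHomeomorph X Y) (G : X → X) (y : Y) : Y :=
  if y ∈ f.target then f (G (f.symm y)) else y

variable {f : OpenPartialHomeomorph X Y} {G : X ≃ₜ X} {K : Set X}

theorem mem_source_of_fixed_compl (hKs : K ⊆ f.source) (hG : ∀ x ∉ K, G x = x) {x : X}
    (hx : x ∈ f.source) : G x ∈ f.source := by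
  by_contra h
  have h1 := hG (G x) fun h' => h (hKs h')
  rw [G.injective h1] at h
  exact h hx

theorem fixed_symm_compl (hG : ∀ x ∉ K, G x = x) : ∀ x ∉ K, G.symm x = x := fun x hx => by
  rw [Homeomorph.symm_apply_eq, hG x hx]

theorem conjExtend_apply {x : X} (hx : x ∈ f.source) : conjExtend f G (f x) = f (G x) := by
  rw [conjExtend, if_pos (f.map_source hx), f.left_inv hx]

theorem conjExtend_of_notMem (hG : ∀ x ∉ K, G x = x) {y : Y} (hy : y ∉ f '' K) :
    conjExtend f G y = y := by
  unfold conjExtend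
  split_ifs with h
  · rw [hG, f.right_inv h]
    exact fun hK => hy ⟨_, hK, f.right_inv h⟩
  · rfl

theorem continuous_conjExtend [T2Space Y] (hK : IsCompact K) (hKs : K ⊆ f.source)
    (hG : ∀ x ∉ K, G x = x) : Continuous (conjExtend f G) := by
  refine continuous_iff_continuousAt.2 fun y => ?_
  by_cases hy : y ∈ f.target
  · have h : ContinuousAt (fun y => f (G (f.symm y))) y := by
      refine ContinuousAt.comp (f := fun y => G (f.symm y)) (g := f) ?_ ?_
      · exact f.continuousAt (mem_source_of_fixed_compl hKs hG (f.map_target hy))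
      · exact G.continuous.continuousAt.comp (f.continuousAt_symm hy)
    refine h.congr ?_
    filter_upwards [f.open_target.mem_nhds hy] with z hz
    rw [conjExtend, if_pos hz]
  -- In a Hausdorff space the compact support is closed, so the extension is the identity near each
  -- point outside the chart.
  · have hcl : IsClosed (f '' K) := (hK.image_of_continuousOn (f.continuousOn.mono hKs)).isClosed
    refine continuousAt_id.congr ?_
    have : y ∈ (f '' K)ᶜ := fun ⟨x, hx, h⟩ => hy (h ▸ f.map_source (hKs hx))
    filter_upwards [hcl.isOpen_compl.mem_nhds this] with z hz
    exact (conjExtend_of_notMem hG hz).symm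

theorem conjExtend_symm_conjExtend (hKs : K ⊆ f.source) (hG : ∀ x ∉ K, G x = x) (y : Y) :
    conjExtend f G.symm (conjExtend f G y) = y := by
  by_cases hy : y ∈ f.target
  · rw [← f.right_inv hy, conjExtend_apply (f.map_target hy), conjExtend_apply
      (mem_source_of_fixed_compl hKs hG (f.map_target hy)), Homeomorph.symm_apply_apply]
  · simp [conjExtend, hy]

theorem exists_homeomorph_conjExtend [T2Space Y] (f : OpenPartialHomeomorph X Y) (G : X ≃ₜ X)
    (hK : IsCompact K) (hKs : K ⊆ f.source) (hG : ∀ x ∉ K, G x = x) :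
    ∃ Γ : Y ≃ₜ Y, (∀ x ∈ f.source, Γ (f x) = f (G x)) ∧ ∀ y ∉ f '' K, Γ y = y :=
  ⟨{ toFun := conjExtend f G
     invFun := conjExtend f G.symm
     left_inv := conjExtend_symm_conjExtend hKs hG
     right_inv := conjExtend_symm_conjExtend (G := G.symm) hKs (fixed_symm_compl hG)
     continuous_toFun := continuous_conjExtend hK hKs hG
     continuous_invFun := continuous_conjExtend (G := G.symm) hK hKs (fixed_symm_compl hG) },
    fun _ hx => conjExtend_apply hx, fun _ hy => conjExtend_of_notMem hG hy⟩

end Extend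

/-! ### Straightening a homeomorphism along a line -/

/-- The projective transformation of `[-η, η]` which fixes the end points and takes `0` to `η s`,
extended by the identity. -/
noncomputable def pushFun (η s t : ℝ) : ℝ :=
  t - η * max (-1) (min 1 (t / η)) +
    η * ((max (-1) (min 1 (t / η)) + s) / (1 + max (-1) (min 1 (t / η)) * s))

section Push

variable {η s t : ℝ}

theorem pushFun_of_abs_ge (hη : 0 < η) (hs : |s| < 1) (h : η ≤ |t|) : pushFun η s t = t := by
  have hs' := abs_lt.1 hs
  have key : max (-1) (min 1 (t / η)) = 1 ∨ max (-1) (min 1 (t / η)) = -1 := by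
    rcases le_abs.1 h with h | h
    · left
      rw [min_eq_left ((le_div_iff₀ hη).2 (by linarith)), max_eq_right (by norm_num)]
    · right
      have : t / η ≤ -1 := (div_le_iff₀ hη).2 (by linarith)
      rw [min_eq_right (by linarith), max_eq_left this]
  unfold pushFun
  rcases key with h | h <;> rw [h]
  · have : 1 + s ≠ 0 := by linarith
    rw [one_mul, div_self this]; ring
  · have : 1 - s ≠ 0 := by linarith
    rw [show (-1 + s) / (1 + -1 * s) = -1 by rw [div_eq_iff (by simpa [← sub_eq_add_neg])]; ring]
    ring

theorem pushFun_mul (hη : 0 < η) {c : ℝ} (hc : |c| ≤ 1) :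
    pushFun η s (η * c) = η * ((c + s) / (1 + c * s)) := by
  have hc' := abs_le.1 hc
  have : η * c / η = c := by field_simp
  rw [pushFun, this, min_eq_right hc'.2, max_eq_right hc'.1]; ring

theorem one_add_mul_pos {c s : ℝ} (hc : |c| ≤ 1) (hs : |s| < 1) : 0 < 1 + c * s := by
  have : |c * s| < 1 := by
    rw [abs_mul]
    calc |c| * |s| ≤ 1 * |s| := by gcongr
      _ < 1 := by linarith
  linarith [neg_abs_le (c * s)]

/-- In the coordinate `c = t / η` the push is the velocity addition law `(c + s) / (1 + cs)`, whose
inverse is addition of `-s`. -/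
theorem pushFun_neg_pushFun (hη : 0 < η) (hs : |s| < 1) (t : ℝ) :
    pushFun η (-s) (pushFun η s t) = t := by
  have hs' : |-s| < 1 := by rwa [abs_neg]
  rcases le_total η |t| with h | h
  · rw [pushFun_of_abs_ge hη hs h, pushFun_of_abs_ge hη hs' h]
  · obtain ⟨c, rfl⟩ : ∃ c, t = η * c := ⟨t / η, by field_simp⟩
    have hc : |c| ≤ 1 := by
      rw [abs_mul, abs_of_pos hη] at h
      exact le_of_mul_le_mul_left (by linarith) hη
    have h1 := one_add_mul_pos hc hs
    have hc' := abs_le.1 hc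
    have hss := abs_lt.1 hs
    have hd : |(c + s) / (1 + c * s)| ≤ 1 := by
      rw [abs_div, abs_of_pos h1, div_le_one h1, abs_le]
      constructor <;> nlinarith
    rw [pushFun_mul hη hc, pushFun_mul hη hd]
    have h2 : 1 - s * s ≠ 0 := by nlinarith
    have h3 : 1 + c * s ≠ 0 := h1.ne'
    have h4 : 1 + (c + s) / (1 + c * s) * -s ≠ 0 := by
      rw [show 1 + (c + s) / (1 + c * s) * -s = (1 - s * s) / (1 + c * s) by field_simp; ring]
      exact div_ne_zero h2 h3
    congr 1
    rw [div_eq_iff h4]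
    field_simp; ring

theorem le_pushFun (hη : 0 < η) (hs0 : 0 ≤ s) (hs : |s| < 1) : t ≤ pushFun η s t := by
  rcases le_total η |t| with h | h
  · rw [pushFun_of_abs_ge hη hs h]
  · obtain ⟨c, rfl⟩ : ∃ c, t = η * c := ⟨t / η, by field_simp⟩
    have hc : |c| ≤ 1 := by
      rw [abs_mul, abs_of_pos hη] at h
      exact le_of_mul_le_mul_left (by linarith) hη
    rw [pushFun_mul hη hc]
    have h1 := one_add_mul_pos hc hs
    have hc' := abs_le.1 hc
    gcongr
    rw [le_div_iff₀ h1]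
    nlinarith [mul_nonneg hs0 (by nlinarith : 0 ≤ 1 - c * c)]

theorem continuous_pushFun {Z : Type*} [TopologicalSpace Z] {s t : Z → ℝ} (hs : Continuous s)
    (ht : Continuous t) (h1 : ∀ z, |s z| < 1) : Continuous fun z => pushFun η (s z) (t z) := by
  unfold pushFun
  have hc : ∀ z, |max (-1) (min 1 (t z / η))| ≤ 1 := fun z =>
    abs_le.2 ⟨le_max_left _ _, max_le (by norm_num) (min_le_left _ _)⟩
  have hcl : Continuous fun z => max (-1) (min 1 (t z / η)) := by fun_prop
  refine (ht.sub (continuous_const.mul hcl)).add (continuous_const.mul ((hcl.add hs).div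
    (continuous_const.add (hcl.mul hs)) fun z => (one_add_mul_pos (hc z) (h1 z)).ne'))

end Push

/-- The vertical push by a variable amount. -/
noncomputable def pushHomeomorph {η : ℝ} (hη : 0 < η) (s : ℝ → ℝ) (hs : Continuous s)
    (h1 : ∀ x, |s x| < 1) : ℝ × ℝ ≃ₜ ℝ × ℝ where
  toFun p := (p.1, pushFun η (s p.1) p.2)
  invFun p := (p.1, pushFun η (-s p.1) p.2)
  left_inv p := by simp only [pushFun_neg_pushFun hη (h1 p.1)]
  right_inv p := by
    have := pushFun_neg_pushFun (s := -s p.1) hη (by simpa using h1 p.1) p.2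
    rw [neg_neg] at this
    simp only [this]
  continuous_toFun := continuous_fst.prodMk
    (continuous_pushFun (hs.comp continuous_fst) continuous_snd fun p => h1 p.1)
  continuous_invFun := continuous_fst.prodMk
    (continuous_pushFun (hs.comp continuous_fst).neg continuous_snd fun p => by
      simpa using h1 p.1)

theorem exists_cutoff {α α' β' β : ℝ} (hα : α < α') (hβ : β' < β) :
    ∃ s : ℝ → ℝ, Continuous s ∧ (∀ x, 0 ≤ s x) ∧ (∀ x, |s x| < 1) ∧
      (∀ x ∈ Icc α' β', s x = 1 / 2) ∧ ∀ x ∉ Icc α β, s x = 0 := by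
  refine ⟨fun x => max 0 (min 1 (min ((x - α) / (α' - α)) ((β - x) / (β - β')))) / 2,
    by fun_prop, fun x => by positivity, fun x => ?_, fun x hx => ?_, fun x hx => ?_⟩
  · rw [abs_of_nonneg (by positivity)]
    have : max 0 (min 1 (min ((x - α) / (α' - α)) ((β - x) / (β - β')))) ≤ 1 :=
      max_le zero_le_one (min_le_left _ _)
    linarith
  · have h1 : 1 ≤ (x - α) / (α' - α) := (one_le_div (by linarith)).2 (by linarith [hx.1])
    have h2 : 1 ≤ (β - x) / (β - β') := (one_le_div (by linarith)).2 (by linarith [hx.2])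
    simp only
    rw [min_eq_left (le_min h1 h2), max_eq_right zero_le_one]
  · have h : min ((x - α) / (α' - α)) ((β - x) / (β - β')) ≤ 0 := by
      by_cases h1 : α ≤ x
      · have : β < x := not_le.1 fun h => hx ⟨h1, h⟩
        exact (min_le_right _ _).trans (div_nonpos_of_nonpos_of_nonneg (by linarith) (by linarith))
      · exact (min_le_left _ _).trans
          (div_nonpos_of_nonpos_of_nonneg (by linarith) (by linarith))
    simp only
    rw [max_eq_left ((min_le_right _ _).trans h), zero_div]

/-- A local homeomorphism that fixes the axis pointwise, replaced by the identity below the axis. -/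
theorem exists_upper_half (E : OpenPartialHomeomorph (ℝ × ℝ) (ℝ × ℝ))
    (hax : ∀ x, (x, (0 : ℝ)) ∈ E.source → E (x, 0) = (x, 0))
    (hup : ∀ p ∈ E.source, 0 < p.2 → 0 < (E p).2) (hdown : ∀ p ∈ E.source, p.2 < 0 → (E p).2 < 0) :
    ∃ E' : OpenPartialHomeomorph (ℝ × ℝ) (ℝ × ℝ), E'.source = E.source ∧
      ∀ p, E' p = if 0 ≤ p.2 then E p else p := by
  let f : ℝ × ℝ → ℝ × ℝ := fun p => if 0 ≤ p.2 then E p else p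
  have hax' : ∀ p ∈ E.source, p.2 = 0 → E p = p := by
    rintro ⟨x, t⟩ hp rfl; exact hax x hp
  have hpos : ∀ p ∈ E.source, 0 ≤ p.2 → 0 ≤ (E p).2 := by
    intro p hp h
    rcases h.eq_or_lt with h | h
    · rw [hax' p hp h.symm, ← h]
    · exact (hup p hp h).le
  have hinj : InjOn f E.source := by
    intro p hp q hq h
    simp only [f] at h
    split_ifs at h with h1 h2 h2
    · exact E.injOn hp hq h
    · have := hpos p hp h1
      rw [h] at this
      exact absurd this h2
    · have := hpos q hq h2
      rw [← h] at this
      exact absurd this h1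
    · exact h
  have hcont : ContinuousOn f E.source := by
    rw [continuousOn_iff_continuous_domRestrict]
    refine Continuous.if_le (f := fun _ => (0 : ℝ)) (g := fun p : E.source => p.1.2)
      (continuousOn_iff_continuous_domRestrict.1 E.continuousOn) continuous_subtype_val
      continuous_const (by fun_prop) ?_
    rintro ⟨p, hp⟩ h
    exact hax' p hp h.symm
  -- At a point of the axis, openness is pieced together: the lower half of a neighbourhood comes
  -- from `O`, the upper half from `E '' O`.
  have himg : ∀ O ⊆ E.source, IsOpen O → IsOpen (f '' O) := by
    intro O hO hOo
    have hEO : IsOpen (E '' O) := E.isOpen_image_of_subset_source hOo hO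
    rw [isOpen_iff_mem_nhds]
    rintro _ ⟨p, hp, rfl⟩
    have hlow : O ∩ {q | q.2 ≤ 0} ⊆ f '' O := by
      rintro q ⟨hq, hq0⟩
      refine ⟨q, hq, ?_⟩
      simp only [f]
      split_ifs with h
      · exact hax' q (hO hq) (le_antisymm hq0 h)
      · rfl
    have hupp : E '' O ∩ {q | 0 ≤ q.2} ⊆ f '' O := by
      rintro _ ⟨⟨q, hq, rfl⟩, hq0⟩
      have : 0 ≤ q.2 := by
        by_contra h
        exact absurd (hdown q (hO hq) (not_le.1 h)) (not_lt.2 hq0)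
      exact ⟨q, hq, if_pos this⟩
    rcases lt_trichotomy p.2 0 with h | h | h
    · have : f p = p := if_neg (not_le.2 h)
      rw [this]
      filter_upwards [hOo.mem_nhds hp, (isOpen_lt continuous_snd continuous_const).mem_nhds h]
        with q h1 h2
      exact hlow ⟨h1, le_of_lt h2⟩
    · have h' : f p = p := by rw [← hax' p (hO hp) h]; simp [f, h, hax' p (hO hp) h]
      have h3 : p ∈ E '' O := ⟨p, hp, hax' p (hO hp) h⟩
      rw [h']
      filter_upwards [hOo.mem_nhds hp, hEO.mem_nhds h3] with q h1 h2
      rcases le_total q.2 0 with h | h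
      · exact hlow ⟨h1, h⟩
      · exact hupp ⟨h2, h⟩
    · have : f p = E p := if_pos h.le
      rw [this]
      filter_upwards [hEO.mem_nhds ⟨p, hp, rfl⟩, (isOpen_lt continuous_const
        continuous_snd).mem_nhds (hup p (hO hp) h)] with q h1 h2
      exact hupp ⟨h1, le_of_lt h2⟩
  refine ⟨OpenPartialHomeomorph.ofContinuousOpenRestrict (hinj.toPartialEquiv f E.source) hcont ?_
    E.open_source, rfl, fun p => rfl⟩
  intro U hU
  have := himg (Subtype.val '' U) (by rintro _ ⟨p, _, rfl⟩; exact p.2)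
    (E.open_source.isOpenMap_subtype_val U hU)
  rwa [← image_comp] at this

/-- A local homeomorphism of the plane that fixes the axis pointwise and preserves its sides agrees
in the upper half plane, near a segment of the axis, with a compactly supported homeomorphism that
is the identity in the lower half plane. -/
theorem exists_homeomorph_eq_above (E : OpenPartialHomeomorph (ℝ × ℝ) (ℝ × ℝ))
    (hax : ∀ x, (x, (0 : ℝ)) ∈ E.source → E (x, 0) = (x, 0))
    (hup : ∀ p ∈ E.source, 0 < p.2 → 0 < (E p).2) (hdown : ∀ p ∈ E.source, p.2 < 0 → (E p).2 < 0)
    {α α' β' β η : ℝ} (hα : α < α') (hβ : β' < β) (hη : 0 < η)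
    (hsrc : Icc α β ×ˢ Icc (-η) η ⊆ E.source) :
    ∃ G : ℝ × ℝ ≃ₜ ℝ × ℝ,
      (∀ p ∉ Icc α β ×ˢ Icc (-η) η ∪ E '' (Icc α β ×ˢ Icc (-η) η), G p = p) ∧
      (∀ p : ℝ × ℝ, p.2 ≤ 0 → G p = p) ∧
      ∃ d > 0, ∀ x ∈ Icc α' β', ∀ t ∈ Icc 0 d, G (x, t) = E (x, t) := by
  obtain ⟨E', hs', hE'⟩ := exists_upper_half E hax hup hdown
  obtain ⟨s, hsc, hs0, hs1, hs2, hs3⟩ := exists_cutoff hα hβ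
  let P := pushHomeomorph hη s hsc hs1
  set K := Icc α β ×ˢ Icc (-η) η with hKdef
  have hK : IsCompact K := isCompact_Icc.prod isCompact_Icc
  have hPK : ∀ p ∉ K, P p = p := by
    intro p hp
    show (p.1, pushFun η (s p.1) p.2) = p
    by_cases h : p.1 ∈ Icc α β
    · rw [pushFun_of_abs_ge hη (hs1 _)]
      by_contra h'
      exact hp ⟨h, abs_le.1 (not_le.1 h').le⟩
    · rw [hs3 _ h]; simp [pushFun]
  obtain ⟨Q, hQ, hQK⟩ := exists_homeomorph_conjExtend E' P hK (hs'.symm ▸ hsrc) hPK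
  have hbelow : ∀ p : ℝ × ℝ, (P.symm p).2 ≤ p.2 := by
    intro p
    have := le_pushFun hη (hs0 (P.symm p).1) (hs1 _) (t := (P.symm p).2)
    have h2 : (P (P.symm p)).2 = p.2 := by rw [Homeomorph.apply_symm_apply]
    exact this.trans_eq h2
  have hE'0 : ∀ p ∈ E.source, p.2 ≤ 0 → E' p = p := by
    rintro ⟨x, t⟩ hp h
    rw [hE']
    split_ifs with h'
    · obtain rfl : t = 0 := le_antisymm h h'
      exact hax x hp
    · rfl
  -- where the first push ends below the axis, the commutator follows `E'`
  have hfollow : ∀ p ∈ K, (P.symm p).2 ≤ 0 → Q (P.symm p) = E' p := by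
    intro p hp h
    have hps : P.symm p ∈ K := by
      by_contra h'
      have := hPK _ h'
      rw [Homeomorph.apply_symm_apply] at this
      exact h' (this ▸ hp)
    rw [← hE'0 _ (hsrc hps) h, hQ _ (hs' ▸ hsrc hps),
      Homeomorph.apply_symm_apply]
  -- This is the commutator `E' P E'⁻¹ P⁻¹`. Over `[α', β']` the push by `1 / 2` raises the axis to
  -- height `η / 2`, so `P⁻¹` takes heights in `[0, η / 2]` to or below the axis. There `E'` is the
  -- identity, and the commutator reduces to `E' P P⁻¹ = E'`.
  refine ⟨P.symm.trans Q, ?_, ?_, η / 2, by positivity, ?_⟩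
  · intro p hp
    simp only [mem_union, not_or] at hp
    rw [Homeomorph.trans_apply, fixed_symm_compl hPK p hp.1]
    refine hQK p ?_
    rintro ⟨q, hq, rfl⟩
    rw [hE'] at hp
    split_ifs at hp
    · exact hp.2 ⟨q, hq, rfl⟩
    · exact hp.1 hq
  · intro p hp
    rw [Homeomorph.trans_apply]
    by_cases hpK : p ∈ K
    · rw [hfollow p hpK ((hbelow p).trans hp), hE'0 p (hsrc hpK) hp]
    · rw [fixed_symm_compl hPK p hpK]
      refine hQK p ?_
      rintro ⟨q, hq, rfl⟩
      have : q.2 ≤ 0 := by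
        by_contra h
        rw [hE', if_pos (not_le.1 h).le] at hp
        exact absurd (hup q (hsrc hq) (not_le.1 h)) (not_lt.2 hp)
      rw [hE'0 q (hsrc hq) this] at hpK
      exact hpK hq
  · intro x hx t ht
    have hpK : ((x, t) : ℝ × ℝ) ∈ K :=
      ⟨⟨hα.le.trans hx.1, hx.2.trans hβ.le⟩, by linarith [ht.1], by linarith [ht.2]⟩
    rw [Homeomorph.trans_apply, hfollow _ hpK, hE', if_pos ht.1]
    show pushFun η (-s x) t ≤ 0
    obtain ⟨c, rfl⟩ : ∃ c, t = η * c := ⟨t / η, by field_simp⟩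
    have hc0 : 0 ≤ c := by
      by_contra h; exact absurd ht.1 (not_le.2 (mul_neg_of_pos_of_neg hη (not_le.1 h)))
    have hc : c ≤ 1 / 2 := by
      have := ht.2
      rw [div_eq_mul_one_div] at this
      exact le_of_mul_le_mul_left this hη
    have hc1 : |c| ≤ 1 := by rw [abs_of_nonneg hc0]; linarith
    rw [pushFun_mul hη hc1, hs2 x hx]
    have : 0 < 1 + c * -(1 / 2) := by linarith
    exact mul_nonpos_of_nonneg_of_nonpos hη.le
      (div_nonpos_of_nonpos_of_nonneg (by linarith) this.le)

/-! ### Reflection curves through a reflection disk -/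

theorem mul_pos_of_isPreconnected {X : Type*} [TopologicalSpace X] {C : Set X}
    (hC : IsPreconnected C) {m : X → ℝ} (hm : ContinuousOn m C) (h0 : ∀ p ∈ C, m p ≠ 0) {p q : X}
    (hp : p ∈ C) (hq : q ∈ C) : 0 < m p * m q := by
  have key : ∀ p ∈ C, ∀ q ∈ C, m p < 0 → ¬ 0 < m q := by
    intro p hp q hq h1 h2
    obtain ⟨x, hx, hx0⟩ := hC.intermediate_value hp hq hm ⟨h1.le, h2.le⟩
    exact h0 x hx hx0
  rcases lt_or_gt_of_ne (h0 p hp) with h1 | h1 <;> rcases lt_or_gt_of_ne (h0 q hq) with h2 | h2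
  · exact mul_pos_of_neg_of_neg h1 h2
  · exact absurd h2 (key p hp q hq h1)
  · exact absurd h1 (key q hq p hp h2)
  · exact mul_pos h1 h2

section Lifts

variable {Y : Type*} [TopologicalSpace Y] {ε : ℤˣ} {δ : ℝ} {F : ℝ × ℝ → Y}

theorem IsBandLift.comp_homeomorph (hF : IsBandLift ε δ F) (Φ : ℝ × ℝ ≃ₜ ℝ × ℝ)
    (hs : ∀ p, Φ p ∈ strip δ ↔ p ∈ strip δ)
    (hr : ∀ p q, (bandSetoid ε).r (Φ p) (Φ q) ↔ (bandSetoid ε).r p q) :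
    IsBandLift ε δ (F ∘ Φ) where
  pos := hF.pos
  continuousOn := hF.continuousOn.comp Φ.continuous.continuousOn fun p hp => (hs p).2 hp
  isOpen_image := fun O hO hOo => by
    rw [image_comp]
    refine hF.isOpen_image _ ?_ (Φ.isOpenMap O hOo)
    rintro _ ⟨p, hp, rfl⟩
    exact (hs p).2 (hO hp)
  eq_iff := fun p hp q hq => by
    rw [Function.comp, Function.comp, hF.eq_iff _ ((hs p).2 hp) _ ((hs q).2 hq), hr]

/-- The reflection `(x, t) ↦ (x, -t)`. -/
def reflAxis : ℝ × ℝ ≃ₜ ℝ × ℝ := (Homeomorph.refl ℝ).prodCongr (Homeomorph.neg ℝ)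

@[simp] theorem reflAxis_apply (p : ℝ × ℝ) : reflAxis p = (p.1, -p.2) := rfl

theorem IsBandLift.comp_reflAxis (hF : IsBandLift ε δ F) : IsBandLift ε δ (F ∘ reflAxis) := by
  refine hF.comp_homeomorph _ (fun p => by simp [strip]) fun p q => ?_
  simp only [band_rel_iff, deck, reflAxis_apply, Prod.ext_iff, mul_neg, neg_inj]

theorem IsBandLift.comp_neg_fst (hF : IsBandLift ε δ F) :
    IsBandLift ε δ (F ∘ (Homeomorph.neg ℝ).prodCongr (Homeomorph.refl ℝ)) := by
  refine hF.comp_homeomorph _ (fun p => by simp [strip]) fun p q => ?_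
  simp only [band_rel_iff, deck, Prod.ext_iff]
  constructor <;>
  · rintro ⟨n, h1, h2⟩
    refine ⟨-n, ?_, by simpa [signPow_neg] using h2⟩
    simp at h1 ⊢
    linarith

theorem IsBandLift.continuousAt (hF : IsBandLift ε δ F) {p : ℝ × ℝ} (hp : p ∈ strip δ) :
    ContinuousAt F p :=
  hF.continuousOn.continuousAt ((isOpen_strip δ).mem_nhds hp)

/-- The square of radius `r` about `(x, 0)`. -/
def square (x r : ℝ) : Set (ℝ × ℝ) := {p | |p.1 - x| < r ∧ |p.2| < r}

theorem square_eq_ball (x r : ℝ) : square x r = Metric.ball ((x, 0) : ℝ × ℝ) r := by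
  ext p
  simp [square, Prod.dist_eq, Real.dist_eq]

theorem isOpen_square (x r : ℝ) : IsOpen (square x r) := by
  rw [square_eq_ball]; exact Metric.isOpen_ball

theorem center_mem_square {x r : ℝ} (hr : 0 < r) : (x, (0 : ℝ)) ∈ square x r := by
  simp [square, hr]

theorem square_mono {x r r' : ℝ} (h : r ≤ r') : square x r ⊆ square x r' := fun _ hp =>
  ⟨hp.1.trans_le h, hp.2.trans_le h⟩

theorem square_subset_strip {x r : ℝ} (h : r ≤ δ) : square x r ⊆ strip δ := fun _ hp =>
  hp.2.trans_le h

theorem square_upper_isPreconnected (x r : ℝ) : IsPreconnected (square x r ∩ {p | 0 < p.2}) := by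
  have : square x r ∩ {p | 0 < p.2} = Ioo (x - r) (x + r) ×ˢ Ioo 0 r := by
    ext p
    simp only [square, mem_inter_iff, mem_ofPred_eq, mem_prod, mem_Ioo, abs_lt]
    constructor
    · rintro ⟨⟨⟨h1, h2⟩, h3, h4⟩, h5⟩; exact ⟨⟨by linarith, by linarith⟩, h5, h4⟩
    · rintro ⟨⟨h1, h2⟩, h3, h4⟩
      exact ⟨⟨⟨by linarith, by linarith⟩, by linarith, h4⟩, h3⟩
  rw [this]
  exact isPreconnected_Ioo.prod isPreconnected_Ioo

theorem exists_square_subset {x : ℝ} {O : Set (ℝ × ℝ)} (h : O ∈ 𝓝 (x, (0 : ℝ))) {c : ℝ}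
    (hc : 0 < c) : ∃ r > 0, r ≤ c ∧ square x r ⊆ O := by
  obtain ⟨r, hr, h⟩ := Metric.mem_nhds_iff.1 h
  refine ⟨min r c, lt_min hr hc, min_le_right _ _, ?_⟩
  rw [square_eq_ball]
  exact (Metric.ball_subset_ball (min_le_left _ _)).trans h

/-- Near `F (x, 0)`, the map `ι` takes the upper side of the core to the lower side. -/
def SwapsSides (F : ℝ × ℝ → Y) (δ : ℝ) (ι : Y → Y) (x r : ℝ) : Prop :=
  0 < r ∧ r ≤ δ ∧ r ≤ 1 / 4 ∧ ∀ p ∈ square x r, 0 < p.2 →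
    ∃ q ∈ strip δ, q.2 < 0 ∧ |q.1 - x| < 1 / 4 ∧ ι (F p) = F q

/-- Near `F (x, 0)`, the map `ι` takes the upper side of the core to itself. -/
def KeepsSides (F : ℝ × ℝ → Y) (δ : ℝ) (ι : Y → Y) (x r : ℝ) : Prop :=
  0 < r ∧ r ≤ δ ∧ r ≤ 1 / 4 ∧ ∀ p ∈ square x r, 0 < p.2 →
    ∃ q ∈ strip δ, 0 < q.2 ∧ |q.1 - x| < 1 / 4 ∧ ι (F p) = F q

/-- A column of width at most one embeds. The bounds `1 / 4` in `SwapsSides` and `KeepsSides` keep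
points that are compared less than one apart. -/
theorem IsBandLift.chart_injOn (hF : IsBandLift ε δ F) {x c : ℝ} (hc : c ≤ 1 / 2) :
    InjOn F {p | p ∈ strip δ ∧ |p.1 - x| < c} := by
  rintro p ⟨hp, hpx⟩ q ⟨hq, hqx⟩ h
  refine hF.eq_of_dist_lt hp hq h ?_
  calc |q.1 - p.1| = |(q.1 - x) - (p.1 - x)| := by ring_nf
    _ ≤ |q.1 - x| + |p.1 - x| := abs_sub _ _
    _ < 1 := by linarith

/-- The core is fixed and `ι` is injective, so `ι` maps a small upper half square off the core. The
half square is connected, so its image lies on one side. -/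
theorem IsBandLift.swapsSides_or_keepsSides (hF : IsBandLift ε δ F) {ι : Y → Y}
    (hι : Continuous ι) (hi : Function.Involutive ι) (hfix : ∀ x, ι (F (x, 0)) = F (x, 0)) (x : ℝ) :
    ∃ r, SwapsSides F δ ι x r ∨ KeepsSides F δ ι x r := by
  set V : Set (ℝ × ℝ) := {p | p ∈ strip δ ∧ |p.1 - x| < 1 / 4} with hVdef
  have hVo : IsOpen V := 
    (isOpen_strip δ).inter (isOpen_lt (continuous_fst.sub continuous_const).abs continuous_const)
  have hV : IsOpen (F '' V) := hF.isOpen_image V (fun p hp => hp.1) hVo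
  have hcore := core_mem_strip hF.pos x
  have hc : ContinuousAt (fun p => ι (F p)) (x, 0) :=
    hι.continuousAt.comp (hF.continuousAt hcore)
  have hO : (fun p => ι (F p)) ⁻¹' (F '' V) ∈ 𝓝 (x, (0 : ℝ)) := by
    refine hc (hV.mem_nhds ?_)
    exact ⟨_, ⟨hcore, by norm_num⟩, (hfix x).symm⟩
  obtain ⟨r, hr, hrc, hrO⟩ := exists_square_subset hO (lt_min hF.pos (by norm_num : (0 : ℝ) < 1 / 4))
  have hrδ := hrc.trans (min_le_left _ _)
  have hr4 := hrc.trans (min_le_right _ _)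
  have hrO' : ∀ p ∈ square x r, ∃ q ∈ V, F q = ι (F p) := fun p hp => hrO hp
  choose! q hqV hq using hrO'
  have hcov : ∀ p ∈ square x r, 0 < p.2 → (q p).2 ≠ 0 := by
    intro p hp h0 hq0
    have h1 : F (q p) ∈ range fun x : ℝ => F (x, 0) := (hF.mem_core_iff (hqV p hp).1).2 hq0
    have h2 : F p ∈ range fun x : ℝ => F (x, 0) := by
      obtain ⟨y, hy⟩ := h1
      refine ⟨y, ?_⟩
      have := congrArg ι (hq p hp)
      rw [hi, ← hy] at this
      simp only at this
      rw [← this, hfix]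
    exact h0.ne' ((hF.mem_core_iff (square_subset_strip hrδ hp)).1 h2)
  have hpre : IsPreconnected ((fun p => ι (F p)) '' (square x r ∩ {p | 0 < p.2})) := by
    refine (square_upper_isPreconnected x r).image _ (hι.comp_continuousOn ?_)
    exact hF.continuousOn.mono (inter_subset_left.trans (square_subset_strip hrδ))
  by_contra hcon
  replace hcon := not_exists.1 hcon r
  simp only [SwapsSides, KeepsSides, not_or, not_exists, not_and, not_forall] at hcon
  obtain ⟨⟨p, hp, hp0, hpq⟩, ⟨p', hp', hp0', hpq'⟩⟩ :=
    And.intro (hcon.1 hr hrδ hr4) (hcon.2 hr hrδ hr4)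
  have e1 : 0 < (q p).2 := lt_of_le_of_ne
    (not_lt.1 fun h => hpq (q p) (hqV p hp).1 h (hqV p hp).2 (hq p hp).symm) (hcov p hp hp0).symm
  have e2 : (q p').2 < 0 := lt_of_le_of_ne
    (not_lt.1 fun h => hpq' (q p') (hqV p' hp').1 h (hqV p' hp').2 (hq p' hp').symm) (hcov p' hp' hp0')
  have hA : IsOpen (F '' (V ∩ {p | 0 < p.2})) := hF.isOpen_image _ (fun p hp => hp.1.1)
    (hVo.inter (isOpen_lt continuous_const continuous_snd))
  have hB : IsOpen (F '' (V ∩ {p | p.2 < 0})) := hF.isOpen_image _ (fun p hp => hp.1.1)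
    (hVo.inter (isOpen_lt continuous_snd continuous_const))
  obtain ⟨y, -, ⟨a, ha, hay⟩, ⟨b, hb, hby⟩⟩ := hpre _ _ hA hB (by
      rintro _ ⟨p, ⟨hp, hp0⟩, rfl⟩
      simp only
      rw [← hq p hp]
      rcases lt_or_gt_of_ne (hcov p hp hp0) with h | h
      · exact Or.inr ⟨_, ⟨hqV p hp, h⟩, rfl⟩
      · exact Or.inl ⟨_, ⟨hqV p hp, h⟩, rfl⟩)
    ⟨_, ⟨p, ⟨hp, hp0⟩, rfl⟩, ⟨q p, ⟨hqV p hp, e1⟩, hq p hp⟩⟩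
    ⟨_, ⟨p', ⟨hp', hp0'⟩, rfl⟩, ⟨q p', ⟨hqV p' hp', e2⟩, hq p' hp'⟩⟩
  have hab : a = b := hF.chart_injOn (x := x) (by norm_num : (1 : ℝ) / 4 ≤ 1 / 2) ha.1 hb.1
    (hay.trans hby.symm)
  have h1 : 0 < a.2 := ha.2
  have h2 : b.2 < 0 := hb.2
  rw [hab] at h1
  linarith

theorem IsBandLift.false_of_swapsSides_keepsSides (hF : IsBandLift ε δ F) {ι : Y → Y}
    {x y r r' : ℝ} (hx : SwapsSides F δ ι x r) (hy : KeepsSides F δ ι y r') {z : ℝ}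
    (hzx : |z - x| < r) (hzy : |z - y| < r') : False := by
  obtain ⟨hr, hrδ, hr4, h⟩ := hx
  obtain ⟨hr', hrδ', hr4', h'⟩ := hy
  have hm : 0 < min r r' / 2 := by positivity
  have hp : (z, min r r' / 2) ∈ square x r := ⟨hzx, by
    rw [abs_of_pos hm]; linarith [min_le_left r r']⟩
  have hp' : (z, min r r' / 2) ∈ square y r' := ⟨hzy, by
    rw [abs_of_pos hm]; linarith [min_le_right r r']⟩
  obtain ⟨q, hq, hq0, hqx, hqF⟩ := h _ hp hm
  obtain ⟨q', hq', hq0', hqx', hqF'⟩ := h' _ hp' hm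
  have : q = q' := by
    refine hF.eq_of_dist_lt hq hq' (hqF.symm.trans hqF') ?_
    rw [abs_lt] at *
    constructor <;> linarith [hqx.1, hqx.2, hqx'.1, hqx'.2, hzx.1, hzx.2, hzy.1, hzy.2]
  rw [this] at hq0
  linarith

/-- Both alternatives are open conditions and they exclude each other on overlapping squares, so
connectedness of the line propagates one of them. On the universal cover the upper side makes sense
even when the core is one-sided. -/
theorem IsBandLift.swapsSides_all (hF : IsBandLift ε δ F) {ι : Y → Y}
    (hι : Continuous ι) (hi : Function.Involutive ι) (hfix : ∀ x, ι (F (x, 0)) = F (x, 0))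
    {x₁ : ℝ} (h₁ : ∃ r, SwapsSides F δ ι x₁ r) (x : ℝ) : ∃ r, SwapsSides F δ ι x r := by
  have hor : ∀ x, (∃ r, SwapsSides F δ ι x r) ∨ ∃ r, KeepsSides F δ ι x r := fun x =>
    exists_or.1 (hF.swapsSides_or_keepsSides hι hi hfix x)
  have hA : IsOpen {x | ∃ r, SwapsSides F δ ι x r} := by
    refine Metric.isOpen_iff.2 fun x ⟨r, hr⟩ => ⟨r, hr.1, fun y hy => (hor y).resolve_right ?_⟩
    rintro ⟨r', hr'⟩
    exact hF.false_of_swapsSides_keepsSides hr hr' (z := y) hy (by simpa using hr'.1)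
  have hB : IsOpen {x | ∃ r, SwapsSides F δ ι x r}ᶜ := by
    refine Metric.isOpen_iff.2 fun x hx => ?_
    obtain ⟨r, hr⟩ := (hor x).resolve_left hx
    refine ⟨r, hr.1, fun y hy => ?_⟩
    rintro ⟨r', hr'⟩
    exact hF.false_of_swapsSides_keepsSides hr' hr (z := y) (by simpa using hr'.1) hy
  have := IsClopen.eq_univ ⟨isOpen_compl_iff.1 hB, hA⟩ ⟨x₁, h₁⟩
  exact (this ▸ mem_univ x : x ∈ {x | ∃ r, SwapsSides F δ ι x r})

theorem IsBandLift.not_fixed_of_swapsSides (hF : IsBandLift ε δ F) {ι : Y → Y} {x r : ℝ}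
    (h : SwapsSides F δ ι x r) {p : ℝ × ℝ} (hp : p ∈ square x r) (hp0 : 0 < p.2) :
    ι (F p) ≠ F p := by
  obtain ⟨hr, hrδ, hr4, h⟩ := h
  obtain ⟨q, hq, hq0, hqx, hqF⟩ := h p hp hp0
  intro hfix
  have : p = q := hF.chart_injOn (x := x) (le_refl (1 / 2))
    ⟨square_subset_strip hrδ hp, hp.1.trans_le (by linarith)⟩ ⟨hq, hqx.trans (by norm_num)⟩
    (hfix.symm.trans hqF)
  rw [this] at hp0
  linarith

/-- If `ι` swaps the sides of the core at one point, as seen from both sides, then the core is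
relatively open in the fixed point set. -/
theorem IsBandLift.exists_isOpen_fixed (hF : IsBandLift ε δ F) {ι : Y → Y}
    (hι : Continuous ι) (hi : Function.Involutive ι) (hfix : ∀ x, ι (F (x, 0)) = F (x, 0))
    {x₁ : ℝ} (h₁ : ∃ r, SwapsSides F δ ι x₁ r) (h₂ : ∃ r, SwapsSides (F ∘ reflAxis) δ ι x₁ r) :
    ∃ W, IsOpen W ∧ (range fun x : ℝ => F (x, 0)) ⊆ W ∧
      ∀ y ∈ W, ι y = y → y ∈ range fun x : ℝ => F (x, 0) := by
  have k₁ := hF.swapsSides_all hι hi hfix h₁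
  have k₂ := hF.comp_reflAxis.swapsSides_all hι hi (by simpa using hfix) h₂
  choose r hr using k₁
  choose r' hr' using k₂
  refine ⟨⋃ x, F '' square x (min (r x) (r' x)), isOpen_iUnion fun x => ?_, ?_, ?_⟩
  · exact hF.isOpen_image _ (square_subset_strip ((min_le_left _ _).trans (hr x).2.1))
      (isOpen_square _ _)
  · rintro _ ⟨x, rfl⟩
    exact mem_iUnion.2 ⟨x, _, center_mem_square (lt_min (hr x).1 (hr' x).1), rfl⟩
  · intro y hy hfy
    obtain ⟨x, p, hp, rfl⟩ := mem_iUnion.1 hy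
    rcases lt_trichotomy p.2 0 with h | h | h
    · refine absurd hfy ?_
      have := hF.comp_reflAxis.not_fixed_of_swapsSides (hr' x) (p := reflAxis p)
        ⟨hp.1.trans_le (min_le_right _ _), by
          simpa using hp.2.trans_le (min_le_right _ _)⟩ (by simpa using h)
      simpa using this
    · exact ⟨p.1, by rw [← h]⟩
    · exact absurd hfy (hF.not_fixed_of_swapsSides (hr x) (square_mono (min_le_left _ _) hp) h)

end Lifts

/-! ### The coordinate of an invariant disk -/

section Disk

variable {S : Type*} [TopologicalSpace S] {ι : S → S} {x₀ : S} (D : InvariantDisk ι x₀)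

namespace InvariantDisk

theorem injOn : InjOn D.e (Metric.ball 0 D.R) := injOn_iff_injective.2 D.isOpenEmbedding.injective

/-- The coordinate disk as a partial homeomorphism. -/
noncomputable def chart : OpenPartialHomeomorph ℂ S :=
  OpenPartialHomeomorph.ofContinuousOpenRestrict (D.injOn.toPartialEquiv D.e _)
    (continuousOn_iff_continuous_domRestrict.2 D.isOpenEmbedding.continuous)
    D.isOpenEmbedding.isOpenMap Metric.isOpen_ball

@[simp] theorem chart_source : D.chart.source = Metric.ball 0 D.R := rfl

@[simp] theorem chart_apply (z : ℂ) : D.chart z = D.e z := rfl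

theorem R_pos : 0 < D.R := one_pos.trans D.one_lt_R

theorem continuousOn_e : ContinuousOn D.e (Metric.ball 0 D.R) := D.chart.continuousOn

theorem isOpen_image {O : Set ℂ} (hO : IsOpen O) (h : O ⊆ Metric.ball 0 D.R) :
    IsOpen (D.e '' O) := D.chart.isOpen_image_of_subset_source hO h

/-- `ι` acts on the disk as complex conjugation. -/
def IsReflection : Prop := ∀ z ∈ Metric.ball (0 : ℂ) D.R, ι (D.e z) = D.e (starRingEnd ℂ z)

/-- `ι` acts on the disk as `z ↦ -z`. -/
def IsRotation : Prop := ∀ z ∈ Metric.ball (0 : ℂ) D.R, ι (D.e z) = D.e (-z)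

variable {D}

theorem IsReflection.fixed_iff (h : D.IsReflection) {z : ℂ} (hz : z ∈ Metric.ball (0 : ℂ) D.R) :
    ι (D.e z) = D.e z ↔ z.im = 0 := by
  rw [h z hz, D.injOn.eq_iff (by simpa using hz) hz, Complex.conj_eq_iff_im]

theorem IsRotation.fixed_iff (h : D.IsRotation) {z : ℂ} (hz : z ∈ Metric.ball (0 : ℂ) D.R) :
    ι (D.e z) = D.e z ↔ z = 0 := by
  rw [h z hz, D.injOn.eq_iff (by simpa using hz) hz, neg_eq_self]

end InvariantDisk

end Disk

/-! ### Fixed cores through the centre of a reflection disk -/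

section Reflection

variable {S : Type*} [TopologicalSpace S] {ι : S → S} {x₀ : S} {D : InvariantDisk ι x₀}
  {ε : ℤˣ} {δ : ℝ} {F : ℝ × ℝ → S}

/-- Near the centre the core is fixed, so it lies in the real axis. Its real coordinate is injective
and vanishes at `x₁`, hence takes both signs, and the intermediate value theorem fills an interval
about `0`. -/
theorem InvariantDisk.IsReflection.exists_axis_subset (hD : D.IsReflection)
    (hF : IsBandLift ε δ F) (hfix : ∀ x, ι (F (x, 0)) = F (x, 0)) {x₁ : ℝ}
    (hx₁ : F (x₁, 0) = x₀) :
    ∃ ρ > 0, ρ ≤ D.R ∧ ∀ s : ℝ, |s| < ρ → D.e s ∈ range fun x : ℝ => F (x, 0) := by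
  have hc : Continuous fun x : ℝ => F (x, 0) :=
    hF.continuousOn.comp_continuous (by fun_prop) fun x => core_mem_strip hF.pos x
  have h0 : (0 : ℂ) ∈ Metric.ball (0 : ℂ) D.R := Metric.mem_ball_self D.R_pos
  have hU : (fun x : ℝ => F (x, 0)) ⁻¹' D.chart.target ∈ 𝓝 x₁ :=
    hc.continuousAt (D.chart.open_target.mem_nhds (by simp only [hx₁]; exact ⟨0, h0, D.map_zero⟩))
  obtain ⟨r, hr, hrU⟩ := Metric.mem_nhds_iff.1 hU
  -- The bound `1 / 4` keeps the interval shorter than a period, so the core is injective on it.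
  set c := min (r / 2) (1 / 4) with hcdef
  have hc0 : 0 < c := by positivity
  have hcr : ∀ x ∈ Icc (x₁ - c) (x₁ + c), F (x, 0) ∈ D.chart.target := fun x hx => hrU (by
    rw [Metric.mem_ball, Real.dist_eq, abs_lt]
    constructor <;> linarith [hx.1, hx.2, min_le_left (r / 2) (1 / 4)])
  let k : ℝ → ℝ := fun x => (D.chart.symm (F (x, 0))).re
  have hk : ∀ x ∈ Icc (x₁ - c) (x₁ + c), D.e (k x) = F (x, 0) ∧ |k x| < D.R := by
    intro x hx
    obtain ⟨z, hz, hzF⟩ := hcr x hx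
    have him : z.im = 0 := by rw [← hD.fixed_iff hz, hzF, hfix]
    have hkx : D.chart.symm (F (x, 0)) = z := by rw [← hzF]; exact D.chart.left_inv hz
    have hre : ((k x : ℝ) : ℂ) = z := by
      simp only [k, hkx]
      exact Complex.ext (by simp) (by simp [him])
    refine ⟨by rw [hre, hzF], ?_⟩
    rw [← Real.norm_eq_abs, ← Complex.norm_real, hre]
    simpa using hz
  have hkc : ContinuousOn k (Icc (x₁ - c) (x₁ + c)) :=
    Complex.continuous_re.comp_continuousOn
      (D.chart.continuousOn_symm.comp hc.continuousOn hcr)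
  have hki : InjOn k (Icc (x₁ - c) (x₁ + c)) := by
    intro x hx y hy h
    have h1 : F (x, 0) = F (y, 0) := by rw [← (hk x hx).1, ← (hk y hy).1, h]
    have := hF.eq_of_dist_lt (core_mem_strip hF.pos x) (core_mem_strip hF.pos y) h1 (by
      rw [abs_lt]
      constructor <;> linarith [hx.1, hx.2, hy.1, hy.2, min_le_right (r / 2) (1 / 4)])
    exact congrArg Prod.fst this
  have hm : x₁ ∈ Icc (x₁ - c) (x₁ + c) := ⟨by linarith, by linarith⟩
  have ha : x₁ - c ∈ Icc (x₁ - c) (x₁ + c) := ⟨le_rfl, by linarith⟩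
  have hb : x₁ + c ∈ Icc (x₁ - c) (x₁ + c) := ⟨by linarith, le_rfl⟩
  have hk0 : k x₁ = 0 := by
    have : D.chart.symm (F (x₁, 0)) = 0 :=
      (congrArg D.chart.symm (hx₁.trans D.map_zero.symm)).trans (D.chart.left_inv h0)
    simp only [k, this, Complex.zero_re]
  have hle : x₁ - c ≤ x₁ + c := by linarith
  have hsgn : k (x₁ - c) * k (x₁ + c) < 0 := by
    rcases hkc.strictMonoOn_of_injOn_Icc' hle hki with h | h
    · have h1 := h ha hm (by linarith)
      have h2 := h hm hb (by linarith)
      rw [hk0] at h1 h2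
      exact mul_neg_of_neg_of_pos h1 h2
    · have h1 := h ha hm (by linarith)
      have h2 := h hm hb (by linarith)
      rw [hk0] at h1 h2
      exact mul_neg_of_pos_of_neg h1 h2
  have hne1 : k (x₁ - c) ≠ 0 := left_ne_zero_of_mul hsgn.ne
  have hne2 : k (x₁ + c) ≠ 0 := right_ne_zero_of_mul hsgn.ne
  refine ⟨min |k (x₁ - c)| |k (x₁ + c)|, lt_min (abs_pos.2 hne1) (abs_pos.2 hne2),
    (min_le_left _ _).trans (hk _ ha).2.le, fun s hs => ?_⟩
  have hs1 := hs.trans_le (min_le_left _ _)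
  have hs2 := hs.trans_le (min_le_right _ _)
  have hsu : s ∈ k '' uIcc (x₁ - c) (x₁ + c) := by
    refine intermediate_value_uIcc (by rwa [uIcc_of_le hle]) ?_
    rw [mem_uIcc]
    rcases lt_or_gt_of_ne hne1 with h | h
    · have h' : 0 < k (x₁ + c) := by nlinarith
      rw [abs_of_neg h] at hs1
      rw [abs_of_pos h'] at hs2
      left; exact ⟨by linarith [neg_abs_le s], by linarith [le_abs_self s]⟩
    · have h' : k (x₁ + c) < 0 := by nlinarith
      rw [abs_of_pos h] at hs1
      rw [abs_of_neg h'] at hs2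
      right; exact ⟨by linarith [neg_abs_le s], by linarith [le_abs_self s]⟩
  rw [uIcc_of_le hle] at hsu
  obtain ⟨x, hx, rfl⟩ := hsu
  exact ⟨x, (hk x hx).1.symm⟩

/-- Near the centre the core coincides with the real axis, so the imaginary part of the disk
coordinate vanishes exactly on the core. It has constant sign on the upper half square, and
conjugation reverses it. -/
theorem InvariantDisk.IsReflection.swapsSides (hD : D.IsReflection) (hι : Continuous ι)
    (hF : IsBandLift ε δ F) (hfix : ∀ x, ι (F (x, 0)) = F (x, 0)) {x₁ : ℝ}
    (hx₁ : F (x₁, 0) = x₀) : ∃ r, SwapsSides F δ ι x₁ r := by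
  obtain ⟨ρ, hρ, hρR, haxis⟩ := hD.exists_axis_subset hF hfix hx₁
  have hB : Metric.ball (0 : ℂ) ρ ⊆ Metric.ball 0 D.R := Metric.ball_subset_ball hρR
  have h0 : (0 : ℂ) ∈ Metric.ball (0 : ℂ) ρ := Metric.mem_ball_self hρ
  have hcore := core_mem_strip hF.pos x₁
  have hO : F ⁻¹' (D.e '' Metric.ball 0 ρ) ∈ 𝓝 (x₁, (0 : ℝ)) :=
    hF.continuousAt hcore ((D.isOpen_image Metric.isOpen_ball hB).mem_nhds
      (by rw [hx₁]; exact ⟨0, h0, D.map_zero⟩))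
  obtain ⟨r, hr, hrc, hrO⟩ := exists_square_subset hO (lt_min hF.pos (by norm_num : (0 : ℝ) < 1 / 4))
  have hrδ := hrc.trans (min_le_left _ _)
  have hr4 := hrc.trans (min_le_right _ _)
  have hstrip : square x₁ r ⊆ strip δ := square_subset_strip hrδ
  let m : ℝ × ℝ → ℝ := fun p => (D.chart.symm (F p)).im
  have hm : ∀ z ∈ Metric.ball (0 : ℂ) D.R, ∀ p, F p = D.e z → m p = z.im := by
    intro z hz p h
    have : D.chart.symm (F p) = z := by rw [h]; exact D.chart.left_inv hz
    simp only [m, this]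
  have hmc : ContinuousOn m (square x₁ r) :=
    Complex.continuous_im.comp_continuousOn (D.chart.continuousOn_symm.comp
      (hF.continuousOn.mono hstrip) fun p hp => image_mono hB (hrO hp))
  have hm0 : ∀ p ∈ square x₁ r, (m p = 0 ↔ p.2 = 0) := by
    intro p hp
    obtain ⟨z, hz, hzp⟩ := hrO hp
    rw [hm z (hB hz) p hzp.symm, ← hF.mem_core_iff (hstrip hp), ← hzp]
    constructor
    · intro him
      have hzre : ((z.re : ℝ) : ℂ) = z := Complex.ext (by simp) (by simp [him])
      rw [← hzre]
      refine haxis _ (lt_of_le_of_lt (Complex.abs_re_le_norm z) (by simpa using hz))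
    · rintro ⟨x, hx⟩
      rw [← hD.fixed_iff (hB hz), ← hx]
      exact hfix x
  have hup : ∀ p ∈ square x₁ r, ∀ q ∈ square x₁ r, 0 < p.2 → 0 < q.2 → 0 < m p * m q :=
    fun p hp q hq hp0 hq0 => mul_pos_of_isPreconnected (square_upper_isPreconnected x₁ r)
      (hmc.mono inter_subset_left) (fun a ha => fun h => (ne_of_gt (show 0 < a.2 from ha.2))
        ((hm0 a ha.1).1 h)) ⟨hp, hp0⟩ ⟨hq, hq0⟩
  have hFQ : IsOpen (F '' square x₁ r) := hF.isOpen_image _ hstrip (isOpen_square _ _)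
  have hc : ContinuousAt (fun p => ι (F p)) (x₁, 0) := hι.continuousAt.comp (hF.continuousAt hcore)
  have hO' : (fun p => ι (F p)) ⁻¹' (F '' square x₁ r) ∈ 𝓝 (x₁, (0 : ℝ)) :=
    hc (hFQ.mem_nhds ⟨_, center_mem_square hr, (hfix x₁).symm⟩)
  obtain ⟨r', hr', hrr', hrO'⟩ := exists_square_subset hO' hr
  refine ⟨r', hr', hrr'.trans hrδ, hrr'.trans hr4, fun p hp hp0 => ?_⟩
  obtain ⟨q, hq, hqF⟩ : ∃ q ∈ square x₁ r, F q = ι (F p) := hrO' hp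
  refine ⟨q, hstrip hq, ?_, hq.1.trans_le hr4, hqF.symm⟩
  have hpr := square_mono hrr' hp
  obtain ⟨z, hz, hzp⟩ := hrO hpr
  have hmp := hm z (hB hz) p hzp.symm
  have hmq : m q = -z.im := by
    rw [hm (starRingEnd ℂ z) (by simpa using hB hz) q, Complex.conj_im]
    rw [hqF, ← hzp, hD z (hB hz)]
  have hz0 : z.im ≠ 0 := by rw [← hmp, Ne, hm0 p hpr]; exact hp0.ne'
  rcases lt_trichotomy q.2 0 with h | h | h
  · exact h
  · rw [← hm0 q hq, hmq, neg_eq_zero] at h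
    exact absurd h hz0
  · have := hup p hpr q hq hp0 h
    rw [hmp, hmq] at this
    nlinarith [mul_self_nonneg z.im]

/-- A band core fixed by `ι` that passes through the centre of a reflection disk is relatively
open in the fixed point set. -/
theorem InvariantDisk.IsReflection.exists_isOpen (hD : D.IsReflection) (hι : Continuous ι)
    (hi : Function.Involutive ι) {γ : Set S} (hγ : γ ∈ fixedCores ε ι) (h0 : x₀ ∈ γ) :
    ∃ W, IsOpen W ∧ γ ⊆ W ∧ ∀ y ∈ W, ι y = y → y ∈ γ := by
  obtain ⟨hγ, hfix⟩ := hγ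
  obtain ⟨δ, F, hF, rfl⟩ := isBandCore_iff.1 hγ
  obtain ⟨x₁, hx₁⟩ := h0
  have hfix' : ∀ x, ι (F (x, 0)) = F (x, 0) := fun x => hfix _ ⟨x, rfl⟩
  exact hF.exists_isOpen_fixed hι hi hfix' (hD.swapsSides hι hF hfix' hx₁)
    (hD.swapsSides hι hF.comp_reflAxis (by simpa using hfix') (by simpa using hx₁))

theorem InvariantDisk.ofReal_mem_ball {s : ℝ} :
    (s : ℂ) ∈ Metric.ball (0 : ℂ) D.R ↔ s ∈ Ioo (-D.R) D.R := by
  simp [abs_lt]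

/-- The real diameter is a connected set of fixed points meeting `γ`, and `γ` is relatively clopen
among the fixed points. -/
theorem InvariantDisk.IsReflection.axis_subset [T2Space S] (hD : D.IsReflection)
    (hι : Continuous ι) (hi : Function.Involutive ι) {γ : Set S} (hγ : γ ∈ fixedCores ε ι)
    (h0 : x₀ ∈ γ) {s : ℝ} (hs : s ∈ Ioo (-D.R) D.R) : D.e s ∈ γ := by
  obtain ⟨W, hW, hγW, hWγ⟩ := hD.exists_isOpen hι hi hγ h0
  have hpre : IsPreconnected ((fun s : ℝ => D.e s) '' Ioo (-D.R) D.R) :=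
    isPreconnected_Ioo.image _ (D.continuousOn_e.comp Complex.continuous_ofReal.continuousOn
      fun s hs => InvariantDisk.ofReal_mem_ball.2 hs)
  by_contra hsγ
  obtain ⟨y, ⟨t, ht, rfl⟩, hyW, hyγ⟩ := hpre W γᶜ hW hγ.1.isCompact.isClosed.isOpen_compl
    (fun x _ => (em (x ∈ γ)).imp (fun h => hγW h) id)
    ⟨_, ⟨0, ⟨by linarith [D.R_pos], D.R_pos⟩, rfl⟩, hγW (by simpa [D.map_zero] using h0)⟩
    ⟨_, ⟨s, hs, rfl⟩, hsγ⟩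
  exact hyγ (hWγ _ hyW ((hD.fixed_iff (InvariantDisk.ofReal_mem_ball.2 ht)).2 (by simp)))

theorem InvariantDisk.IsReflection.mem_iff [T2Space S] (hD : D.IsReflection)
    (hι : Continuous ι) (hi : Function.Involutive ι) {γ : Set S} (hγ : γ ∈ fixedCores ε ι)
    (h0 : x₀ ∈ γ) {z : ℂ} (hz : z ∈ Metric.ball (0 : ℂ) D.R) : D.e z ∈ γ ↔ z.im = 0 := by
  constructor
  · intro h
    exact (hD.fixed_iff hz).1 (hγ.2 _ h)
  · intro h
    have hzre : ((z.re : ℝ) : ℂ) = z := Complex.ext (by simp) (by simp [h])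
    rw [← hzre] at hz ⊢
    exact hD.axis_subset hι hi hγ h0 (InvariantDisk.ofReal_mem_ball.1 hz)

end Reflection

/-- Clamp to `[-b, b]` and continue with slope one beyond both ends. -/
theorem exists_homeomorph_of_strictMonoOn {b : ℝ} (hb : 0 < b) {ψ : ℝ → ℝ} (hc : Continuous ψ)
    (hm : StrictMonoOn ψ (Icc (-b) b)) :
    ∃ φ : ℝ ≃ₜ ℝ, StrictMono φ ∧ ∀ s ∈ Icc (-b) b, φ s = ψ s := by
  let κ : ℝ → ℝ := fun s => max (-b) (min b s)
  have hκ : ∀ s, κ s ∈ Icc (-b) b := fun s =>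
    ⟨le_max_left _ _, max_le (by linarith) (min_le_left _ _)⟩
  have hκ' : ∀ s ∈ Icc (-b) b, κ s = s := fun s hs => by
    simp only [κ]; rw [min_eq_right hs.2, max_eq_right hs.1]
  have hκm : Monotone κ := fun s t h => max_le_max le_rfl (min_le_min le_rfl h)
  have hκl : ∀ s t, s ≤ t → κ t - κ s ≤ t - s := by
    intro s t h
    have h1 : κ t ≤ κ s + (t - s) := by
      refine max_le (by linarith [(hκ s).1]) ?_
      rcases le_total b s with h' | h'
      · have : κ s = b := by simp only [κ]; rw [min_eq_left h', max_eq_right (by linarith)]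
        rw [this]
        exact (min_le_left _ _).trans (by linarith)
      · have : s ≤ κ s := by simp only [κ]; rw [min_eq_right h']; exact le_max_right _ _
        exact (min_le_right _ _).trans (by linarith)
    linarith
  let φ : ℝ → ℝ := fun s => ψ (κ s) + (s - κ s)
  have hφc : Continuous φ := by fun_prop
  have hφm : StrictMono φ := by
    intro s t hst
    simp only [φ]
    rcases (hκm hst.le).eq_or_lt with h | h
    · rw [h]; linarith
    · linarith [hm (hκ s) (hκ t) h, hκl s t hst.le]
  have hψ : ∀ s, ψ (-b) ≤ ψ (κ s) ∧ ψ (κ s) ≤ ψ b := fun s =>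
    ⟨hm.monotoneOn ⟨le_rfl, by linarith⟩ (hκ s) (hκ s).1,
      hm.monotoneOn (hκ s) ⟨by linarith, le_rfl⟩ (hκ s).2⟩
  have hφs : Function.Surjective φ := by
    refine hφc.surjective ?_ ?_
    · refine Filter.tendsto_atTop_mono (f := fun s => s + (ψ (-b) - b)) (fun s => ?_)
        (Filter.tendsto_atTop_add_const_right _ _ Filter.tendsto_id)
      simp only [φ]
      linarith [(hψ s).1, (hκ s).2]
    · refine Filter.tendsto_atBot_mono (f := fun s => s + (ψ b + b)) (fun s => ?_)
        (Filter.tendsto_atBot_add_const_right _ _ Filter.tendsto_id)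
      simp only [φ]
      linarith [(hψ s).2, (hκ s).1]
  refine ⟨(StrictMono.orderIsoOfSurjective φ hφm hφs).toHomeomorph, hφm, fun s hs => ?_⟩
  show ψ (κ s) + (s - κ s) = ψ s
  rw [hκ' s hs, sub_self, add_zero]

/-- The plane in real coordinates. -/
noncomputable def toComplex : ℝ × ℝ ≃ₜ ℂ := Complex.equivRealProdCLM.symm.toHomeomorph

theorem toComplex_re (p : ℝ × ℝ) : (toComplex p).re = p.1 := rfl

theorem toComplex_im (p : ℝ × ℝ) : (toComplex p).im = p.2 := rfl

theorem toComplex_axis (s : ℝ) : toComplex (s, 0) = (s : ℂ) := Complex.ext rfl rfl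

/-! ### Comparing the coordinate of the disk with that of the band -/

section Reflection

variable {S : Type*} [TopologicalSpace S] {ι : S → S} {x₀ : S}
  {D : InvariantDisk ι x₀} {ε : ℤˣ} {δ : ℝ} {F : ℝ × ℝ → S}

/-- The diameter is a path in the core circle and lifts to the covering line. Clamping by `κ` makes
the path defined on all of `ℝ`. -/
theorem IsBandLift.exists_axis_lift (hF : IsBandLift ε δ F) {b : ℝ} (hb : 0 < b) (hbR : b < D.R)
    (haxis : ∀ s ∈ Ioo (-D.R) D.R, D.e (s : ℝ) ∈ range fun x : ℝ => F (x, 0)) :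
    ∃ ψ : ℝ → ℝ, Continuous ψ ∧ InjOn ψ (Icc (-b) b) ∧
      ∀ s ∈ Icc (-b) b, F (ψ s, 0) = D.e (s : ℝ) := by
  let κ : ℝ → ℝ := fun s => max (-b) (min b s)
  have hκ : ∀ s, κ s ∈ Ioo (-D.R) D.R := fun s =>
    ⟨lt_of_lt_of_le (by linarith) (le_max_left _ _),
      (max_le (by linarith) (min_le_left _ _)).trans_lt hbR⟩
  obtain ⟨c, hc, hcF⟩ := hF.exists_isEmbedding_addCircle
  have hr : ∀ s, D.e (κ s : ℝ) ∈ range c := by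
    intro s
    obtain ⟨x, hx⟩ := haxis _ (hκ s)
    exact ⟨x, (hcF x).trans hx⟩
  have he : Continuous fun s => D.e (κ s : ℝ) := by
    refine D.continuousOn_e.comp_continuous
      (Complex.continuous_ofReal.comp (show Continuous κ by fun_prop)) fun s => ?_
    exact InvariantDisk.ofReal_mem_ball.2 (hκ s)
  let f : C(ℝ, AddCircle (1 : ℝ)) :=
    ⟨fun s => hc.toHomeomorph.symm ⟨_, hr s⟩, hc.toHomeomorph.symm.continuous.comp
      (he.subtype_mk _)⟩
  have hf : ∀ s, c (f s) = D.e (κ s : ℝ) := fun s =>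
    congrArg Subtype.val (hc.toHomeomorph.apply_symm_apply ⟨_, hr s⟩)
  obtain ⟨y, hy⟩ := QuotientAddGroup.mk_surjective (f 0)
  obtain ⟨ψ, ⟨-, hψ⟩, -⟩ :=
    (AddCircle.isCoveringMap_coe (1 : ℝ)).existsUnique_continuousMap_lifts f 0 y hy
  have hF : ∀ s ∈ Icc (-b) b, F (ψ s, 0) = D.e (s : ℝ) := by
    intro s hs
    rw [← hcF, show ((ψ s : ℝ) : AddCircle (1 : ℝ)) = f s from congrFun hψ s, hf]
    simp only [κ]
    rw [min_eq_right hs.2, max_eq_right hs.1]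
  refine ⟨ψ, ψ.continuous, fun s hs t ht h => ?_, hF⟩
  have h1 : D.e (s : ℝ) = D.e (t : ℝ) := by rw [← hF s hs, ← hF t ht, h]
  have hmem : ∀ s ∈ Icc (-b) b, ((s : ℝ) : ℂ) ∈ Metric.ball (0 : ℂ) D.R := fun s hs =>
    InvariantDisk.ofReal_mem_ball.2 ⟨by linarith [hs.1], by linarith [hs.2]⟩
  exact_mod_cast D.injOn (hmem s hs) (hmem t ht) h1

/-- The axis of a reflection disk inside a band core, in an increasing coordinate of the core. -/
theorem IsBandLift.exists_axis_coordinate (hF : IsBandLift ε δ F) {b : ℝ} (hb : 0 < b)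
    (hbR : b < D.R) (haxis : ∀ s ∈ Ioo (-D.R) D.R, D.e (s : ℝ) ∈ range fun x : ℝ => F (x, 0)) :
    ∃ F' : ℝ × ℝ → S, IsBandLift ε δ F' ∧
      (range fun x : ℝ => F' (x, 0)) = (range fun x : ℝ => F (x, 0)) ∧
      ∃ φ : ℝ ≃ₜ ℝ, StrictMono φ ∧ (∀ s ∈ Icc (-b) b, F' (φ s, 0) = D.e (s : ℝ)) ∧
        φ b < φ (-b) + 1 := by
  -- If `φ` advanced by a full period, it would reach `φ (-b) + 1`. This lies over the same core
  -- point as `φ (-b)`, against injectivity of the disk coordinate.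
  have hlen : ∀ (F : ℝ × ℝ → S) (_ : IsBandLift ε δ F) (φ : ℝ ≃ₜ ℝ), StrictMono φ →
      (∀ s ∈ Icc (-b) b, F (φ s, 0) = D.e (s : ℝ)) → φ b < φ (-b) + 1 := by
    intro F hF φ hφ h
    by_contra hcon
    have hle : -b ≤ b := by linarith
    obtain ⟨s, hs, hs1⟩ := intermediate_value_Icc hle φ.continuous.continuousOn
      (⟨by linarith, not_lt.1 hcon⟩ : φ (-b) + 1 ∈ Icc (φ (-b)) (φ b))
    have h1 : D.e (s : ℝ) = D.e ((-b : ℝ) : ℂ) := by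
      rw [← h s hs, ← h (-b) ⟨le_rfl, hle⟩, hs1,
        ← hF.deck_eq (core_mem_strip hF.pos (φ (-b))) 1]
      simp [deck]
    have h2 := D.injOn (InvariantDisk.ofReal_mem_ball.2 ⟨by linarith [hs.1], by linarith [hs.2]⟩)
      (InvariantDisk.ofReal_mem_ball.2 ⟨by linarith, by linarith⟩) h1
    have h3 : s = -b := by exact_mod_cast h2
    rw [h3] at hs1
    linarith
  obtain ⟨ψ, hψc, hψi, hψ⟩ := hF.exists_axis_lift hb hbR haxis
  rcases hψc.continuousOn.strictMonoOn_of_injOn_Icc' (by linarith : -b ≤ b) hψi with h | h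
  · obtain ⟨φ, hφ, hφψ⟩ := exists_homeomorph_of_strictMonoOn hb hψc h
    have hφF : ∀ s ∈ Icc (-b) b, F (φ s, 0) = D.e (s : ℝ) := fun s hs => by
      rw [hφψ s hs, hψ s hs]
    exact ⟨F, hF, rfl, φ, hφ, hφF, hlen F hF φ hφ hφF⟩
  -- The lift is decreasing: the direction of the core is reversed.
  · obtain ⟨φ, hφ, hφψ⟩ := exists_homeomorph_of_strictMonoOn hb hψc.neg
      (fun s hs t ht hst => neg_lt_neg (h hs ht hst))
    have hφF : ∀ s ∈ Icc (-b) b, (F ∘ (Homeomorph.neg ℝ).prodCongr (Homeomorph.refl ℝ)) (φ s, 0) =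
        D.e (s : ℝ) := fun s hs => by
      rw [hφψ s hs, ← hψ s hs]; simp
    refine ⟨_, hF.comp_neg_fst, ?_, φ, hφ, hφF, hlen _ hF.comp_neg_fst φ hφ hφF⟩
    ext y
    constructor
    · rintro ⟨x, rfl⟩; exact ⟨-x, rfl⟩
    · rintro ⟨x, rfl⟩; exact ⟨-x, by simp⟩

/-- A fundamental domain of a band as a partial homeomorphism. -/
noncomputable def IsBandLift.chart (hF : IsBandLift ε δ F) (m : ℝ) :
    OpenPartialHomeomorph (ℝ × ℝ) S :=
  have hO : IsOpen (strip δ ∩ {p | |p.1 - m| < 1 / 2}) :=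
    (isOpen_strip δ).inter (isOpen_lt (continuous_fst.sub continuous_const).abs continuous_const)
  OpenPartialHomeomorph.ofContinuousOpenRestrict
    ((hF.chart_injOn (x := m) (le_refl (1 / 2))).toPartialEquiv F (strip δ ∩ {p | |p.1 - m| < 1 / 2}))
    (hF.continuousOn.mono inter_subset_left)
    (fun U hU => by
      have := hF.isOpen_image (Subtype.val '' U) (by rintro _ ⟨p, _, rfl⟩; exact p.2.1)
        (hO.isOpenMap_subtype_val U hU)
      rwa [← image_comp] at this) hO

theorem IsBandLift.chart_source (hF : IsBandLift ε δ F) (m : ℝ) :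
    (hF.chart m).source = strip δ ∩ {p | |p.1 - m| < 1 / 2} := rfl

theorem IsBandLift.chart_apply (hF : IsBandLift ε δ F) (m : ℝ) (p : ℝ × ℝ) :
    hF.chart m p = F p := rfl

/-- The transition map from the disk to the band near the axis. -/
theorem IsBandLift.exists_transition (hF : IsBandLift ε δ F) {b : ℝ} (hb : 0 < b) (hbR : b < D.R)
    (hmem : ∀ z ∈ Metric.ball (0 : ℂ) D.R, D.e z ∈ (range fun x : ℝ => F (x, 0)) ↔ z.im = 0)
    {φ : ℝ ≃ₜ ℝ} (hφ : StrictMono φ) (hφF : ∀ s ∈ Icc (-b) b, F (φ s, 0) = D.e (s : ℝ))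
    (hlen : φ b < φ (-b) + 1) :
    ∃ F' : ℝ × ℝ → S, ∃ hF' : IsBandLift ε δ F', (∀ x, F' (x, 0) = F (x, 0)) ∧
      ∃ m : ℝ, ∃ η > 0, η ≤ δ ∧ ∃ E : OpenPartialHomeomorph (ℝ × ℝ) (ℝ × ℝ),
        E.source = Ioo (φ (-b)) (φ b) ×ˢ Ioo (-η) η ∧ E.source ⊆ (hF'.chart m).source ∧
        (∀ p ∈ E.source, E p ∈ (hF'.chart m).source) ∧
        (∀ p ∈ E.source, toComplex (φ.symm p.1, p.2) ∈ Metric.ball (0 : ℂ) D.R ∧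
          F' (E p) = D.e (toComplex (φ.symm p.1, p.2))) ∧
        (∀ x, (x, (0 : ℝ)) ∈ E.source → E (x, 0) = (x, 0)) ∧
        (∀ p ∈ E.source, 0 < p.2 → 0 < (E p).2) ∧ (∀ p ∈ E.source, p.2 < 0 → (E p).2 < 0) := by
  set m := (φ (-b) + φ b) / 2 with hm
  have hbb : φ (-b) < φ b := hφ (by linarith)
  let T : ℝ × ℝ ≃ₜ ℂ := (φ.symm.prodCongr (Homeomorph.refl ℝ)).trans toComplex
  have hT : ∀ p, T p = toComplex (φ.symm p.1, p.2) := fun p => rfl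
  let A : OpenPartialHomeomorph (ℝ × ℝ) S := T.toOpenPartialHomeomorph.trans D.chart
  have hAs : ∀ p, p ∈ A.source ↔ T p ∈ Metric.ball (0 : ℂ) D.R := by
    intro p
    simp [A]
  have hA : ∀ p, A p = D.e (T p) := fun p => rfl
  let B := hF.chart m
  let E₀ := A.trans B.symm
  have hE₀s : ∀ p, p ∈ E₀.source ↔ p ∈ A.source ∧ A p ∈ B.target := by
    intro p
    simp [E₀]
  have hE₀B : ∀ p ∈ E₀.source, E₀ p ∈ B.source := fun p hp => B.map_target ((hE₀s p).1 hp).2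
  have hE₀F : ∀ p ∈ E₀.source, F (E₀ p) = D.e (T p) := fun p hp =>
    B.right_inv ((hE₀s p).1 hp).2
  have hseg : ∀ x ∈ Icc (φ (-b)) (φ b), (x, (0 : ℝ)) ∈ B.source ∧ φ.symm x ∈ Icc (-b) b ∧
      F (x, 0) = D.e (T (x, 0)) := by
    intro x hx
    have h1 : φ.symm x ∈ Icc (-b) b := by
      constructor
      · rw [← hφ.le_iff_le, Homeomorph.apply_symm_apply]; exact hx.1
      · rw [← hφ.le_iff_le, Homeomorph.apply_symm_apply]; exact hx.2
    refine ⟨⟨core_mem_strip hF.pos x, ?_⟩, h1, ?_⟩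
    · show |x - m| < 1 / 2
      rw [abs_lt]
      constructor <;> linarith [hx.1, hx.2]
    · rw [hT, toComplex_axis, ← hφF _ h1, Homeomorph.apply_symm_apply]
  have hseg' : Icc (φ (-b)) (φ b) ×ˢ ({0} : Set ℝ) ⊆ E₀.source ∩ B.source := by
    rintro ⟨x, t⟩ ⟨hx, rfl⟩
    obtain ⟨h1, h2, h3⟩ := hseg x hx
    refine ⟨(hE₀s _).2 ⟨(hAs _).2 ?_, ?_⟩, h1⟩
    · rw [hT, toComplex_axis]
      exact InvariantDisk.ofReal_mem_ball.2 ⟨by linarith [h2.1], by linarith [h2.2]⟩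
    · rw [hA, ← h3]
      exact B.map_source h1
  -- The transition map is defined near a compact segment of the axis, hence on a rectangle about
  -- it.
  obtain ⟨u, v, -, hv, hu, h0, huv⟩ := generalized_tube_lemma isCompact_Icc isCompact_singleton
    (E₀.open_source.inter B.open_source) hseg'
  obtain ⟨η, hη, hηv⟩ := Metric.isOpen_iff.1 hv 0 (h0 rfl)
  set R₀ : Set (ℝ × ℝ) := Ioo (φ (-b)) (φ b) ×ˢ Ioo (-min η δ) (min η δ) with hR₀
  have hR₀o : IsOpen R₀ := isOpen_Ioo.prod isOpen_Ioo
  have hR₀s : R₀ ⊆ E₀.source ∩ B.source := by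
    rintro ⟨x, t⟩ ⟨hx, ht⟩
    refine huv ⟨hu ⟨hx.1.le, hx.2.le⟩, hηv ?_⟩
    rw [Metric.mem_ball, dist_zero_right, Real.norm_eq_abs, abs_lt]
    exact ⟨by linarith [ht.1, min_le_left η δ], by linarith [ht.2, min_le_left η δ]⟩
  have hη' : 0 < min η δ := lt_min hη hF.pos
  let E := E₀.restrOpen R₀ hR₀o
  have hEs : E.source = R₀ := by
    rw [OpenPartialHomeomorph.restrOpen_source]
    exact inter_eq_right.2 fun p hp => (hR₀s hp).1
  have hE : ∀ p, E p = E₀ p := fun p => rfl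
  have hax : ∀ x, (x, (0 : ℝ)) ∈ R₀ → E₀ (x, 0) = (x, 0) := by
    intro x hx
    have hx' : x ∈ Icc (φ (-b)) (φ b) := ⟨hx.1.1.le, hx.1.2.le⟩
    obtain ⟨h1, h2, h3⟩ := hseg x hx'
    refine B.injOn (hE₀B _ (hR₀s hx).1) h1 ?_
    exact (hE₀F _ (hR₀s hx).1).trans h3.symm
  have hzero : ∀ p ∈ R₀, (E₀ p).2 = 0 ↔ p.2 = 0 := by
    intro p hp
    rw [← hF.mem_core_iff (hE₀B p (hR₀s hp).1).1, hE₀F p (hR₀s hp).1,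
      hmem _ ((hAs p).1 ((hE₀s p).1 (hR₀s hp).1).1), hT, toComplex_im]
  have hEc : ContinuousOn (fun p => (E₀ p).2) R₀ :=
    continuous_snd.comp_continuousOn (E₀.continuousOn.mono fun p hp => (hR₀s hp).1)
  have hupper : IsPreconnected (Ioo (φ (-b)) (φ b) ×ˢ Ioo 0 (min η δ)) :=
    isPreconnected_Ioo.prod isPreconnected_Ioo
  have hlower : IsPreconnected (Ioo (φ (-b)) (φ b) ×ˢ Ioo (-min η δ) 0) :=
    isPreconnected_Ioo.prod isPreconnected_Ioo
  have hsu : Ioo (φ (-b)) (φ b) ×ˢ Ioo 0 (min η δ) ⊆ R₀ :=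
    prod_mono le_rfl fun t ht => ⟨by linarith [ht.1], ht.2⟩
  have hsl : Ioo (φ (-b)) (φ b) ×ˢ Ioo (-min η δ) 0 ⊆ R₀ :=
    prod_mono le_rfl fun t ht => ⟨ht.1, by linarith [ht.2]⟩
  have hpu : ∀ p ∈ R₀, 0 < p.2 → ∀ q ∈ R₀, 0 < q.2 → 0 < (E₀ p).2 * (E₀ q).2 :=
    fun p hp hp0 q hq hq0 => mul_pos_of_isPreconnected hupper (hEc.mono hsu)
      (fun a ha h => (ne_of_gt ha.2.1) ((hzero a (hsu ha)).1 h)) ⟨hp.1, hp0, hp.2.2⟩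
      ⟨hq.1, hq0, hq.2.2⟩
  have hpl : ∀ p ∈ R₀, p.2 < 0 → ∀ q ∈ R₀, q.2 < 0 → 0 < (E₀ p).2 * (E₀ q).2 :=
    fun p hp hp0 q hq hq0 => mul_pos_of_isPreconnected hlower (hEc.mono hsl)
      (fun a ha h => (ne_of_lt ha.2.2) ((hzero a (hsl ha)).1 h)) ⟨hp.1, hp.2.1, hp0⟩
      ⟨hq.1, hq.2.1, hq0⟩
  -- both signs occur among the values of `E₀`
  have hboth : ∃ p ∈ R₀, ∃ q ∈ R₀, 0 < (E₀ p).2 ∧ (E₀ q).2 < 0 := by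
    have hEo : IsOpen (E₀ '' R₀) :=
      E₀.isOpen_image_of_subset_source hR₀o fun p hp => (hR₀s hp).1
    have hmR : (m, (0 : ℝ)) ∈ R₀ := ⟨⟨by linarith, by linarith⟩, by linarith, hη'⟩
    obtain ⟨r, hr, hrE⟩ := Metric.isOpen_iff.1 hEo _ ⟨_, hmR, hax m hmR⟩
    have h1 : (m, r / 2) ∈ Metric.ball (m, (0 : ℝ)) r := by
      simp [Prod.dist_eq, abs_of_pos hr, hr]
    have h2 : (m, -(r / 2)) ∈ Metric.ball (m, (0 : ℝ)) r := by
      simp [Prod.dist_eq, abs_of_pos hr, hr]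
    obtain ⟨p, hp, hpE⟩ := hrE h1
    obtain ⟨q, hq, hqE⟩ := hrE h2
    refine ⟨p, hp, q, hq, ?_, ?_⟩
    · rw [hpE]; exact half_pos hr
    · rw [hqE]; exact neg_lt_zero.2 (half_pos hr)
  -- Each open half of the rectangle is connected, so the height of the image has constant sign on
  -- it. Both signs occur, so the halves have opposite signs. If they are exchanged, the band is
  -- replaced by its reflection `F ∘ reflAxis`.
  have hmain : ((∀ p ∈ R₀, 0 < p.2 → 0 < (E₀ p).2) ∧ ∀ p ∈ R₀, p.2 < 0 → (E₀ p).2 < 0) ∨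
      ((∀ p ∈ R₀, 0 < p.2 → (E₀ p).2 < 0) ∧ ∀ p ∈ R₀, p.2 < 0 → 0 < (E₀ p).2) := by
    obtain ⟨p, hp, q, hq, hp0, hq0⟩ := hboth
    have hpne : p.2 ≠ 0 := fun h => hp0.ne' ((hzero p hp).2 h)
    have hqne : q.2 ≠ 0 := fun h => hq0.ne ((hzero q hq).2 h)
    rcases lt_or_gt_of_ne hpne with h1 | h1 <;> rcases lt_or_gt_of_ne hqne with h2 | h2
    · nlinarith [hpl p hp h1 q hq h2]
    · right
      exact ⟨fun a ha ha0 => by nlinarith [hpu q hq h2 a ha ha0],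
        fun a ha ha0 => by nlinarith [hpl p hp h1 a ha ha0]⟩
    · left
      exact ⟨fun a ha ha0 => by nlinarith [hpu p hp h1 a ha ha0],
        fun a ha ha0 => by nlinarith [hpl q hq h2 a ha ha0]⟩
    · nlinarith [hpu p hp h1 q hq h2]
  rcases hmain with ⟨h1, h2⟩ | ⟨h1, h2⟩
  · refine ⟨F, hF, fun _ => rfl, m, min η δ, hη', min_le_right _ _, E, hEs, ?_⟩
    rw [hEs]
    exact ⟨fun p hp => (hR₀s hp).2, fun p hp => hE₀B p (hR₀s hp).1,
      fun p hp => ⟨(hAs p).1 ((hE₀s p).1 (hR₀s hp).1).1, hE₀F p (hR₀s hp).1⟩, hax, h1, h2⟩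
  · have hsrc : ∀ p, reflAxis p ∈ B.source ↔ p ∈ B.source := by
      intro p
      simp [B, hF.chart_source, strip]
    refine ⟨F ∘ reflAxis, hF.comp_reflAxis, fun _ => by simp, m, min η δ, hη', min_le_right _ _,
      E.trans reflAxis.toOpenPartialHomeomorph, by simp [hEs]; exact hR₀, ?_⟩
    have hs : (E.trans reflAxis.toOpenPartialHomeomorph).source = R₀ := by simp [hEs]
    rw [hs]
    refine ⟨fun p hp => (hR₀s hp).2, fun p hp => (hsrc _).2 (hE₀B p (hR₀s hp).1),
      fun p hp => ⟨(hAs p).1 ((hE₀s p).1 (hR₀s hp).1).1, ?_⟩, fun x hx => ?_, ?_, ?_⟩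
    · simp [hE]
      exact hE₀F p (hR₀s hp).1
    · simp [hE, hax x hx]
    · intro p hp hp0
      simpa [hE] using h1 p hp hp0
    · intro p hp hp0
      simpa [hE] using h2 p hp hp0

end Reflection

/-! ### Deforming a band to agree with the coordinate of the disk -/

section Reflection

variable {S : Type*} [TopologicalSpace S] {ι : S → S} {x₀ : S}
  {D : InvariantDisk ι x₀} {ε : ℤˣ} {δ : ℝ} {F : ℝ × ℝ → S}

theorem IsBandLift.homeomorph_comp (hF : IsBandLift ε δ F) (Γ : S ≃ₜ S) :
    IsBandLift ε δ (Γ ∘ F) where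
  pos := hF.pos
  continuousOn := Γ.continuous.comp_continuousOn hF.continuousOn
  isOpen_image := fun O hO hOo => by
    rw [image_comp]
    exact Γ.isOpenMap _ (hF.isOpen_image O hO hOo)
  eq_iff := fun p hp q hq => by
    rw [Function.comp, Function.comp, Γ.injective.eq_iff, hF.eq_iff p hp q hq]

/-- A local homeomorphism of the plane that fixes the axis pointwise and preserves its sides agrees
near a segment of the axis with a compactly supported homeomorphism. -/
theorem exists_homeomorph_eq_near (E : OpenPartialHomeomorph (ℝ × ℝ) (ℝ × ℝ))
    (hax : ∀ x, (x, (0 : ℝ)) ∈ E.source → E (x, 0) = (x, 0))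
    (hup : ∀ p ∈ E.source, 0 < p.2 → 0 < (E p).2) (hdown : ∀ p ∈ E.source, p.2 < 0 → (E p).2 < 0)
    {α α' β' β η : ℝ} (hα : α < α') (hβ : β' < β) (hη : 0 < η)
    (hsrc : Icc α β ×ˢ Icc (-η) η ⊆ E.source) :
    ∃ G : ℝ × ℝ ≃ₜ ℝ × ℝ,
      (∀ p ∉ Icc α β ×ˢ Icc (-η) η ∪ E '' (Icc α β ×ˢ Icc (-η) η), G p = p) ∧
      (∀ p : ℝ × ℝ, p.2 = 0 → G p = p) ∧
      ∃ d > 0, ∀ x ∈ Icc α' β', ∀ t, |t| < d → G (x, t) = E (x, t) := by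
  set K := Icc α β ×ˢ Icc (-η) η with hK
  have hKr : ∀ p, reflAxis p ∈ K ↔ p ∈ K := by
    intro p
    simp only [hK, mem_prod, reflAxis_apply, mem_Icc]
    constructor <;> rintro ⟨h, h1, h2⟩ <;> exact ⟨h, by linarith, by linarith⟩
  obtain ⟨G₁, hG₁K, hG₁, d₁, hd₁, hGE₁⟩ := exists_homeomorph_eq_above E hax hup hdown hα hβ hη hsrc
  -- Conjugation by the reflection brings the lower half plane to the upper one, where
  -- `exists_homeomorph_eq_above` applies.
  let E₂ := (reflAxis.toOpenPartialHomeomorph.trans E).trans reflAxis.toOpenPartialHomeomorph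
  have hE₂s : ∀ p, p ∈ E₂.source ↔ reflAxis p ∈ E.source := by
    intro p; simp [E₂]
  have hE₂ : ∀ p, E₂ p = reflAxis (E (reflAxis p)) := fun p => rfl
  have hrr : ∀ p, reflAxis (reflAxis p) = p := fun p => by simp
  obtain ⟨G₂, hG₂K, hG₂, d₂, hd₂, hGE₂⟩ := exists_homeomorph_eq_above E₂
    (fun x hx => by
      have := hax x (by simpa using (hE₂s _).1 hx)
      rw [hE₂]; simp [this])
    (fun p hp hp0 => by
      have := hdown (reflAxis p) ((hE₂s p).1 hp) (by simpa using hp0)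
      rw [hE₂]; simpa using this)
    (fun p hp hp0 => by
      have := hup (reflAxis p) ((hE₂s p).1 hp) (by simpa using hp0)
      rw [hE₂]; simpa using this) hα hβ hη
    (fun p hp => (hE₂s p).2 (hsrc ((hKr p).2 hp)))
  let G₃ := (reflAxis.trans G₂).trans reflAxis
  have hG₃ : ∀ p, G₃ p = reflAxis (G₂ (reflAxis p)) := fun p => rfl
  have hG₃up : ∀ p : ℝ × ℝ, 0 ≤ p.2 → G₃ p = p := by
    intro p hp
    rw [hG₃, hG₂ _ (by simpa using hp), hrr]
  have hG₃E : ∀ x ∈ Icc α' β', ∀ t ∈ Icc (-d₂) 0, G₃ (x, t) = E (x, t) := by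
    intro x hx t ht
    rw [hG₃, show reflAxis (x, t) = (x, -t) from rfl,
      hGE₂ x hx (-t) ⟨by linarith [ht.2], by linarith [ht.1]⟩, hE₂, hrr]
    simp
  -- `G₃` follows `E` below the axis and is the identity above it; `G₁` does the opposite. Since `E`
  -- preserves the sides, the two do not interfere.
  refine ⟨G₃.trans G₁, ?_, ?_, min η (min d₁ d₂), lt_min hη (lt_min hd₁ hd₂), ?_⟩
  · intro p hp
    have h3 : G₃ p = p := by
      rw [hG₃, hG₂K, hrr]
      rintro (h | ⟨q, hq, hqp⟩)
      · exact hp (Or.inl ((hKr p).1 h))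
      · refine hp (Or.inr ⟨reflAxis q, (hKr q).2 hq, ?_⟩)
        rw [hE₂] at hqp
        exact reflAxis.injective hqp
    rw [Homeomorph.trans_apply, h3, hG₁K p hp]
  · intro p hp
    rw [Homeomorph.trans_apply, hG₃up p hp.ge, hG₁ p hp.le]
  · intro x hx t ht
    obtain ⟨h1, h2⟩ := abs_lt.1 ht
    have e1 := min_le_left η (min d₁ d₂)
    have e2 := (min_le_right η (min d₁ d₂)).trans (min_le_left d₁ d₂)
    have e3 := (min_le_right η (min d₁ d₂)).trans (min_le_right d₁ d₂)
    have hxK : (x, t) ∈ E.source :=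
      hsrc ⟨⟨hα.le.trans hx.1, hx.2.trans hβ.le⟩, by linarith, by linarith⟩
    rw [Homeomorph.trans_apply]
    rcases le_total 0 t with h | h
    · rw [hG₃up (x, t) h, hGE₁ x hx t ⟨h, by linarith⟩]
    · rw [hG₃E x hx t ⟨by linarith, h⟩]
      refine hG₁ _ ?_
      rcases h.eq_or_lt with rfl | h
      · rw [hax x hxK]
      · exact (hdown _ hxK h).le

/-- The band along a core through the centre of a reflection disk can be chosen to agree with the
coordinate of the disk near the axis. -/
theorem IsBandLift.exists_adapted [T2Space S] (hF : IsBandLift ε δ F) {a b : ℝ} (ha : 0 < a)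
    (hab : a < b) (hbR : b < D.R)
    (hmem : ∀ z ∈ Metric.ball (0 : ℂ) D.R, D.e z ∈ (range fun x : ℝ => F (x, 0)) ↔ z.im = 0) :
    ∃ (δ' : ℝ) (F' : ℝ × ℝ → S), IsBandLift ε δ' F' ∧
      (range fun x : ℝ => F' (x, 0)) = (range fun x : ℝ => F (x, 0)) ∧
      ∃ φ : ℝ ≃ₜ ℝ, StrictMono φ ∧ φ b < φ (-b) + 1 ∧ ∀ s ∈ Icc (-a) a, ∀ t, |t| < δ' →
        toComplex (s, t) ∈ Metric.ball (0 : ℂ) D.R ∧ F' (φ s, t) = D.e (toComplex (s, t)) := by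
  have hb : 0 < b := ha.trans hab
  obtain ⟨F₁, hF₁, hcore₁, φ, hφ, hφF, hlen⟩ := hF.exists_axis_coordinate hb hbR fun s hs =>
    (hmem s (InvariantDisk.ofReal_mem_ball.2 hs)).2 (by simp)
  rw [← hcore₁] at hmem
  obtain ⟨F₂, hF₂, hcore₂, m, η, hη, hηδ, E, hEs, hEB, hEB', hEe, hax, hup, hdown⟩ :=
    hF₁.exists_transition hb hbR hmem hφ hφF hlen
  -- The midpoint of `a` and `b` leaves room on both sides: the rectangle stays inside the source of
  -- `E`, and the cutoff still has its plateau over `[-a, a]`.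
  have hsrc : Icc (φ (-((a + b) / 2))) (φ ((a + b) / 2)) ×ˢ Icc (-(η / 2)) (η / 2) ⊆ E.source := by
    rw [hEs]
    refine prod_mono (Icc_subset_Ioo (hφ (by linarith)) (hφ (by linarith)))
      (Icc_subset_Ioo (by linarith) (by linarith))
  obtain ⟨G, hGK, hG0, d, hd, hGE⟩ := exists_homeomorph_eq_near E hax hup hdown
    (hφ (by linarith) : φ (-((a + b) / 2)) < φ (-a)) (hφ (by linarith) : φ a < φ ((a + b) / 2))
    (half_pos hη) hsrc
  set K := Icc (φ (-((a + b) / 2))) (φ ((a + b) / 2)) ×ˢ Icc (-(η / 2)) (η / 2) with hK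
  have hKc : IsCompact K := isCompact_Icc.prod isCompact_Icc
  have hKE : IsCompact (K ∪ E '' K) :=
    hKc.union (hKc.image_of_continuousOn (E.continuousOn.mono hsrc))
  -- `Γ` is `G` carried to the surface through the chart of the band. It fixes the core, and over
  -- `[φ (-a), φ a]` close to the axis `Γ ∘ F₂ = F₂ ∘ E`, which is the disk coordinate.
  obtain ⟨Γ, hΓ, hΓK⟩ := exists_homeomorph_conjExtend (hF₂.chart m) G hKE
    (union_subset (hsrc.trans hEB) (by rintro _ ⟨p, hp, rfl⟩; exact hEB' p (hsrc hp))) hGK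
  have hΓcore : ∀ x, Γ (F₂ (x, 0)) = F₂ (x, 0) := by
    intro x
    by_cases h : F₂ (x, 0) ∈ hF₂.chart m '' (K ∪ E '' K)
    · obtain ⟨p, hp, hpx⟩ := h
      have hps : p ∈ (hF₂.chart m).source := by
        rcases hp with hp | ⟨q, hq, rfl⟩
        · exact hEB (hsrc hp)
        · exact hEB' q (hsrc hq)
      have hp0 : p.2 = 0 := (hF₂.mem_core_iff hps.1).1 ⟨x, hpx.symm⟩
      rw [← hpx, hΓ p hps, hG0 p hp0]
    · exact hΓK _ h
  have hd' : 0 < min (η / 2) d := lt_min (half_pos hη) hd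
  refine ⟨min (η / 2) d, Γ ∘ F₂, (hF₂.homeomorph_comp Γ).mono hd'
    ((min_le_left _ _).trans (by linarith)), ?_, φ, hφ, hlen, fun s hs t ht => ?_⟩
  · rw [← hcore₁]
    congr 1
    ext x
    exact (hΓcore x).trans (hcore₂ x)
  · have hst : (φ s, t) ∈ E.source := by
      rw [hEs]
      obtain ⟨h1, h2⟩ := abs_lt.1 ht
      have := min_le_left (η / 2) d
      exact ⟨⟨hφ (by linarith [hs.1]), hφ (by linarith [hs.2])⟩, by linarith, by linarith⟩
    have hEe' := hEe _ hst
    simp only [Homeomorph.symm_apply_apply] at hEe'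
    refine ⟨hEe'.1, ?_⟩
    rw [Function.comp, ← hEe'.2, ← hF₂.chart_apply m, hΓ _ (hEB hst),
      hGE _ ⟨hφ.monotone hs.1, hφ.monotone hs.2⟩ t (ht.trans_le (min_le_right _ _))]
    rfl

end Reflection

/-! ### The topology of the blowup -/

section Blowup

variable {S : Type*} [TopologicalSpace S] {ι : S → S} {x₀ : S} (D : InvariantDisk ι x₀)

namespace InvariantDisk

/-- The complement of the open unit disk. -/
def ext : Set S := (D.e '' Metric.ball (0 : ℂ) 1)ᶜ

theorem mem_ball_R {z : ℂ} : z ∈ Metric.ball (0 : ℂ) D.R ↔ ‖z‖ < D.R := by simp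

theorem norm_lt_R {z : ℂ} (hz : ‖z‖ ≤ 1) : ‖z‖ < D.R := hz.trans_lt D.one_lt_R

theorem e_mem_image_iff {O : Set ℂ} (hO : O ⊆ Metric.ball 0 D.R) {z : ℂ} (hz : ‖z‖ < D.R) :
    D.e z ∈ D.e '' O ↔ z ∈ O :=
  D.injOn.mem_image_iff hO (D.mem_ball_R.2 hz)

theorem e_mem_ext {z : ℂ} (hz : ‖z‖ < D.R) : D.e z ∈ D.ext ↔ 1 ≤ ‖z‖ := by
  rw [ext, mem_compl_iff, D.e_mem_image_iff (Metric.ball_subset_ball D.one_lt_R.le) hz]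
  simp

theorem e_eq_iff {z w : ℂ} (hz : ‖z‖ < D.R) (hw : ‖w‖ < D.R) : D.e z = D.e w ↔ z = w :=
  D.injOn.eq_iff (D.mem_ball_R.2 hz) (D.mem_ball_R.2 hw)

theorem e_one_mem_ext : D.e 1 ∈ D.ext := (D.e_mem_ext (by simpa using D.one_lt_R)).2 (by simp)

/-- The projection of the exterior onto the blowup. -/
def toBlowup (x : D.Exterior) : D.Blowup := Quotient.mk D.antipodal x

open Classical in
/-- The projection onto the blowup, with a junk value in the open unit disk. -/
noncomputable def proj (y : S) : D.Blowup :=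
  if h : y ∈ D.ext then D.toBlowup ⟨y, h⟩ else D.toBlowup ⟨D.e 1, D.e_one_mem_ext⟩

theorem proj_of_mem {y : S} (h : y ∈ D.ext) :
    D.proj y = D.toBlowup ⟨y, h⟩ :=
  dif_pos h

theorem proj_surj (q : D.Blowup) : ∃ y ∈ D.ext, D.proj y = q := by
  induction q using Quotient.inductionOn with | _ x => ?_
  exact ⟨x.1, x.2, D.proj_of_mem x.2⟩

theorem proj_eq_iff {y y' : S} (h : y ∈ D.ext) (h' : y' ∈ D.ext) : D.proj y = D.proj y' ↔
    y = y' ∨ ∃ z : ℂ, ‖z‖ = 1 ∧ y = D.e z ∧ y' = D.e (-z) := by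
  rw [D.proj_of_mem h, D.proj_of_mem h']
  constructor
  · intro h
    rcases Quotient.exact (s := D.antipodal) h with h | h
    · exact Or.inl (congrArg Subtype.val h)
    · exact Or.inr h
  · rintro (rfl | h)
    · rfl
    · exact Quotient.sound (s := D.antipodal) (Or.inr h)

theorem continuousOn_proj : ContinuousOn D.proj D.ext := by
  rw [continuousOn_iff_continuous_domRestrict]
  have : D.ext.domRestrict D.proj = fun x : D.ext => D.toBlowup ⟨x.1, x.2⟩ := by
    ext x
    exact D.proj_of_mem x.2
  rw [this]
  exact continuous_quot_mk

theorem isOpen_blowup {U : Set D.Blowup} {V : Set S} (hV : IsOpen V)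
    (h : ∀ y ∈ D.ext, D.proj y ∈ U ↔ y ∈ V) : IsOpen U := by
  have hq : IsQuotientMap D.toBlowup :=
    isQuotientMap_quot_mk
  refine hq.isOpen_preimage.1 ?_
  have : D.toBlowup ⁻¹' U =
      (fun x : D.Exterior => x.1) ⁻¹' V := by
    ext x
    have := h x.1 x.2
    rwa [D.proj_of_mem x.2] at this
  rw [this]
  exact hV.preimage continuous_subtype_val

theorem isClosed_blowup {U : Set D.Blowup} {V : Set S} (hV : IsClosed V)
    (h : ∀ y ∈ D.ext, D.proj y ∈ U ↔ y ∈ V) : IsClosed U :=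
  isOpen_compl_iff.1 (D.isOpen_blowup hV.isOpen_compl fun y hy => not_congr (h y hy))

theorem map_mem_ext (hι : Function.Involutive ι) {y : S} (h : y ∈ D.ext) : ι y ∈ D.ext :=
  D.map_exterior hι ⟨y, h⟩

theorem blowupMap_proj (hι : Function.Involutive ι) {y : S} (h : y ∈ D.ext) :
    D.blowupMap hι (D.proj y) = D.proj (ι y) := by
  rw [D.proj_of_mem h, D.proj_of_mem (D.map_mem_ext hι h)]
  rfl

/-- The complement of the closed unit disk. -/
def outer : Set S := (D.e '' Metric.closedBall (0 : ℂ) 1)ᶜ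

theorem outer_subset_ext : D.outer ⊆ D.ext :=
  compl_subset_compl.2 (image_mono Metric.ball_subset_closedBall)

theorem e_mem_outer {z : ℂ} (hz : ‖z‖ < D.R) : D.e z ∈ D.outer ↔ 1 < ‖z‖ := by
  rw [outer, mem_compl_iff, D.e_mem_image_iff (Metric.closedBall_subset_ball D.one_lt_R) hz]
  simp

theorem mem_ext_iff {y : S} : y ∈ D.ext ↔ y ∈ D.outer ∨ ∃ z : ℂ, ‖z‖ = 1 ∧ y = D.e z := by
  constructor
  · intro h
    by_cases h' : y ∈ D.outer
    · exact Or.inl h'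
    · obtain ⟨z, hz, rfl⟩ := not_not.1 h'
      have hz1 : ‖z‖ ≤ 1 := by simpa using hz
      exact Or.inr ⟨z, le_antisymm hz1 ((D.e_mem_ext (D.norm_lt_R hz1)).1 h), rfl⟩
  · rintro (h | ⟨z, hz, rfl⟩)
    · exact D.outer_subset_ext h
    · exact (D.e_mem_ext (D.norm_lt_R hz.le)).2 hz.ge

theorem isOpen_outer [T2Space S] : IsOpen D.outer :=
  (((isCompact_closedBall (0 : ℂ) 1).image_of_continuousOn (D.continuousOn_e.mono
    (Metric.closedBall_subset_ball D.one_lt_R))).isClosed).isOpen_compl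

theorem map_mem_outer (hι : Function.Involutive ι) {y : S} (h : y ∈ D.outer) : ι y ∈ D.outer := by
  rintro ⟨z, hz, hzy⟩
  have hz1 : ‖z‖ ≤ 1 := by simpa using hz
  refine h ?_
  rcases D.equivariant with he | he
  · exact ⟨-z, by simpa using hz1, by rw [← he z (D.mem_ball hz1), hzy, hι]⟩
  · exact ⟨starRingEnd ℂ z, by simpa using hz1, by rw [← he z (D.mem_ball hz1), hzy, hι]⟩

/-- The involution of the complement of the closed unit disk. -/
def outerMap (hι : Function.Involutive ι) (y : D.outer) : D.outer :=
  ⟨ι y.1, D.map_mem_outer hι y.2⟩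

theorem proj_injOn_outer {y y' : S} (h : y ∈ D.outer) (h' : y' ∈ D.ext)
    (hp : D.proj y = D.proj y') : y = y' := by
  rcases (D.proj_eq_iff (D.outer_subset_ext h) h').1 hp with h | ⟨z, hz, rfl, -⟩
  · exact h
  · have := (D.e_mem_outer (D.norm_lt_R hz.le)).1 h
    linarith

theorem isOpenEmbedding_proj [T2Space S] :
    IsOpenEmbedding (fun y : D.outer => D.proj y.1) := by
  refine IsOpenEmbedding.of_continuous_injective_isOpenMap ?_ ?_ ?_
  · exact D.continuousOn_proj.comp_continuous continuous_subtype_val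
      fun y => D.outer_subset_ext y.2
  · intro y y' h
    exact Subtype.ext (D.proj_injOn_outer y.2 (D.outer_subset_ext y'.2) h)
  · intro U hU
    refine D.isOpen_blowup (D.isOpen_outer.isOpenMap_subtype_val U hU) fun y hy => ?_
    constructor
    · rintro ⟨y', hy', h⟩
      exact ⟨y', hy', D.proj_injOn_outer y'.2 hy h⟩
    · rintro ⟨y', hy', rfl⟩
      exact ⟨y', hy', rfl⟩

/-- The curve of the blowup which replaces the disk. -/
def exceptional : Set D.Blowup := (fun z : ℂ => D.proj (D.e z)) '' Metric.sphere 0 1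

theorem range_proj_outer : range (fun y : D.outer => D.proj y.1) = D.exceptionalᶜ := by
  ext q
  obtain ⟨y, hy, rfl⟩ := D.proj_surj q
  simp only [mem_range, mem_compl_iff, exceptional, mem_image, mem_sphere_zero_iff_norm, not_exists,
    not_and]
  constructor
  · rintro ⟨⟨y', hy'⟩, h⟩ z hz hzy
    have hze := (D.e_mem_ext (D.norm_lt_R hz.le)).2 hz.ge
    have := D.proj_injOn_outer hy' hze (h.trans hzy.symm)
    rw [this, D.e_mem_outer (D.norm_lt_R hz.le)] at hy'
    linarith
  · intro h
    rcases D.mem_ext_iff.1 hy with h' | ⟨z, hz, rfl⟩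
    · exact ⟨⟨y, h'⟩, rfl⟩
    · exact absurd rfl (h z hz)

theorem isClosed_exceptional [T2Space S] : IsClosed D.exceptional := by
  rw [← isOpen_compl_iff, ← D.range_proj_outer]
  exact D.isOpenEmbedding_proj.isOpen_range

-- On the unit circle the rotation sends each point to its antipode, which represents the same point
-- of the blowup.
variable {D} in
theorem IsRotation.neg_mem (h : D.IsRotation) (hι : Function.Involutive ι) {z : ℂ}
    (hz : ‖z‖ = 1) : D.blowupMap hι (D.proj (D.e z)) = D.proj (D.e z) := by
  have hze := (D.e_mem_ext (D.norm_lt_R hz.le)).2 hz.ge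
  have hze' := (D.e_mem_ext (z := -z) (by simpa using D.norm_lt_R hz.le)).2 (by simp [hz])
  rw [D.blowupMap_proj hι hze, h z (D.mem_ball hz.le), D.proj_eq_iff hze' hze]
  exact Or.inr ⟨-z, by simpa using hz, rfl, by simp⟩

/-- Polar coordinates about the exceptional curve. -/
noncomputable def polar : ℝ × ℝ ≃ₜ ℂ :=
  (((Homeomorph.mulLeft₀ Real.pi Real.pi_ne_zero).prodCongr (Homeomorph.refl ℝ)).trans
    (Homeomorph.prodComm ℝ ℝ)).trans toComplex

theorem polar_re (p : ℝ × ℝ) : (polar p).re = p.2 := rfl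

theorem polar_im (p : ℝ × ℝ) : (polar p).im = Real.pi * p.1 := rfl

/-- The point of the exterior disk at distance `exp |t|` from the centre. -/
noncomputable def polarPoint (p : ℝ × ℝ) : ℂ := Complex.exp (polar (p.1, |p.2|))

theorem norm_polarPoint (p : ℝ × ℝ) : ‖polarPoint p‖ = Real.exp |p.2| := by
  rw [polarPoint, Complex.norm_exp, polar_re]

/-- One unit of `x` is an angle `π`, and `exp (πi) = -1`. This sign is the twist of the Möbius band.
-/
theorem polarPoint_add_int (x t : ℝ) (n : ℤ) (s : ℝ) (h : |s| = |t|) :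
    polarPoint (x + n, s) = signPow (-1) n * polarPoint (x, t) := by
  have h1 : polar (x + n, |s|) = polar (x, |t|) + n * (Real.pi * Complex.I) := by
    apply Complex.ext
    · simp [polar_re, h]
    · simp [polar_im]; ring
  rw [polarPoint, h1, Complex.exp_add, Complex.exp_int_mul, Complex.exp_pi_mul_I, mul_comm]
  rcases Int.even_or_odd n with h | h <;>
    simp [signPow, polarPoint, h.neg_one_zpow]

/-- Squaring removes the sign, and the period `2πi` of the exponential becomes one unit of `x`. -/
theorem exists_int_of_polarPoint {p q : ℝ × ℝ}
    (h : polarPoint p = polarPoint q ∨ polarPoint p = -polarPoint q) :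
    |p.2| = |q.2| ∧ ∃ n : ℤ, q.1 = p.1 + n := by
  have hn : ‖polarPoint p‖ = ‖polarPoint q‖ := by
    rcases h with h | h <;> simp [h]
  rw [norm_polarPoint, norm_polarPoint, Real.exp_eq_exp] at hn
  refine ⟨hn, ?_⟩
  have h2 : Complex.exp (2 * polar (p.1, |p.2|)) = Complex.exp (2 * polar (q.1, |q.2|)) := by
    have : polarPoint p ^ 2 = polarPoint q ^ 2 := by rcases h with h | h <;> simp [h]
    rw [polarPoint, polarPoint, ← Complex.exp_nat_mul, ← Complex.exp_nat_mul] at this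
    exact_mod_cast this
  obtain ⟨n, hn⟩ := Complex.exp_eq_exp_iff_exists_int.1 h2
  have := congrArg Complex.im hn
  simp [polar_im] at this
  refine ⟨-n, ?_⟩
  have hpi := Real.pi_pos
  have : p.1 = q.1 + n := by
    have h3 : 2 * Real.pi * (p.1 - (q.1 + n)) = 0 := by linarith
    rcases mul_eq_zero.1 h3 with h | h
    · linarith
    · linarith
  push_cast
  linarith

/-- The Möbius band around the exceptional curve. -/
noncomputable def polarLift (p : ℝ × ℝ) : D.Blowup :=
  -- A path that crosses the exceptional curve at `z` re-emerges at `-z`, so negative heights are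
  -- read at the antipode.
  if 0 ≤ p.2 then D.proj (D.e (polarPoint p)) else D.proj (D.e (-polarPoint p))

theorem polarPoint_lt {p : ℝ × ℝ} (hp : p ∈ strip (Real.log D.R)) : ‖polarPoint p‖ < D.R := by
  rw [norm_polarPoint, ← Real.lt_log_iff_exp_lt D.R_pos]
  exact hp

theorem one_le_polarPoint (p : ℝ × ℝ) : 1 ≤ ‖polarPoint p‖ := by
  rw [norm_polarPoint]
  exact Real.one_le_exp (abs_nonneg _)

theorem proj_e_neg {z : ℂ} (hz : ‖z‖ = 1) : D.proj (D.e (-z)) = D.proj (D.e z) := by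
  rw [D.proj_eq_iff ((D.e_mem_ext (by simpa using D.norm_lt_R hz.le)).2 (by simp [hz]))
    ((D.e_mem_ext (D.norm_lt_R hz.le)).2 hz.ge)]
  exact Or.inr ⟨-z, by simpa using hz, rfl, by simp⟩

theorem proj_e_eq_iff {z w : ℂ} (hz : ‖z‖ < D.R) (hw : ‖w‖ < D.R) (hz1 : 1 ≤ ‖z‖) (hw1 : 1 ≤ ‖w‖) :
    D.proj (D.e z) = D.proj (D.e w) ↔ z = w ∨ (‖z‖ = 1 ∧ w = -z) := by
  rw [D.proj_eq_iff ((D.e_mem_ext hz).2 hz1) ((D.e_mem_ext hw).2 hw1), D.e_eq_iff hz hw]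
  refine or_congr_right ⟨?_, ?_⟩
  · rintro ⟨v, hv, h1, h2⟩
    rw [D.e_eq_iff hz (D.norm_lt_R hv.le)] at h1
    rw [D.e_eq_iff hw (by simpa using D.norm_lt_R hv.le)] at h2
    exact ⟨h1 ▸ hv, h1 ▸ h2⟩
  · rintro ⟨h1, h2⟩
    exact ⟨z, h1, rfl, by rw [h2]⟩

theorem polarLift_eq (p : ℝ × ℝ) : ∃ s : ℝ, (s = 1 ∨ s = -1) ∧ p.2 = s * |p.2| ∧
    D.polarLift p = D.proj (D.e (s * polarPoint p)) := by
  rcases le_or_gt 0 p.2 with h | h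
  · exact ⟨1, Or.inl rfl, by rw [abs_of_nonneg h, one_mul], by simp [polarLift, h]⟩
  · exact ⟨-1, Or.inr rfl, by rw [abs_of_neg h]; ring, by simp [polarLift, not_le.2 h]⟩

theorem polarLift_deck {p : ℝ × ℝ} (hp : p ∈ strip (Real.log D.R)) (n : ℤ) :
    D.polarLift (deck (-1) n p) = D.polarLift p := by
  have hP : polarPoint (deck (-1) n p) = signPow (-1) n * polarPoint p :=
    polarPoint_add_int p.1 p.2 n _ (by rw [abs_mul, abs_signPow, one_mul])
  obtain ⟨s, hs, hsp, hs'⟩ := D.polarLift_eq p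
  obtain ⟨r, hr, hrp, hr'⟩ := D.polarLift_eq (deck (-1) n p)
  have hpR := D.polarPoint_lt hp
  rw [hs', hr', hP, ← mul_assoc, ← Complex.ofReal_mul]
  have habs : |(deck (-1) n p).2| = |p.2| := by simp [deck, abs_mul, abs_signPow]
  by_cases h0 : p.2 = 0
  · have h1 : ‖polarPoint p‖ = 1 := by rw [norm_polarPoint, h0]; simp
    have key : ∀ c : ℝ, c = 1 ∨ c = -1 → D.proj (D.e (c * polarPoint p)) =
        D.proj (D.e (polarPoint p)) := by
      rintro c (rfl | rfl)
      · simp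
      · simpa using D.proj_e_neg h1
    rw [key s hs, key _ _]
    rcases hr with rfl | rfl <;> rcases signPow_eq_or (-1) n with h | h <;> simp [h]
  · have h1 : |p.2| ≠ 0 := abs_ne_zero.2 h0
    have h2 : r * |p.2| = signPow (-1) n * s * |p.2| := by
      rw [← habs, ← hrp, mul_assoc, habs, ← hsp]; rfl
    rw [mul_right_cancel₀ h1 h2, mul_right_comm, signPow_mul_self, one_mul]

theorem isBandLift_polarLift : IsBandLift (-1) (Real.log D.R) D.polarLift where
  pos := Real.log_pos D.one_lt_R
  continuousOn := by
    have hc : Continuous polarPoint := by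
      unfold polarPoint
      exact Complex.continuous_exp.comp (polar.continuous.comp (by fun_prop))
    have hm : ∀ p ∈ strip (Real.log D.R), D.e (polarPoint p) ∈ D.ext ∧
        D.e (-polarPoint p) ∈ D.ext := fun p hp =>
      ⟨(D.e_mem_ext (D.polarPoint_lt hp)).2 (one_le_polarPoint p),
        (D.e_mem_ext (by simpa using D.polarPoint_lt hp)).2 (by simpa using one_le_polarPoint p)⟩
    have c1 : ContinuousOn (fun p => D.proj (D.e (polarPoint p))) (strip (Real.log D.R)) :=
      D.continuousOn_proj.comp (D.continuousOn_e.comp hc.continuousOn fun p hp =>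
        D.mem_ball_R.2 (D.polarPoint_lt hp)) fun p hp => (hm p hp).1
    have c2 : ContinuousOn (fun p => D.proj (D.e (-polarPoint p))) (strip (Real.log D.R)) :=
      D.continuousOn_proj.comp (D.continuousOn_e.comp hc.neg.continuousOn fun p hp =>
        D.mem_ball_R.2 (by simpa using D.polarPoint_lt hp)) fun p hp => (hm p hp).2
    rw [continuousOn_iff_continuous_domRestrict] at c1 c2 ⊢
    refine Continuous.if_le (f := fun _ => (0 : ℝ)) (g := fun p : strip (Real.log D.R) => p.1.2)
      c1 c2 continuous_const (by fun_prop) ?_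
    rintro ⟨p, hp⟩ h
    exact (D.proj_e_neg (by rw [norm_polarPoint, ← show 0 = p.2 from h]; simp)).symm
  isOpen_image := fun O hO hOo => by
    have hsat : ∀ p ∈ saturation (-1) O, p ∈ strip (Real.log D.R) := by
      intro p hp
      obtain ⟨q, hq, n, rfl⟩ := mem_saturation.1 hp
      exact deck_mem_strip.2 (hO hq)
    have hball : Complex.exp '' (polar '' saturation (-1) O) ⊆ Metric.ball 0 D.R := by
      rintro _ ⟨_, ⟨p, hp, rfl⟩, rfl⟩
      rw [D.mem_ball_R, Complex.norm_exp, polar_re, ← Real.lt_log_iff_exp_lt D.R_pos]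
      exact (le_abs_self _).trans_lt (hsat p hp)
    -- At nonnegative heights the lift is the disk coordinate of the exponential, an open map. A
    -- point at negative height is brought there by one deck transformation, so the image of the
    -- saturation of `O` is the open set wanted.
    refine D.isOpen_blowup (D.isOpen_image (Complex.isOpenMap_exp _
      (polar.isOpenMap _ (isOpen_saturation hOo))) hball) fun y hy => ?_
    have hmem : ∀ p ∈ saturation (-1) O, 0 ≤ p.2 →
        D.e (polarPoint p) ∈ D.e '' (Complex.exp '' (polar '' saturation (-1) O)) :=
      fun p hp h => ⟨_, ⟨_, ⟨p, hp, rfl⟩, rfl⟩, by rw [polarPoint, abs_of_nonneg h]⟩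
    constructor
    · rintro ⟨p, hp, hpy⟩
      obtain ⟨s, hs, hsp, hs'⟩ := D.polarLift_eq p
      have hpR := D.polarPoint_lt (hO hp)
      have hn : ‖(s : ℂ) * polarPoint p‖ = ‖polarPoint p‖ := by
        rcases hs with rfl | rfl <;> simp
      have hsat0 : p ∈ saturation (-1) O := mem_saturation.2 ⟨p, hp, 0, by simp⟩
      have hsat1 : deck (-1) 1 p ∈ saturation (-1) O := mem_saturation.2 ⟨p, hp, 1, rfl⟩
      have hP : polarPoint (deck (-1) 1 p) = -polarPoint p := by
        have := polarPoint_add_int p.1 p.2 1 (signPow (-1) 1 * p.2) (by simp [abs_mul, abs_signPow])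
        simpa [deck, signPow] using this
      have hy' : y = D.e (s * polarPoint p) ∨ (‖polarPoint p‖ = 1 ∧ y = D.e (-(s * polarPoint p))) := by
        rw [hs', D.proj_eq_iff ((D.e_mem_ext (hn ▸ hpR)).2 (hn ▸ one_le_polarPoint p)) hy] at hpy
        rcases hpy with h | ⟨z, hz, h1, h2⟩
        · exact Or.inl h.symm
        · rw [D.e_eq_iff (hn ▸ hpR) (D.norm_lt_R hz.le)] at h1
          exact Or.inr ⟨by rw [← hn, h1, hz], by rw [h1, h2]⟩
      have hpos : ∀ c : ℝ, (c = 1 ∨ c = -1) → p.2 = c * |p.2| →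
          D.e (c * polarPoint p) ∈ D.e '' (Complex.exp '' (polar '' saturation (-1) O)) := by
        rintro c (rfl | rfl) hc
        · simpa using hmem p hsat0 (by rw [hc]; positivity)
        · have := hmem _ hsat1 (by
            simp only [deck, signPow_one_right]; rw [hc]; simp)
          rw [hP] at this
          simpa using this
      rcases hy' with rfl | ⟨h1, rfl⟩
      · exact hpos s hs hsp
      · have h0 : p.2 = 0 := by
          rw [norm_polarPoint, Real.exp_eq_one_iff, abs_eq_zero] at h1; exact h1
        have := hpos (-s) (by rcases hs with rfl | rfl <;> simp) (by rw [h0]; simp)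
        simpa using this
    · rintro ⟨_, ⟨_, ⟨p, hp, rfl⟩, rfl⟩, rfl⟩
      have hlt : ‖Complex.exp (polar p)‖ < D.R := D.mem_ball_R.1 (hball ⟨_, ⟨p, hp, rfl⟩, rfl⟩)
      have hp0 : 0 ≤ p.2 := by
        have := (D.e_mem_ext hlt).1 hy
        rwa [Complex.norm_exp, polar_re, Real.one_le_exp_iff] at this
      obtain ⟨q, hq, n, rfl⟩ := mem_saturation.1 hp
      refine ⟨q, hq, ?_⟩
      rw [← D.polarLift_deck (hO hq) n]
      change D.polarLift (deck (-1) n q) = D.proj (D.e (Complex.exp (polar (deck (-1) n q))))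
      change 0 ≤ (deck (-1) n q).2 at hp0
      rw [polarLift, if_pos hp0, polarPoint, abs_of_nonneg hp0]
  eq_iff := fun p hp q hq => by
    refine ⟨fun h => ?_, fun ⟨n, hn⟩ => by rw [show q = deck (-1) n p from hn, D.polarLift_deck hp]⟩
    obtain ⟨s, hs, hsp, hs'⟩ := D.polarLift_eq p
    obtain ⟨r, hr, hrq, hr'⟩ := D.polarLift_eq q
    have hpR := D.polarPoint_lt hp
    have hqR := D.polarPoint_lt hq
    have hns : ‖(s : ℂ) * polarPoint p‖ = ‖polarPoint p‖ := by
      rcases hs with rfl | rfl <;> simp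
    have hnr : ‖(r : ℂ) * polarPoint q‖ = ‖polarPoint q‖ := by
      rcases hr with rfl | rfl <;> simp
    rw [hs', hr', D.proj_e_eq_iff (hns ▸ hpR) (hnr ▸ hqR) (hns ▸ one_le_polarPoint p)
      (hnr ▸ one_le_polarPoint q), hns] at h
    have hpm : polarPoint p = polarPoint q ∨ polarPoint p = -polarPoint q := by
      rcases h with h | ⟨-, h⟩ <;> rcases hs with rfl | rfl <;> rcases hr with rfl | rfl <;>
        push_cast at h <;>
        first
        | exact Or.inl (by linear_combination h)
        | exact Or.inl (by linear_combination -h)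
        | exact Or.inr (by linear_combination h)
        | exact Or.inr (by linear_combination -h)
    obtain ⟨habs, n, hn⟩ := exists_int_of_polarPoint hpm
    refine ⟨n, ?_⟩
    have hq2 : polarPoint q = signPow (-1) n * polarPoint p := by
      rw [← polarPoint_add_int p.1 p.2 n q.2 habs.symm, ← hn]
    change q = deck (-1) n p
    refine Prod.ext hn ?_
    change q.2 = signPow (-1) n * p.2
    rcases h with h | ⟨h, -⟩
    · have hne : polarPoint p ≠ 0 := Complex.exp_ne_zero _
      rw [hq2, ← mul_assoc] at h
      have h3 : (s : ℂ) = r * signPow (-1) n := mul_right_cancel₀ hne h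
      have h4 : s = r * signPow (-1) n := by exact_mod_cast h3
      calc q.2 = (signPow (-1) n * signPow (-1) n) * (r * |q.2|) := by
            rw [signPow_mul_self, one_mul, ← hrq]
        _ = signPow (-1) n * (s * |p.2|) := by rw [h4, habs]; ring
        _ = signPow (-1) n * p.2 := by rw [← hsp]
    · rw [norm_polarPoint, Real.exp_eq_one_iff, abs_eq_zero] at h
      have : q.2 = 0 := by rw [← abs_eq_zero, ← habs, h, abs_zero]
      rw [this, h, mul_zero]

theorem isBandCore_exceptional : IsBandCore (-1) D.exceptional := by
  refine isBandCore_iff.2 ⟨_, _, D.isBandLift_polarLift, ?_⟩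
  ext q
  constructor
  · rintro ⟨x, rfl⟩
    refine ⟨polarPoint (x, 0), ?_, by simp [polarLift]⟩
    rw [mem_sphere_zero_iff_norm, norm_polarPoint]; simp
  · rintro ⟨z, hz, rfl⟩
    rw [mem_sphere_zero_iff_norm] at hz
    refine ⟨z.arg / Real.pi, ?_⟩
    have h1 : polar (z.arg / Real.pi, |0|) = z.arg * Complex.I := by
      apply Complex.ext
      · simp [polar_re]
      · simp [polar_im]; field_simp
    simp only [polarLift, le_refl, if_true, polarPoint, h1]
    congr 2
    simpa [hz] using Complex.norm_mul_exp_arg_mul_I z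

end InvariantDisk

end Blowup

/-! ### Closing a strip up to a band -/

section Twist

variable {Y : Type*} {σ : ℤˣ} {δ : ℝ} {c : ℝ × ℝ → Y}

/-- The extension of a map on `[0, 1] × ℝ` that is invariant under the deck transformations. -/
noncomputable def twistExtend (σ : ℤˣ) (c : ℝ × ℝ → Y) (p : ℝ × ℝ) : Y :=
  c (Int.fract p.1, signPow σ ⌊p.1⌋ * p.2)

theorem twistExtend_deck (n : ℤ) (p : ℝ × ℝ) :
    twistExtend σ c (deck σ n p) = twistExtend σ c p := by
  simp only [twistExtend, deck, Int.fract_add_intCast, Int.floor_add_intCast, signPow_add]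
  rw [mul_assoc, ← mul_assoc (signPow σ n), signPow_mul_self, one_mul]

theorem twistExtend_of_Ico {p : ℝ × ℝ} (hp : p.1 ∈ Ico (0 : ℝ) 1) : twistExtend σ c p = c p := by
  simp only [twistExtend, Int.fract_eq_self.2 hp, Int.floor_eq_zero_iff.2 hp, signPow_zero, one_mul]

theorem twistExtend_of_Icc (hglue : ∀ t, |t| < δ → c (1, t) = c (0, signPow σ 1 * t)) {p : ℝ × ℝ}
    (hp : p.1 ∈ Icc (0 : ℝ) 1) (hps : p ∈ strip δ) : twistExtend σ c p = c p := by
  rcases hp.2.eq_or_lt with h | h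
  · have : p = (1, p.2) := by rw [← h]
    rw [this, hglue _ hps]
    simp [twistExtend]
  · exact twistExtend_of_Ico ⟨hp.1, h⟩

theorem exists_deck_Ico (σ : ℤˣ) (p : ℝ × ℝ) : ∃ n : ℤ, (deck σ n p).1 ∈ Ico (0 : ℝ) 1 := by
  refine ⟨-⌊p.1⌋, ?_⟩
  simp only [deck, Int.cast_neg]
  exact ⟨by linarith [Int.floor_le p.1], by linarith [Int.lt_floor_add_one p.1]⟩

/-- Deck invariance reduces the claim to `-1 < x < 1`, where two continuous pieces meet along `x =
0` by the gluing condition. -/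
theorem continuousOn_twistExtend [TopologicalSpace Y]
    (hc : ContinuousOn c {p | p.1 ∈ Icc (0 : ℝ) 1 ∧ |p.2| < δ})
    (hglue : ∀ t, |t| < δ → c (1, t) = c (0, signPow σ 1 * t)) :
    ContinuousOn (twistExtend σ c) (strip δ) := by
  have hmain : ContinuousOn (twistExtend σ c) (strip δ ∩ {p | p.1 ∈ Ioo (-1 : ℝ) 1}) := by
    let κ : ℝ → ℝ := fun u => max 0 (min 1 u)
    have hκ : ∀ u, κ u ∈ Icc (0 : ℝ) 1 := fun u =>
      ⟨le_max_left _ _, max_le zero_le_one (min_le_left _ _)⟩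
    have hκ' : ∀ u ∈ Icc (0 : ℝ) 1, κ u = u := fun u hu => by
      simp only [κ]; rw [min_eq_right hu.2, max_eq_right hu.1]
    have hκc : Continuous κ := by fun_prop
    have c1 : ContinuousOn (fun p : ℝ × ℝ => c (κ p.1, p.2)) (strip δ) :=
      hc.comp (by fun_prop) fun p hp => ⟨hκ _, hp⟩
    have c2 : ContinuousOn (fun p : ℝ × ℝ => c (κ (p.1 + 1), signPow σ 1 * p.2)) (strip δ) :=
      hc.comp (by fun_prop) fun p hp => ⟨hκ _, by
        rw [abs_mul, abs_signPow, one_mul]; exact hp⟩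
    have c3 : ContinuousOn (fun p : ℝ × ℝ => if 0 ≤ p.1 then c (κ p.1, p.2) else
        c (κ (p.1 + 1), signPow σ 1 * p.2)) (strip δ) := by
      rw [continuousOn_iff_continuous_domRestrict] at c1 c2 ⊢
      refine Continuous.if_le (f := fun _ => (0 : ℝ)) (g := fun p : strip δ => p.1.1)
        c1 c2 continuous_const (by fun_prop) ?_
      rintro ⟨⟨x, t⟩, hp⟩ h
      obtain rfl : 0 = x := h
      simp only
      rw [hκ' 0 (by norm_num), hκ' (0 + 1) (by norm_num), zero_add, hglue _ (by
        rw [abs_mul, abs_signPow, one_mul]; exact hp), ← mul_assoc, signPow_mul_self, one_mul]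
    refine (c3.mono inter_subset_left).congr ?_
    rintro ⟨x, t⟩ ⟨hp, hx⟩
    simp only [mem_ofPred_eq] at hx
    simp only
    split_ifs with h
    · rw [hκ' x ⟨h, hx.2.le⟩, twistExtend_of_Ico ⟨h, hx.2⟩]
    · have h' := not_le.1 h
      rw [hκ' (x + 1) ⟨by linarith [hx.1], by linarith⟩, ← twistExtend_deck 1,
        twistExtend_of_Ico]
      · simp [deck]
      · simp only [deck, Int.cast_one]
        exact ⟨by linarith [hx.1], by linarith⟩
  intro p hp
  obtain ⟨n, hn⟩ := exists_deck_Ico σ p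
  have ho : IsOpen (strip δ ∩ {p | p.1 ∈ Ioo (-1 : ℝ) 1}) :=
    (isOpen_strip δ).inter (isOpen_Ioo.preimage continuous_fst)
  have h1 : ContinuousAt (twistExtend σ c) (deck σ n p) :=
    hmain.continuousAt (ho.mem_nhds ⟨deck_mem_strip.2 hp, by linarith [hn.1], hn.2⟩)
  have h2 : ContinuousAt (twistExtend σ c ∘ deck σ n) p :=
    h1.comp (continuous_deck σ n).continuousAt
  refine (h2.congr (Filter.Eventually.of_forall fun q => ?_)).continuousWithinAt
  exact twistExtend_deck n q

end Twist

/-! ### The band of the blowup along a curve through the centre -/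

section Strip

variable {S : Type*} [TopologicalSpace S] {ι : S → S} {x₀ : S} {D : InvariantDisk ι x₀}
  {ε : ℤˣ} {δ a : ℝ} {F : ℝ × ℝ → S} {φ : ℝ ≃ₜ ℝ}

/-- A band which agrees with the coordinate of the disk near the axis, and stays away from the unit
disk elsewhere. -/
structure IsAdapted (D : InvariantDisk ι x₀) (ε : ℤˣ) (δ a : ℝ) (F : ℝ × ℝ → S) (φ : ℝ ≃ₜ ℝ) :
    Prop where
  lift : IsBandLift ε δ F
  le_one : δ ≤ 1
  one_lt : 1 < a
  strictMono : StrictMono φ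
  length : φ a < φ (-a) + 1
  eq_disk : ∀ s ∈ Icc (-a) a, ∀ t, |t| < δ →
    ‖toComplex (s, t)‖ < D.R ∧ F (φ s, t) = D.e (toComplex (s, t))
  mem_outer : ∀ x ∈ Icc (φ a) (φ (-a) + 1), ∀ t, |t| < δ → F (x, t) ∈ D.outer

theorem norm_toComplex_sq (s t : ℝ) : ‖toComplex (s, t)‖ ^ 2 = s ^ 2 + t ^ 2 := by
  rw [← Complex.normSq_eq_norm_sq, Complex.normSq_apply, toComplex_re, toComplex_im]
  ring

/-- Half the length of the horizontal chord of the unit disk at height `t`. -/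
noncomputable def chord (t : ℝ) : ℝ := √(1 - t ^ 2)

theorem chord_sq {t : ℝ} (ht : |t| < 1) : chord t ^ 2 = 1 - t ^ 2 :=
  Real.sq_sqrt (by have := (sq_lt_one_iff_abs_lt_one t).2 ht; linarith)

theorem chord_pos {t : ℝ} (ht : |t| < 1) : 0 < chord t :=
  Real.sqrt_pos.2 (by have := (sq_lt_one_iff_abs_lt_one t).2 ht; linarith)

theorem chord_le_one (t : ℝ) : chord t ≤ 1 :=
  Real.sqrt_le_one.2 (by nlinarith [sq_nonneg t])

theorem chord_signPow (n : ℤ) (t : ℝ) : chord (signPow ε n * t) = chord t := by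
  rw [chord, chord, mul_pow, sq (signPow ε n), signPow_mul_self, one_mul]

theorem continuous_chord : Continuous chord := by unfold chord; fun_prop

theorem norm_chord {t : ℝ} (ht : |t| < 1) : ‖toComplex (chord t, t)‖ = 1 := by
  have := norm_toComplex_sq (chord t) t
  rw [chord_sq ht] at this
  have h : ‖toComplex (chord t, t)‖ ^ 2 = 1 := by rw [this]; ring
  exact (pow_eq_one_iff_of_nonneg (norm_nonneg _) two_ne_zero).1 h

theorem toComplex_neg (s t : ℝ) : -toComplex (s, t) = toComplex (-s, -t) := Complex.ext rfl rfl

theorem signPow_neg_left (ε : ℤˣ) : signPow (-ε) 1 = -signPow ε 1 := by simp [signPow]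

namespace IsAdapted

/-- The left end of the exterior part of the strip at height `t`. -/
noncomputable def left (φ : ℝ ≃ₜ ℝ) (t : ℝ) : ℝ := φ (chord t)

/-- The right end of the exterior part of the strip at height `t`. -/
noncomputable def right (φ : ℝ ≃ₜ ℝ) (t : ℝ) : ℝ := φ (-chord t) + 1

theorem lt_one (h : IsAdapted D ε δ a F φ) {t : ℝ} (ht : |t| < δ) : |t| < 1 := ht.trans_le h.le_one

theorem left_lt_right (h : IsAdapted D ε δ a F φ) (t : ℝ) : left φ t < right φ t := by
  have h1 := chord_le_one t
  have h2 : φ (chord t) ≤ φ a := h.strictMono.monotone (h1.trans h.one_lt.le)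
  have h3 : φ (-a) ≤ φ (-chord t) := h.strictMono.monotone (by linarith [h.one_lt])
  have := h.length
  unfold left right
  linarith

theorem right_lt_left (h : IsAdapted D ε δ a F φ) {t : ℝ} (ht : |t| < δ) : right φ t - 1 < left φ t := by
  have := h.strictMono (show -chord t < chord t by linarith [chord_pos (h.lt_one ht)])
  unfold left right
  linarith

theorem at_left (h : IsAdapted D ε δ a F φ) {t : ℝ} (ht : |t| < δ) : F (left φ t, t) = D.e (toComplex (chord t, t)) :=
  (h.eq_disk _ ⟨by linarith [chord_pos (h.lt_one ht), h.one_lt],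
    by linarith [chord_le_one t, h.one_lt]⟩ t ht).2

theorem shift (h : IsAdapted D ε δ a F φ) {x t : ℝ} (ht : |t| < δ) : F (x + 1, t) = F (x, signPow ε 1 * t) := by
  have hp : (x, signPow ε 1 * t) ∈ strip δ := by
    simpa [strip, abs_mul, abs_signPow] using ht
  rw [← h.lift.deck_eq hp 1]
  simp [deck, ← mul_assoc, signPow_mul_self]

theorem abs_sign_lt (_ : IsAdapted D ε δ a F φ) {t : ℝ} (ht : |t| < δ) : |signPow ε 1 * t| < δ := by
  rwa [abs_mul, abs_signPow, one_mul]

/-- The right end is a left endpoint of a chord seen one period later; the deck transformation back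
multiplies the height by `ε`. -/
theorem at_right (h : IsAdapted D ε δ a F φ) {t : ℝ} (ht : |t| < δ) :
    F (right φ t, t) = D.e (toComplex (-chord t, signPow ε 1 * t)) := by
  rw [right, h.shift ht]
  exact (h.eq_disk _ ⟨by linarith [chord_le_one t, h.one_lt],
    by linarith [chord_pos (h.lt_one ht), h.one_lt]⟩ _ (h.abs_sign_lt ht)).2

theorem notMem_ext (h : IsAdapted D ε δ a F φ) {x t : ℝ} (ht : |t| < δ) (h1 : right φ t - 1 < x) (h2 : x < left φ t) :
    F (x, t) ∉ D.ext := by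
  obtain ⟨s, rfl⟩ := φ.surjective x
  have h1' : -chord t < s := h.strictMono.lt_iff_lt.1 (by unfold right at h1; linarith)
  have h2' : s < chord t := h.strictMono.lt_iff_lt.1 h2
  have hc := chord_le_one t
  obtain ⟨hR, he⟩ := h.eq_disk s ⟨by linarith [h.one_lt], by linarith [h.one_lt]⟩ t ht
  rw [he, D.e_mem_ext hR, not_le]
  have h3 := norm_toComplex_sq s t
  have h4 := chord_sq (h.lt_one ht)
  have h5 : s ^ 2 < chord t ^ 2 := sq_lt_sq' h1' h2'
  nlinarith [norm_nonneg (toComplex (s, t))]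

/-- Three ranges of `x` occur: within the disk coordinate beyond the chord, within the same
coordinate one period later, and between the two, where the last field of `IsAdapted` applies. -/
theorem mem_outer_of_mem (h : IsAdapted D ε δ a F φ) {x t : ℝ} (ht : |t| < δ) (h1 : left φ t < x) (h2 : x < right φ t) :
    F (x, t) ∈ D.outer := by
  have hgt : ∀ s ∈ Icc (-a) a, ∀ t, |t| < δ → chord t < |s| → F (φ s, t) ∈ D.outer := by
    intro s hs t ht hc
    obtain ⟨hR, he⟩ := h.eq_disk s hs t ht
    rw [he, D.e_mem_outer hR]
    have h3 := norm_toComplex_sq s t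
    have h4 := chord_sq (h.lt_one ht)
    have h5 : chord t ^ 2 < s ^ 2 := by
      rw [← sq_abs s]; exact pow_lt_pow_left₀ hc (chord_pos (h.lt_one ht)).le two_ne_zero
    nlinarith [norm_nonneg (toComplex (s, t))]
  rcases le_total x (φ a) with h3 | h3
  · obtain ⟨s, rfl⟩ := φ.surjective x
    have h1' : chord t < s := h.strictMono.lt_iff_lt.1 h1
    have hs := h.strictMono.le_iff_le.1 h3
    have hc := chord_pos (h.lt_one ht)
    exact hgt s ⟨by linarith [h.one_lt], hs⟩ t ht (by rw [abs_of_pos (by linarith)]; exact h1')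
  · rcases le_total (φ (-a) + 1) x with h4 | h4
    · obtain ⟨s, hs⟩ := φ.surjective (x - 1)
      obtain rfl : x = φ s + 1 := by linarith
      have h2' : s < -chord t := h.strictMono.lt_iff_lt.1 (by unfold right at h2; linarith)
      have hs := h.strictMono.le_iff_le.1 (show φ (-a) ≤ φ s by linarith)
      have hc := chord_pos (h.lt_one ht)
      rw [h.shift ht]
      refine hgt s ⟨hs, by linarith [h.one_lt]⟩ _ (h.abs_sign_lt ht) ?_
      rw [chord_signPow, abs_of_neg (by linarith)]
      linarith
    · exact h.mem_outer x ⟨h3, h4⟩ t ht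

theorem mem_ext (h : IsAdapted D ε δ a F φ) {x t : ℝ} (ht : |t| < δ) (hx : x ∈ Icc (left φ t) (right φ t)) :
    F (x, t) ∈ D.ext := by
  rcases hx.1.eq_or_lt with rfl | h1
  · have := norm_chord (h.lt_one ht)
    rw [h.at_left ht, D.e_mem_ext (D.norm_lt_R this.le), this]
  · rcases hx.2.eq_or_lt with rfl | h2
    · have : ‖toComplex (-chord t, signPow ε 1 * t)‖ = 1 := by
        rw [← norm_chord (h.lt_one ht)]
        rw [← sq_eq_sq₀ (norm_nonneg _) (norm_nonneg _), norm_toComplex_sq, norm_toComplex_sq,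
          mul_pow, sq (signPow ε 1), signPow_mul_self]
        ring
      rw [h.at_right ht, D.e_mem_ext (D.norm_lt_R this.le), this]
    · exact D.outer_subset_ext (h.mem_outer_of_mem ht h1 h2)

theorem eq_left_of_circle (h : IsAdapted D ε δ a F φ) {x t : ℝ} (ht : |t| < δ) (hx : x ∈ Ico (left φ t) (right φ t)) {z : ℂ}
    (hz : ‖z‖ = 1) (he : F (x, t) = D.e z) : x = left φ t ∧ z = toComplex (chord t, t) := by
  have hx' : x = left φ t := by
    rcases hx.1.eq_or_lt with h1 | h1
    · exact h1.symm
    · have := h.mem_outer_of_mem ht h1 hx.2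
      rw [he, D.e_mem_outer (D.norm_lt_R hz.le)] at this
      linarith
  refine ⟨hx', ?_⟩
  rw [hx', h.at_left ht, D.e_eq_iff (D.norm_lt_R (norm_chord (h.lt_one ht)).le)
    (D.norm_lt_R hz.le)] at he
  exact he.symm

/-- Points of the strip near the exterior part that lie in the exterior. -/
theorem mem_Icc_of_mem_ext (h : IsAdapted D ε δ a F φ) {x t : ℝ} (ht : |t| < δ) (h1 : right φ t - 1 < x)
    (h2 : x < left φ t + 1) (hx : F (x, t) ∈ D.ext) : x ∈ Icc (left φ t) (right φ t) := by
  constructor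
  · by_contra h3
    exact h.notMem_ext ht h1 (not_le.1 h3) hx
  · by_contra h3
    have h4 := not_le.1 h3
    obtain ⟨y, rfl⟩ : ∃ y, x = y + 1 := ⟨x - 1, by ring⟩
    rw [h.shift ht] at hx
    refine h.notMem_ext (h.abs_sign_lt ht) ?_ ?_ hx
    · unfold right at *; rw [chord_signPow]; linarith
    · unfold left at *; rw [chord_signPow]; linarith

end IsAdapted

end Strip

/-! ### Existence of adapted bands, and the strict transform -/

section Strip

variable {S : Type*} [TopologicalSpace S] {ι : S → S} {x₀ : S} {D : InvariantDisk ι x₀}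
  {ε : ℤˣ} {δ a : ℝ} {F : ℝ × ℝ → S} {φ : ℝ ≃ₜ ℝ}

/-- A band core through the centre of the disk has an adapted band in a given neighbourhood. -/
theorem exists_isAdapted [T2Space S] {γ : Set S} (hγ : IsBandCore ε γ)
    (hmem : ∀ z ∈ Metric.ball (0 : ℂ) D.R, D.e z ∈ γ ↔ z.im = 0) {W : Set S} (hW : IsOpen W)
    (hγW : γ ⊆ W) : ∃ δ a F φ, IsAdapted D ε δ a F φ ∧ (range fun x : ℝ => F (x, 0)) = γ ∧
      ∀ p ∈ strip δ, F p ∈ W := by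
  obtain ⟨δ₀, F₀, hF₀, rfl⟩ := isBandCore_iff.1 hγ
  have hR := D.one_lt_R
  obtain ⟨a, ha1, haR⟩ := exists_between hR
  obtain ⟨b, hab, hbR⟩ := exists_between haR
  obtain ⟨δ₁, F, hF, hcore, φ, hφ, hlen, hdisk⟩ := hF₀.exists_adapted (by linarith) hab hbR hmem
  rw [← hcore] at hmem hγW ⊢
  have hlen' : φ a < φ (-a) + 1 := by
    linarith [hφ hab, hφ (show -b < -a by linarith)]
  -- The core meets the closed unit disk only in the segment `[-1, 1]`. Its parameters are the
  -- integer translates of `φ '' [-1, 1]`, and none of these reaches the interval from `φ a` to `φ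
  -- (-a) + 1`.
  have hcore_out : ∀ x ∈ Icc (φ a) (φ (-a) + 1), F (x, 0) ∈ D.outer := by
    rintro x hx ⟨z, hz, hzx⟩
    have hz1 : ‖z‖ ≤ 1 := by simpa using hz
    have him : z.im = 0 := (hmem z (D.mem_ball hz1)).1 ⟨x, hzx.symm⟩
    have hre : |z.re| ≤ 1 := (Complex.abs_re_le_norm z).trans hz1
    have hre' := abs_le.1 hre
    have hzre : toComplex (z.re, 0) = z := Complex.ext rfl him.symm
    have h1 := (hdisk z.re ⟨by linarith, by linarith⟩ 0 (by simpa using hF.pos)).2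
    rw [hzre, hzx] at h1
    obtain ⟨n, hn⟩ := band_rel_iff.1 ((hF.eq_iff _ (core_mem_strip hF.pos _) _
      (core_mem_strip hF.pos _)).1 h1)
    have hn1 : x = φ z.re + n := congrArg Prod.fst hn
    have h2 := hφ (show z.re < a by linarith)
    have h3 := hφ (show -a < z.re by linarith)
    have h4 : (0 : ℝ) < n := by linarith [hx.1]
    have h5 : (n : ℝ) < 1 := by linarith [hx.2]
    have h4' : 0 < n := by exact_mod_cast h4
    have h5' : n < 1 := by exact_mod_cast h5
    omega
  obtain ⟨u, v, -, hv, hu, h0, huv⟩ := generalized_tube_lemma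
    (isCompact_Icc (a := φ a) (b := φ (-a) + 1)) (isCompact_singleton (x := (0 : ℝ)))
    (hF.continuousOn.isOpen_inter_preimage (isOpen_strip δ₁) D.isOpen_outer) (by
      rintro ⟨x, t⟩ ⟨hx, rfl⟩
      exact ⟨core_mem_strip hF.pos x, hcore_out x hx⟩)
  obtain ⟨r, hr, hrv⟩ := Metric.isOpen_iff.1 hv 0 (h0 rfl)
  obtain ⟨δ₂, hδ₂, hδ₂₁, hFW⟩ := hF.exists_thin hW hγW
  have hpos : 0 < min (min r 1) δ₂ := by positivity
  refine ⟨min (min r 1) δ₂, a, F, φ, ⟨hF.mono hpos ((min_le_right _ _).trans hδ₂₁),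
    (min_le_left _ _).trans (min_le_right _ _), ha1, hφ, hlen', fun s hs t ht => ?_,
    fun x hx t ht => ?_⟩, rfl, fun p hp => hFW p (strip_mono (min_le_right _ _) hp)⟩
  · obtain ⟨h1, h2⟩ := hdisk s hs t (ht.trans_le ((min_le_right _ _).trans hδ₂₁))
    exact ⟨D.mem_ball_R.1 h1, h2⟩
  · refine (huv ⟨hu hx, hrv ?_⟩ : (x, t) ∈ _).2
    rw [Metric.mem_ball, dist_zero_right, Real.norm_eq_abs]
    exact ht.trans_le ((min_le_left _ _).trans (min_le_left _ _))

namespace IsAdapted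

/-- The exterior part of the strip in the parameters `[0, 1] × ℝ`. -/
noncomputable def param (φ : ℝ ≃ₜ ℝ) (p : ℝ × ℝ) : ℝ × ℝ :=
  (left φ p.2 + p.1 * (right φ p.2 - left φ p.2), p.2)

theorem continuous_left (φ : ℝ ≃ₜ ℝ) : Continuous (left φ) := φ.continuous.comp continuous_chord

theorem continuous_right (φ : ℝ ≃ₜ ℝ) : Continuous (right φ) :=
  (φ.continuous.comp continuous_chord.neg).add continuous_const

theorem continuous_param (φ : ℝ ≃ₜ ℝ) : Continuous (param φ) := by
  have h1 := continuous_left φ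
  have h2 := continuous_right φ
  unfold param
  fun_prop

theorem param_Icc (h : IsAdapted D ε δ a F φ) {p : ℝ × ℝ} (hp : p.1 ∈ Icc (0 : ℝ) 1) :
    (param φ p).1 ∈ Icc (left φ p.2) (right φ p.2) := by
  have := h.left_lt_right p.2
  simp only [param]
  constructor <;> nlinarith [hp.1, hp.2]

theorem param_Ico (h : IsAdapted D ε δ a F φ) {p : ℝ × ℝ} (hp : p.1 ∈ Ico (0 : ℝ) 1) :
    (param φ p).1 ∈ Ico (left φ p.2) (right φ p.2) := by
  have := h.left_lt_right p.2
  simp only [param]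
  constructor <;> nlinarith [hp.1, hp.2]

/-- The inverse of `param`. -/
noncomputable def unparam (φ : ℝ ≃ₜ ℝ) (p : ℝ × ℝ) : ℝ × ℝ :=
  ((p.1 - left φ p.2) / (right φ p.2 - left φ p.2), p.2)

theorem continuous_unparam (h : IsAdapted D ε δ a F φ) : Continuous (unparam φ) := by
  have h1 := continuous_left φ
  have h2 := continuous_right φ
  refine Continuous.prodMk (Continuous.div (by fun_prop) (by fun_prop) fun p => ?_) continuous_snd
  have := h.left_lt_right p.2
  linarith

theorem param_unparam (h : IsAdapted D ε δ a F φ) (p : ℝ × ℝ) : param φ (unparam φ p) = p := by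
  have := h.left_lt_right p.2
  have h' : right φ p.2 - left φ p.2 ≠ 0 := by linarith
  simp only [param, unparam]
  ext
  · simp only; field_simp; ring
  · rfl

theorem unparam_param (h : IsAdapted D ε δ a F φ) (p : ℝ × ℝ) : unparam φ (param φ p) = p := by
  have := h.left_lt_right p.2
  have h' : right φ p.2 - left φ p.2 ≠ 0 := by linarith
  simp only [param, unparam]
  ext
  · simp only; field_simp; ring
  · rfl

theorem unparam_Icc (h : IsAdapted D ε δ a F φ) {p : ℝ × ℝ}
    (hp : p.1 ∈ Icc (left φ p.2) (right φ p.2)) : (unparam φ p).1 ∈ Icc (0 : ℝ) 1 := by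
  have := h.left_lt_right p.2
  have h' : 0 < right φ p.2 - left φ p.2 := by linarith
  exact ⟨div_nonneg (by linarith [hp.1]) h'.le, (div_le_one h').2 (by linarith [hp.2])⟩

/-- The exterior part of the strip in the blowup. -/
noncomputable def chartMap (D : InvariantDisk ι x₀) (F : ℝ × ℝ → S) (φ : ℝ ≃ₜ ℝ) (p : ℝ × ℝ) :
    D.Blowup := D.proj (F (param φ p))

theorem param_mem_ext (h : IsAdapted D ε δ a F φ) {p : ℝ × ℝ} (hp : p.1 ∈ Icc (0 : ℝ) 1)
    (ht : |p.2| < δ) : F (param φ p) ∈ D.ext :=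
  h.mem_ext ht (h.param_Icc hp)

theorem continuousOn_chartMap (h : IsAdapted D ε δ a F φ) :
    ContinuousOn (chartMap D F φ) {p | p.1 ∈ Icc (0 : ℝ) 1 ∧ |p.2| < δ} :=
  D.continuousOn_proj.comp (h.lift.continuousOn.comp (continuous_param φ).continuousOn
    fun _ hp => hp.2) fun _ hp => h.param_mem_ext hp.1 hp.2

/-- Here the type changes. The right end at height `t` is `e(-c + iεt)`, with `c` the half chord.
The blowup identifies it with its antipode `e(c - iεt)`, the left end at height `-εt`. -/
theorem chartMap_one (h : IsAdapted D ε δ a F φ) (t : ℝ) (ht : |t| < δ) :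
    chartMap D F φ (1, t) = chartMap D F φ (0, signPow (-ε) 1 * t) := by
  have h1 : param φ (1, t) = (right φ t, t) := by simp [param]
  have h2 : param φ (0, signPow (-ε) 1 * t) = (left φ (signPow (-ε) 1 * t), signPow (-ε) 1 * t) := by
    simp [param]
  have ht' : |signPow (-ε) 1 * t| < δ := by rwa [abs_mul, abs_signPow, one_mul]
  have hn := norm_chord (h.lt_one ht')
  rw [chartMap, chartMap, h1, h2, h.at_right ht, h.at_left ht', ← D.proj_e_neg hn, toComplex_neg,
    chord_signPow, signPow_neg_left]
  simp

/-- Points with equal images in the surface differ by a deck transformation, and the strip is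
shorter than a period. Antipodal points would both be left ends, whose real parts are positive. -/
theorem injOn_chartMap (h : IsAdapted D ε δ a F φ) :
    InjOn (chartMap D F φ) {p | p.1 ∈ Ico (0 : ℝ) 1 ∧ |p.2| < δ} := by
  rintro p ⟨hp, hpt⟩ q ⟨hq, hqt⟩ hpq
  rcases (D.proj_eq_iff (h.param_mem_ext (Ico_subset_Icc_self hp) hpt)
    (h.param_mem_ext (Ico_subset_Icc_self hq) hqt)).1 hpq with h1 | ⟨z, hz, h1, h2⟩
  · obtain ⟨n, hn⟩ := band_rel_iff.1
      ((h.lift.eq_iff (param φ p) hpt (param φ q) hqt).1 h1)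
    have e1 : (param φ q).1 = (param φ p).1 + n := congrArg Prod.fst hn
    have e2 : q.2 = signPow ε n * p.2 := congrArg Prod.snd hn
    have hp1 := h.param_Ico hp
    have hq1 := h.param_Ico hq
    have hl : left φ q.2 = left φ p.2 := by rw [e2, left, left, chord_signPow]
    have hr : right φ q.2 = right φ p.2 := by rw [e2, right, right, chord_signPow]
    rw [hl, hr] at hq1
    have hlen := h.right_lt_left hpt
    have hn0 : n = 0 := by
      have : |(n : ℝ)| < 1 := by
        rw [abs_lt]
        constructor <;> linarith [hp1.1, hp1.2, hq1.1, hq1.2]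
      exact Int.abs_lt_one_iff.1 (by exact_mod_cast this)
    rw [hn0, deck_zero] at hn
    rw [← h.unparam_param p, ← h.unparam_param q, hn]
  · have e1 := (h.eq_left_of_circle hpt (h.param_Ico hp) hz h1).2
    have e2 := (h.eq_left_of_circle hqt (h.param_Ico hq) (by simpa using hz) h2).2
    have h3 := congrArg Complex.re e1
    have h4 := congrArg Complex.re e2
    rw [toComplex_re] at h3 h4
    rw [Complex.neg_re] at h4
    simp only at h3 h4
    linarith [chord_pos (h.lt_one hpt), chord_pos (h.lt_one hqt)]

/-- The band of the blowup along the strict transform. -/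
noncomputable def blowupLift (D : InvariantDisk ι x₀) (ε : ℤˣ) (F : ℝ × ℝ → S) (φ : ℝ ≃ₜ ℝ) :
    ℝ × ℝ → D.Blowup := twistExtend (-ε) (chartMap D F φ)

theorem blowupLift_of_Icc (h : IsAdapted D ε δ a F φ) {p : ℝ × ℝ} (hp : p.1 ∈ Icc (0 : ℝ) 1)
    (hps : p ∈ strip δ) : blowupLift D ε F φ p = D.proj (F (param φ p)) :=
  twistExtend_of_Icc h.chartMap_one hp hps

theorem blowupLift_deck (n : ℤ) (p : ℝ × ℝ) :
    blowupLift D ε F φ (deck (-ε) n p) = blowupLift D ε F φ p := twistExtend_deck n p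

/-- A point of the exterior lies over the image of an open set of parameters iff it lies in an open
subset of the strip. -/
theorem proj_mem_image_iff (h : IsAdapted D ε δ a F φ) {O : Set (ℝ × ℝ)} (hO : O ⊆ strip δ) {y : S}
    (hy : y ∈ D.ext) : D.proj y ∈ blowupLift D ε F φ '' O ↔
      y ∈ F '' {p | (|p.2| < δ ∧ right φ p.2 - 1 < p.1 ∧ p.1 < left φ p.2 + 1) ∧
        unparam φ p ∈ saturation (-ε) O} := by
  constructor
  · rintro ⟨p, hp, hpy⟩
    obtain ⟨n, hn⟩ := exists_deck_Ico (-ε) p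
    rw [← blowupLift_deck n] at hpy
    have hsat : deck (-ε) n p ∈ saturation (-ε) O := mem_saturation.2 ⟨p, hp, n, rfl⟩
    have hqs : deck (-ε) n p ∈ strip δ := deck_mem_strip.2 (hO hp)
    generalize deck (-ε) n p = q at *
    have hqt : |q.2| < δ := hqs
    have hq := h.param_Ico hn
    rw [h.blowupLift_of_Icc (Ico_subset_Icc_self hn) hqs, D.proj_eq_iff
      (h.param_mem_ext (Ico_subset_Icc_self hn) hqt) hy] at hpy
    rcases hpy with rfl | ⟨z, hz, h1, h2⟩
    · have := h.right_lt_left hqt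
      refine ⟨param φ q, ⟨⟨hqt, ?_, ?_⟩, by rwa [h.unparam_param]⟩, rfl⟩
      · show right φ q.2 - 1 < _
        linarith [hq.1]
      · show _ < left φ q.2 + 1
        linarith [hq.2]
    -- Here `y` is the antipode of a left end, hence a right end: it has parameter `1` and is the
    -- deck translate of `q`.
    · obtain ⟨e1, e2⟩ := h.eq_left_of_circle hqt hq hz h1
      have hq1 : q = (0, q.2) := by
        rw [← h.unparam_param q]
        ext
        · show ((param φ q).1 - left φ q.2) / (right φ q.2 - left φ q.2) = 0
          rw [e1, sub_self, zero_div]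
        · rfl
      have ht' : |signPow (-ε) 1 * q.2| < δ := by rwa [abs_mul, abs_signPow, one_mul]
      refine ⟨(right φ (signPow (-ε) 1 * q.2), signPow (-ε) 1 * q.2), ⟨⟨ht', ?_, ?_⟩, ?_⟩, ?_⟩
      · simp
      · have := h.right_lt_left ht'
        simp only
        linarith
      · have e3 : unparam φ (right φ (signPow (-ε) 1 * q.2), signPow (-ε) 1 * q.2) =
            deck (-ε) 1 q := by
          have := h.left_lt_right (signPow (-ε) 1 * q.2)
          rw [hq1, unparam, deck]
          simp only
          rw [div_self (by linarith)]
          simp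
        rw [e3]
        obtain ⟨r, hr, m, hm⟩ := mem_saturation.1 hsat
        refine mem_saturation.2 ⟨r, hr, m + 1, ?_⟩
        rw [show q = deck (-ε) m r from hm, deck_deck]
        rfl
      · rw [h.at_right ht', h2, e2, toComplex_neg, chord_signPow, signPow_neg_left]
        congr 3
        rw [neg_mul, mul_neg, ← mul_assoc, signPow_mul_self, one_mul]
  · rintro ⟨p, ⟨⟨hpt, h1, h2⟩, hsat⟩, rfl⟩
    have hI := h.unparam_Icc (h.mem_Icc_of_mem_ext hpt h1 h2 hy)
    obtain ⟨q, hq, n, hn⟩ := mem_saturation.1 hsat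
    refine ⟨q, hq, ?_⟩
    rw [← blowupLift_deck n, ← show unparam φ p = deck (-ε) n q from hn,
      h.blowupLift_of_Icc hI hpt, h.param_unparam]

theorem isBandLift_blowupLift (h : IsAdapted D ε δ a F φ) :
    IsBandLift (-ε) δ (blowupLift D ε F φ) where
  pos := h.lift.pos
  continuousOn := continuousOn_twistExtend h.continuousOn_chartMap h.chartMap_one
  isOpen_image := fun O hO hOo => by
    -- The exterior part of the strip is not open. Extending it at both ends into the unit disk
    -- makes it open and adds no exterior points.
    refine D.isOpen_blowup (h.lift.isOpen_image _ (fun p hp => hp.1.1) ?_)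
      fun y hy => h.proj_mem_image_iff hO hy
    refine IsOpen.inter ?_ ((isOpen_saturation hOo).preimage h.continuous_unparam)
    have c1 := continuous_left φ
    have c2 := continuous_right φ
    have o1 : IsOpen {p : ℝ × ℝ | right φ p.2 - 1 < p.1} :=
      isOpen_lt ((c2.comp continuous_snd).sub continuous_const) continuous_fst
    have o2 : IsOpen {p : ℝ × ℝ | p.1 < left φ p.2 + 1} :=
      isOpen_lt continuous_fst ((c1.comp continuous_snd).add continuous_const)
    exact (isOpen_strip δ).inter (o1.inter o2)
  eq_iff := fun p hp q hq => by
    constructor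
    · intro hpq
      obtain ⟨n, hn⟩ := exists_deck_Ico (-ε) p
      obtain ⟨m, hm⟩ := exists_deck_Ico (-ε) q
      rw [← blowupLift_deck n p, ← blowupLift_deck m q, blowupLift, twistExtend_of_Ico hn,
        twistExtend_of_Ico hm] at hpq
      have := h.injOn_chartMap ⟨hn, deck_mem_strip.2 hp⟩ ⟨hm, deck_mem_strip.2 hq⟩ hpq
      refine band_rel_iff.2 ⟨n + -m, ?_⟩
      rw [← deck_deck, this, deck_deck, add_neg_cancel, deck_zero]
    · rintro ⟨n, hn⟩
      rw [show q = deck (-ε) n p from hn, blowupLift_deck]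

/-- The core of the band of the blowup is the strict transform of the core. -/
theorem range_blowupLift (h : IsAdapted D ε δ a F φ) :
    (range fun x : ℝ => blowupLift D ε F φ (x, 0)) =
      D.proj '' ((range fun x : ℝ => F (x, 0)) ∩ D.ext) := by
  have h0 : |(0 : ℝ)| < δ := by simpa using h.lift.pos
  ext q
  constructor
  · rintro ⟨x, rfl⟩
    obtain ⟨n, hn⟩ := exists_deck_Ico (-ε) (x, 0)
    obtain ⟨u, he⟩ : ∃ u, deck (-ε) n (x, 0) = (u, 0) :=
      ⟨(deck (-ε) n (x, 0)).1, by simp [deck]⟩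
    rw [he] at hn
    have hs := core_mem_strip h.lift.pos u
    simp only
    rw [← blowupLift_deck n, he, h.blowupLift_of_Icc (Ico_subset_Icc_self hn) hs]
    exact ⟨_, ⟨⟨_, rfl⟩, h.param_mem_ext (Ico_subset_Icc_self hn) h0⟩, rfl⟩
  · rintro ⟨y, ⟨⟨x, rfl⟩, hy⟩, rfl⟩
    have hx : ∃ x' ∈ Icc (left φ 0) (right φ 0), F (x', 0) = F (x, 0) := by
      -- This shift brings the parameter into `(right φ 0 - 1, right φ 0]`, where only the exterior
      -- part of the strip lies in the exterior.
      have hfl : F (x + (-⌈x - right φ 0⌉ : ℤ), 0) = F (x, 0) := by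
        rw [← h.lift.deck_eq (core_mem_strip h.lift.pos x) (-⌈x - right φ 0⌉)]
        simp [deck]
      have h1 := Int.le_ceil (x - right φ 0)
      have h2 := Int.ceil_lt_add_one (x - right φ 0)
      refine ⟨_, h.mem_Icc_of_mem_ext h0 ?_ ?_ (hfl ▸ hy), hfl⟩
      · push_cast; linarith
      · have := h.right_lt_left h0
        push_cast; linarith
    obtain ⟨x', hx', hxx⟩ := hx
    have hu := h.unparam_Icc (p := (x', 0)) hx'
    refine ⟨(unparam φ (x', 0)).1, ?_⟩
    have := h.blowupLift_of_Icc hu (core_mem_strip h.lift.pos _)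
    rw [h.param_unparam, hxx] at this
    exact this

end IsAdapted

/-- The strict transform of a band core through the centre of the disk is a band core of the
other type. -/
theorem isBandCore_strictTransform [T2Space S] {γ : Set S} (hγ : IsBandCore ε γ)
    (hmem : ∀ z ∈ Metric.ball (0 : ℂ) D.R, D.e z ∈ γ ↔ z.im = 0) :
    IsBandCore (-ε) (D.proj '' (γ ∩ D.ext)) := by
  obtain ⟨δ, a, F, φ, h, rfl, -⟩ := exists_isAdapted hγ hmem isOpen_univ (subset_univ _)
  exact isBandCore_iff.2 ⟨_, _, h.isBandLift_blowupLift, h.range_blowupLift⟩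

/-- The band of the blowup lies over an adapted band chosen inside `W`. This controls the fixed
points near the strict transform. -/
theorem exists_isOpen_strictTransform [T2Space S] {γ : Set S} (hγ : IsBandCore ε γ)
    (hmem : ∀ z ∈ Metric.ball (0 : ℂ) D.R, D.e z ∈ γ ↔ z.im = 0) {W : Set S} (hW : IsOpen W)
    (hγW : γ ⊆ W) : ∃ W' : Set D.Blowup, IsOpen W' ∧ D.proj '' (γ ∩ D.ext) ⊆ W' ∧
      ∀ q ∈ W', ∃ y ∈ D.ext ∩ W, q = D.proj y := by
  obtain ⟨δ, a, F, φ, h, rfl, hFW⟩ := exists_isAdapted hγ hmem hW hγW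
  have hb := h.isBandLift_blowupLift
  refine ⟨_, hb.isOpen_image _ Subset.rfl (isOpen_strip δ), ?_, ?_⟩
  · rw [← h.range_blowupLift]
    rintro _ ⟨x, rfl⟩
    exact ⟨_, core_mem_strip hb.pos x, rfl⟩
  · rintro _ ⟨p, hp, rfl⟩
    obtain ⟨n, hn⟩ := exists_deck_Ico (-ε) p
    have hps := (deck_mem_strip (ε := -ε) (n := n)).2 hp
    refine ⟨_, ⟨h.param_mem_ext (Ico_subset_Icc_self hn) hps, hFW _ ?_⟩, ?_⟩
    · exact hps
    · rw [← IsAdapted.blowupLift_deck n, h.blowupLift_of_Icc (Ico_subset_Icc_self hn) hps]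

end Strip

/-! ### Counting reflection curves -/

section Count

theorem encard_eq_add_one {α : Type*} {s : Set (Set α)} {A U : Set α} (hA : A ∈ s)
    (hAU : ¬ A ⊆ U) (h : ∀ γ ∈ s, ¬ γ ⊆ U → γ = A) :
    s.encard = {γ ∈ s | γ ⊆ U}.encard + 1 := by
  rw [← encard_insert_of_notMem (a := A) fun h' => hAU h'.2]
  congr 1
  ext γ
  simp only [mem_insert_iff, mem_sep_iff]
  constructor
  · intro hγ
    by_cases h' : γ ⊆ U
    · exact Or.inr ⟨hγ, h'⟩
    · exact Or.inl (h γ hγ h')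
  · rintro (rfl | h')
    · exact hA
    · exact h'.1

variable {S : Type*} [TopologicalSpace S] {ι : S → S} {x₀ : S} {D : InvariantDisk ι x₀}
  {ε : ℤˣ}

theorem not_mem_fixedCores_of_isolated {q : S} {W : Set S} (hW : W ∈ 𝓝 q)
    (hfix : ∀ y ∈ W, ι y = y → y = q) {γ : Set S} (hγ : γ ∈ fixedCores ε ι) : q ∉ γ := by
  intro hq
  obtain ⟨z, hz, hzW, hne⟩ := hγ.1.exists_ne_mem hq hW
  exact hne (hfix z hzW (hγ.2 z hz))

namespace InvariantDisk

theorem isOpen_proj_image {O : Set ℂ} (hO : IsOpen O) (hOR : O ⊆ Metric.ball 0 D.R)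
    (hneg : ∀ z ∈ O, ‖z‖ = 1 → -z ∈ O) : IsOpen (D.proj '' (D.e '' O ∩ D.ext)) := by
  refine D.isOpen_blowup (D.isOpen_image hO hOR) fun y hy => ⟨?_, fun h => ⟨y, ⟨h, hy⟩, rfl⟩⟩
  rintro ⟨y', ⟨hy', hye⟩, h⟩
  rcases (D.proj_eq_iff hye hy).1 h with rfl | ⟨z, hz, rfl, rfl⟩
  · exact hy'
  · exact ⟨-z, hneg z ((D.e_mem_image_iff hOR (D.norm_lt_R hz.le)).1 hy') hz, rfl⟩

theorem blowupMap_fixed_iff (hι : Function.Involutive ι) {y : S} (hy : y ∈ D.ext) :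
    D.blowupMap hι (D.proj y) = D.proj y ↔
      ι y = y ∨ ∃ z : ℂ, ‖z‖ = 1 ∧ ι y = D.e z ∧ y = D.e (-z) := by
  rw [D.blowupMap_proj hι hy, D.proj_eq_iff (D.map_mem_ext hι hy) hy]

/-- Both numbers count the fixed cores of the outer part itself, which is open in either surface. -/
theorem encard_outer [T2Space S] (hι : Function.Involutive ι) :
    {γ ∈ fixedCores ε (D.blowupMap hι) | γ ⊆ D.exceptionalᶜ}.encard =
      {γ ∈ fixedCores ε ι | γ ⊆ D.outer}.encard := by
  rw [← D.range_proj_outer, encard_fixedCores_subset_range D.isOpenEmbedding_proj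
    (κ := D.outerMap hι) fun y => D.blowupMap_proj hι (D.outer_subset_ext y.2)]
  rw [← encard_fixedCores_subset_range D.isOpen_outer.isOpenEmbedding_subtypeVal
    (κ := D.outerMap hι) (ι := ι) fun y => rfl, Subtype.range_coe]

theorem exists_of_not_subset_outer {γ : Set S} (h : ¬ γ ⊆ D.outer) :
    ∃ z : ℂ, ‖z‖ ≤ 1 ∧ D.e z ∈ γ := by
  obtain ⟨y, hy, hy'⟩ := not_subset.1 h
  obtain ⟨z, hz, rfl⟩ := not_not.1 hy'
  exact ⟨z, by simpa using hz, hy⟩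

theorem exists_of_not_subset_compl {γ : Set D.Blowup} (h : ¬ γ ⊆ D.exceptionalᶜ) :
    ∃ z : ℂ, ‖z‖ = 1 ∧ D.proj (D.e z) ∈ γ := by
  obtain ⟨y, hy, hy'⟩ := not_subset.1 h
  obtain ⟨z, hz, rfl⟩ := not_not.1 hy'
  exact ⟨z, by simpa using hz, hy⟩

/-! #### Rotation disks -/

/-- A reflection would fix a whole diameter, which accumulates at the centre. -/
theorem isRotation_of_isolated (h : IsIsolatedFixedPoint ι x₀) : D.IsRotation := by
  rcases D.equivariant with he | he
  · exact he
  · exfalso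
    have hD : D.IsReflection := he
    obtain ⟨-, U, hU, hfix⟩ := h
    have h0 : (0 : ℂ) ∈ Metric.ball (0 : ℂ) D.R := Metric.mem_ball_self D.R_pos
    have hc : ContinuousAt D.e 0 := D.continuousOn_e.continuousAt (Metric.isOpen_ball.mem_nhds h0)
    have hc' : ContinuousAt (fun s : ℝ => D.e s) 0 :=
      ContinuousAt.comp (by simpa using hc) Complex.continuous_ofReal.continuousAt
    have hU' : ∀ᶠ s : ℝ in 𝓝 0, D.e s ∈ U := hc' (by simpa [D.map_zero] using hU)
    obtain ⟨r, hr, hrU⟩ := Metric.eventually_nhds_iff.1 hU'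
    obtain ⟨s, hs0, hs⟩ := exists_between (lt_min hr D.R_pos)
    have hsb : (s : ℂ) ∈ Metric.ball (0 : ℂ) D.R :=
      ofReal_mem_ball.2 ⟨by linarith [D.R_pos], hs.trans_le (min_le_right _ _)⟩
    have := hfix _ (hrU (y := s) (by simpa [abs_of_pos hs0] using hs.trans_le (min_le_left _ _)))
      ((hD.fixed_iff hsb).2 (by simp))
    replace this := D.injOn hsb h0 (this.trans D.map_zero.symm)
    exact hs0.ne' (by exact_mod_cast this)

/-- The centre is the only fixed point in the disk and is isolated, so no fixed core contains it. -/
theorem IsRotation.subset_outer (hD : D.IsRotation) {γ : Set S} (hγ : γ ∈ fixedCores ε ι) :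
    γ ⊆ D.outer := by
  have h0 : (0 : ℂ) ∈ Metric.ball (0 : ℂ) D.R := Metric.mem_ball_self D.R_pos
  have hx : x₀ ∉ γ := by
    refine not_mem_fixedCores_of_isolated (W := D.e '' Metric.ball 0 D.R)
      ((D.isOpen_image Metric.isOpen_ball Subset.rfl).mem_nhds ⟨0, h0, D.map_zero⟩) ?_ hγ
    rintro _ ⟨z, hz, rfl⟩ h
    rw [(hD.fixed_iff hz).1 h, D.map_zero]
  by_contra h
  obtain ⟨z, hz, hzγ⟩ := exists_of_not_subset_outer h
  refine hx ?_
  rwa [(hD.fixed_iff (D.mem_ball hz)).1 (hγ.2 _ hzγ), D.map_zero] at hzγ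

theorem IsRotation.encard_eq (hD : D.IsRotation) :
    {γ ∈ fixedCores ε ι | γ ⊆ D.outer}.encard = (fixedCores ε ι).encard := by
  congr 1
  ext γ
  exact ⟨fun h => h.1, fun h => ⟨h, hD.subset_outer h⟩⟩

theorem IsRotation.exceptional_mem (hD : D.IsRotation) (hι : Function.Involutive ι) :
    D.exceptional ∈ fixedCores (-1) (D.blowupMap hι) := by
  refine ⟨D.isBandCore_exceptional, ?_⟩
  rintro _ ⟨z, hz, rfl⟩
  exact hD.neg_mem hι (by simpa using hz)

/-- In the collar given by the coordinate disk only the points of the exceptional circle are fixed,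
so this circle is relatively clopen in the fixed point set. -/
theorem IsRotation.eq_exceptional [T2Space S] (hD : D.IsRotation) (hι : Function.Involutive ι)
    {γ : Set D.Blowup} (hγ : γ ∈ fixedCores ε (D.blowupMap hι)) (h : ¬ γ ⊆ D.exceptionalᶜ) :
    γ = D.exceptional := by
  obtain ⟨z, hz, hzγ⟩ := exists_of_not_subset_compl h
  refine fixedCores_eq_of_mem D.isBandCore_exceptional D.isClosed_exceptional
    (D.isOpen_proj_image Metric.isOpen_ball Subset.rfl fun w hw _ => by simpa using hw) ?_ ?_ hγ
    ⟨z, by simpa using hz, rfl⟩ hzγ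
  · rintro _ ⟨w, hw, rfl⟩
    have hw1 : ‖w‖ = 1 := by simpa using hw
    exact ⟨_, ⟨⟨w, D.mem_ball hw1.le, rfl⟩, (D.e_mem_ext (D.norm_lt_R hw1.le)).2 hw1.ge⟩, rfl⟩
  · rintro _ ⟨_, ⟨⟨w, hw, rfl⟩, hwe⟩, rfl⟩ hfix
    have hwR := D.mem_ball_R.1 hw
    have hw1 := (D.e_mem_ext hwR).1 hwe
    rcases (D.blowupMap_fixed_iff hι hwe).1 hfix with h | ⟨v, hv, -, h⟩
    · rw [(hD.fixed_iff hw).1 h] at hw1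
      norm_num at hw1
    · rw [D.e_eq_iff hwR (by simpa using D.norm_lt_R hv.le)] at h
      exact ⟨w, by simp [h, hv], rfl⟩

/-! #### Reflection disks -/

theorem isReflection_of_mem {γ : Set S} (hγ : γ ∈ fixedCores ε ι) (h0 : x₀ ∈ γ) :
    D.IsReflection := by
  rcases D.equivariant with he | he
  · have hD : D.IsRotation := he
    exact absurd ⟨0, by simp, D.map_zero⟩ (hD.subset_outer hγ h0)
  · exact he

/-- Besides the real points, those with `conj w = -w` on the unit circle become fixed; they are `i`
and `-i`. -/
theorem IsReflection.eq_of_fixed (hD : D.IsReflection) (hι : Function.Involutive ι) {w : ℂ}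
    (hwR : ‖w‖ < D.R) (hw1 : 1 ≤ ‖w‖)
    (hfix : D.blowupMap hι (D.proj (D.e w)) = D.proj (D.e w)) :
    w.im = 0 ∨ w = Complex.I ∨ w = -Complex.I := by
  have hw := D.mem_ball_R.2 hwR
  rcases (D.blowupMap_fixed_iff hι ((D.e_mem_ext hwR).2 hw1)).1 hfix with h | ⟨v, hv, h, h'⟩
  · exact Or.inl ((hD.fixed_iff hw).1 h)
  · rw [D.e_eq_iff hwR (by simpa using D.norm_lt_R hv.le)] at h'
    rw [hD w hw, D.e_eq_iff (by simpa using hwR) (D.norm_lt_R hv.le)] at h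
    have hre : w.re = 0 := by
      have h1 : w.re = v.re := by simpa using congrArg Complex.re h
      have h2 : w.re = -v.re := by simpa using congrArg Complex.re h'
      linarith
    have him : w.im * w.im = 1 := by
      have h1 := Complex.normSq_eq_norm_sq w
      rw [h', norm_neg, hv, ← h', Complex.normSq_apply, hre] at h1
      linarith
    right
    rcases mul_self_eq_one_iff.1 him with h1 | h1
    · exact Or.inl (Complex.ext (by simp [hre]) (by simp [h1]))
    · exact Or.inr (Complex.ext (by simp [hre]) (by simp [h1]))

/-- Off the real axis the common class of `i` and `-i` is the only fixed point in the collar, hence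
it is isolated. -/
theorem IsReflection.I_notMem (hD : D.IsReflection) (hι : Function.Involutive ι)
    {γ : Set D.Blowup} (hγ : γ ∈ fixedCores ε (D.blowupMap hι)) :
    D.proj (D.e Complex.I) ∉ γ := by
  have hI : ‖Complex.I‖ = 1 := Complex.norm_I
  have hO : IsOpen (Metric.ball (0 : ℂ) D.R ∩ {w | w.im ≠ 0}) :=
    Metric.isOpen_ball.inter (isOpen_ne_fun Complex.continuous_im continuous_const)
  refine not_mem_fixedCores_of_isolated ((D.isOpen_proj_image hO inter_subset_left
    fun w hw _ => ⟨by simpa using hw.1, by simpa using hw.2⟩).mem_nhds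
    ⟨_, ⟨⟨_, ⟨D.mem_ball hI.le, by simp⟩, rfl⟩, (D.e_mem_ext (D.norm_lt_R hI.le)).2 hI.ge⟩, rfl⟩)
    ?_ hγ
  rintro _ ⟨_, ⟨⟨w, ⟨hw, hw0⟩, rfl⟩, hwe⟩, rfl⟩ hfix
  have hwR := D.mem_ball_R.1 hw
  rcases hD.eq_of_fixed hι hwR ((D.e_mem_ext hwR).1 hwe) hfix with h | rfl | rfl
  · exact absurd h hw0
  · rfl
  · exact D.proj_e_neg hI

variable {γ₀ : Set S}

/-- A fixed core meets the closed disk only in real points, which belong to `γ₀`, so a core that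
meets it equals `γ₀`. A core of the other type cannot, since `γ₀` has only one type. -/
theorem IsReflection.encard_eq [T2Space S] (hD : D.IsReflection) (hc : Continuous ι)
    (hι : Function.Involutive ι) (hγ₀ : γ₀ ∈ fixedCores ε ι) (h0 : x₀ ∈ γ₀) :
    (fixedCores ε ι).encard = {γ ∈ fixedCores ε ι | γ ⊆ D.outer}.encard + 1 ∧
    {γ ∈ fixedCores (-ε) ι | γ ⊆ D.outer}.encard = (fixedCores (-ε) ι).encard := by
  have key : ∀ ε' : ℤˣ, ∀ γ ∈ fixedCores ε' ι, ¬ γ ⊆ D.outer → γ = γ₀ := by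
    intro ε' γ hγ h
    obtain ⟨z, hz, hzγ⟩ := exists_of_not_subset_outer h
    obtain ⟨W, hW, hγW, hfix⟩ := hD.exists_isOpen hc hι hγ₀ h0
    refine fixedCores_eq_of_mem hγ₀.1 hγ₀.1.isCompact.isClosed hW hγW hfix hγ ?_ hzγ
    exact (hD.mem_iff hc hι hγ₀ h0 (D.mem_ball hz)).2
      ((hD.fixed_iff (D.mem_ball hz)).1 (hγ.2 _ hzγ))
  refine ⟨encard_eq_add_one hγ₀ (fun h => h h0 ⟨0, by simp, D.map_zero⟩) (key ε), ?_⟩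
  congr 1
  ext γ
  refine ⟨fun h => h.1, fun h => ⟨h, ?_⟩⟩
  by_contra h'
  exact hγ₀.1.not_isBandCore_neg (key _ γ h h' ▸ h.1)

theorem IsReflection.strictTransform_mem [T2Space S] (hD : D.IsReflection) (hc : Continuous ι)
    (hι : Function.Involutive ι) (hγ₀ : γ₀ ∈ fixedCores ε ι) (h0 : x₀ ∈ γ₀) :
    D.proj '' (γ₀ ∩ D.ext) ∈ fixedCores (-ε) (D.blowupMap hι) := by
  refine ⟨isBandCore_strictTransform hγ₀.1 fun z hz => hD.mem_iff hc hι hγ₀ h0 hz, ?_⟩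
  rintro _ ⟨y, hy, rfl⟩
  rw [D.blowupMap_proj hι hy.2, hγ₀.2 y hy.1]

theorem IsReflection.isClosed_strictTransform [T2Space S] (hD : D.IsReflection)
    (hc : Continuous ι) (hι : Function.Involutive ι) (hγ₀ : γ₀ ∈ fixedCores ε ι) (h0 : x₀ ∈ γ₀) :
    IsClosed (D.proj '' (γ₀ ∩ D.ext)) := by
  refine D.isClosed_blowup hγ₀.1.isCompact.isClosed fun y hy =>
    ⟨?_, fun h => ⟨y, ⟨h, hy⟩, rfl⟩⟩
  rintro ⟨y', ⟨hy', hye⟩, h⟩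
  rcases (D.proj_eq_iff hye hy).1 h with rfl | ⟨z, hz, rfl, rfl⟩
  · exact hy'
  · have h1 := (hD.mem_iff hc hι hγ₀ h0 (D.mem_ball hz.le)).1 hy'
    exact (hD.mem_iff hc hι hγ₀ h0 (D.mem_ball (by simp [hz]))).2 (by simp [h1])

/-- A fixed core meeting the exceptional circle avoids the class of `i`, so it passes through the
class of `1`, which lies on the strict transform. -/
theorem IsReflection.eq_strictTransform [T2Space S] (hD : D.IsReflection) (hc : Continuous ι)
    (hι : Function.Involutive ι) (hγ₀ : γ₀ ∈ fixedCores ε ι) (h0 : x₀ ∈ γ₀) {ε' : ℤˣ}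
    {γ : Set D.Blowup} (hγ : γ ∈ fixedCores ε' (D.blowupMap hι)) (h : ¬ γ ⊆ D.exceptionalᶜ) :
    γ = D.proj '' (γ₀ ∩ D.ext) := by
  have hI : ‖Complex.I‖ = 1 := Complex.norm_I
  have hmem {z : ℂ} (hz : z ∈ Metric.ball (0 : ℂ) D.R) := hD.mem_iff hc hι hγ₀ h0 hz
  obtain ⟨z, hz, hzγ⟩ := exists_of_not_subset_compl h
  obtain ⟨W, hW, hγW, hfix⟩ := hD.exists_isOpen hc hι hγ₀ h0
  -- The points `e(i)` and `e(-i)` are removed from `W`, so that the fixed points in `W'` come from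
  -- `γ₀` alone.
  obtain ⟨W', hW', hsub, hcov⟩ := exists_isOpen_strictTransform (D := D) hγ₀.1
    (fun z hz => hmem hz) (W := W ∩ {D.e Complex.I, D.e (-Complex.I)}ᶜ)
    (hW.inter (toFinite _).isClosed.isOpen_compl) (by
      refine subset_inter hγW ?_
      rintro y hy (rfl | rfl)
      · simpa using (hmem (D.mem_ball hI.le)).1 hy
      · simpa using (hmem (D.mem_ball (by simp))).1 hy)
  refine fixedCores_eq_of_mem (hD.strictTransform_mem hc hι hγ₀ h0).1
    (hD.isClosed_strictTransform hc hι hγ₀ h0) hW' hsub ?_ hγ ?_ hzγ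
  · intro q hq hqfix
    obtain ⟨y, ⟨hye, hyW, hyI⟩, rfl⟩ := hcov q hq
    refine ⟨y, ⟨?_, hye⟩, rfl⟩
    rcases (D.blowupMap_fixed_iff hι hye).1 hqfix with h | ⟨v, hv, -, rfl⟩
    · exact hfix y hyW h
    · have hv' : ‖-v‖ = 1 := by simpa using hv
      rcases hD.eq_of_fixed hι (D.norm_lt_R hv'.le) hv'.ge hqfix with h | h | h
      · exact (hmem (D.mem_ball hv'.le)).2 h
      · exact absurd (Or.inl (by rw [h])) hyI
      · exact absurd (Or.inr (by rw [h]; rfl)) hyI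
  · have hI' := hD.I_notMem hι hγ
    rcases hD.eq_of_fixed hι (D.norm_lt_R hz.le) hz.ge (hγ.2 _ hzγ) with h | rfl | rfl
    · exact ⟨_, ⟨(hmem (D.mem_ball hz.le)).2 h, (D.e_mem_ext (D.norm_lt_R hz.le)).2 hz.ge⟩, rfl⟩
    · exact absurd hzγ hI'
    · rw [D.proj_e_neg hI] at hzγ
      exact absurd hzγ hI'

theorem IsReflection.encard_blowup_eq [T2Space S] (hD : D.IsReflection) (hc : Continuous ι)
    (hι : Function.Involutive ι) (hγ₀ : γ₀ ∈ fixedCores ε ι) (h0 : x₀ ∈ γ₀) :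
    (fixedCores (-ε) (D.blowupMap hι)).encard =
      {γ ∈ fixedCores (-ε) (D.blowupMap hι) | γ ⊆ D.exceptionalᶜ}.encard + 1 ∧
    {γ ∈ fixedCores ε (D.blowupMap hι) | γ ⊆ D.exceptionalᶜ}.encard =
      (fixedCores ε (D.blowupMap hι)).encard := by
  have hmem := hD.strictTransform_mem hc hι hγ₀ h0
  refine ⟨encard_eq_add_one hmem (fun h => ?_)
    fun γ hγ => hD.eq_strictTransform hc hι hγ₀ h0 hγ, ?_⟩
  · refine h ⟨D.e 1, ⟨?_, D.e_one_mem_ext⟩, rfl⟩ ⟨1, by simp, rfl⟩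
    exact (hD.mem_iff hc hι hγ₀ h0 (D.mem_ball (by simp))).2 (by simp)
  · congr 1
    ext γ
    refine ⟨fun h => h.1, fun h => ⟨h, ?_⟩⟩
    by_contra h'
    rw [hD.eq_strictTransform hc hι hγ₀ h0 h h'] at h
    exact hmem.1.not_isBandCore_neg (by simpa using h.1)

theorem IsRotation.encard_blowup_eq [T2Space S] (hD : D.IsRotation)
    (hι : Function.Involutive ι) :
    (fixedCores (-1) (D.blowupMap hι)).encard = (fixedCores (-1) ι).encard + 1 ∧
    (fixedCores 1 (D.blowupMap hι)).encard = (fixedCores 1 ι).encard := by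
  have hmem := hD.exceptional_mem hι
  rw [← hD.encard_eq, ← hD.encard_eq, ← D.encard_outer hι, ← D.encard_outer hι]
  refine ⟨encard_eq_add_one hmem (fun h => ?_) fun γ hγ => hD.eq_exceptional hι hγ, ?_⟩
  · have h1 : D.proj (D.e 1) ∈ D.exceptional := ⟨1, by simp, rfl⟩
    exact h h1 h1
  · congr 1
    ext γ
    refine ⟨fun h => ⟨h, ?_⟩, fun h => h.1⟩
    by_contra h'
    rw [hD.eq_exceptional hι h h'] at h
    exact h.1.not_isBandCore_neg hmem.1

/-- The blowup at a point of a reflection curve changes the type of the curve. -/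
theorem encard_blowup_of_mem [T2Space S] (hc : Continuous ι) (hι : Function.Involutive ι)
    (hγ₀ : γ₀ ∈ fixedCores ε ι) (h0 : x₀ ∈ γ₀) :
    (fixedCores ε (D.blowupMap hι)).encard + 1 = (fixedCores ε ι).encard ∧
    (fixedCores (-ε) (D.blowupMap hι)).encard = (fixedCores (-ε) ι).encard + 1 := by
  have hD : D.IsReflection := isReflection_of_mem hγ₀ h0
  obtain ⟨h1, h2⟩ := hD.encard_eq hc hι hγ₀ h0
  obtain ⟨h3, h4⟩ := hD.encard_blowup_eq hc hι hγ₀ h0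
  rw [← h4, h1, h3, ← h2, encard_outer, encard_outer]
  exact ⟨rfl, rfl⟩

end InvariantDisk

end Count

end SurfaceBlowup

/-- `S` is the closed non-orientable surface `N_g`; `S'` is any copy of the surface obtained by the
blowup of `S` at `x₀` (such as `N_{g+1}`). -/
theorem mainTheorem5 (g : ℕ) (hg : 1 ≤ g)
    {S : Type*} [TopologicalSpace S]
    (hS : Nonempty (S ≃ₜ SurfaceBlowup.NonorientableSurface g))
    {S' : Type*} [TopologicalSpace S']
    (ι : S → S) (hι_cont : Continuous ι) (hι : Function.Involutive ι)
    (x₀ : S) (ι' : S' → S')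
    (hblow : SurfaceBlowup.IsObtainedByBlowup ι hι x₀ ι') :
    (SurfaceBlowup.IsIsolatedFixedPoint ι x₀ →
      SurfaceBlowup.numOneSided ι' = SurfaceBlowup.numOneSided ι + 1 ∧
      SurfaceBlowup.numTwoSided ι' = SurfaceBlowup.numTwoSided ι) ∧
    ((∃ γ : Set S, SurfaceBlowup.IsReflectionCurve ι γ ∧ SurfaceBlowup.IsOneSided γ ∧ x₀ ∈ γ) →
      SurfaceBlowup.numOneSided ι' + 1 = SurfaceBlowup.numOneSided ι ∧
      SurfaceBlowup.numTwoSided ι' = SurfaceBlowup.numTwoSided ι + 1) ∧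
    ((∃ γ : Set S, SurfaceBlowup.IsReflectionCurve ι γ ∧ SurfaceBlowup.IsTwoSided γ ∧ x₀ ∈ γ) →
      SurfaceBlowup.numTwoSided ι' + 1 = SurfaceBlowup.numTwoSided ι ∧
      SurfaceBlowup.numOneSided ι' = SurfaceBlowup.numOneSided ι + 1) := by
  obtain ⟨h⟩ := hS
  have : T2Space S := T2Space.of_injective_continuous h.injective h.continuous
  obtain ⟨D, F, hF⟩ := hblow
  simp only [SurfaceBlowup.numOneSided_eq, SurfaceBlowup.numTwoSided_eq,
    SurfaceBlowup.encard_fixedCores_homeomorph F hF]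
  refine ⟨fun h0 => ?_, ?_, ?_⟩
  · exact (SurfaceBlowup.InvariantDisk.isRotation_of_isolated h0).encard_blowup_eq hι
  · rintro ⟨γ, hγ, hγ1, h0⟩
    simpa using SurfaceBlowup.InvariantDisk.encard_blowup_of_mem (D := D) hι_cont hι
      ⟨hγ1, hγ.2⟩ h0
  · rintro ⟨γ, hγ, hγ1, h0⟩
    exact SurfaceBlowup.InvariantDisk.encard_blowup_of_mem hι_cont hι ⟨hγ1, hγ.2⟩ h0
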